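/- Let $k$ be an algebraically closed field of characteristic zero, let $n \ge 0$, write $\mathbb P^n$ for projective $n$-space over $k$ and $\omega$ for its canonical sheaf (the sheaf of differential forms of top degree $n$). A *free monad* for a sheaf of $\mathcal O_{\mathbb P^n}$-modules $\mathcal G$ is a finite complex $$0 \longrightarrow \mathcal C^{a} \longrightarrow \mathcal C^{a+1} \longrightarrow \cdots \longrightarrow \mathcal C^{b} \longrightarrow 0$$ (with $\mathcal C^i = 0$ outside the range $a \le i \le b$) in which every $\mathcal C^i$ is a finite direct sum of line bundles, and which is exact except in degree $0$, where its cohomology is isomorphic to $\mathcal G$. **Lemma 3.** Let $\mathcal F$ be a coherent sheaf on $\mathbb P^n$ whose support has codimension $c \ge 1$ (in particular $\mathcal F \ne 0$), and assume that $\mathcal Ext^i(\mathcal F, \omega) = 0$ for all $i > c$. Let $$0 \longrightarrow \mathcal C^{-p} \longrightarrow \cdots \longrightarrow \mathcal C^0 \longrightarrow \cdots \longrightarrow \mathcal C^q \longrightarrow 0 \qquad (p, q \ge 0)$$ be a free monad for $\mathcal F$. Put $\mathcal C_D^i = \mathcal Hom(\mathcal C^{-i-c}, \omega)$, with the differentials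 $\mathcal C_D^i \to \mathcal C_D^{i+1}$ induced by those of $\mathcal C^\bullet$. Then the dual sequence $$0 \longrightarrow \mathcal C_D^{-q-c} \longrightarrow \cdots \longrightarrow \mathcal C_D^0 \longrightarrow \cdots \longrightarrow \mathcal C_D^{p-c} \longrightarrow 0$$ is a free monad for the dual sheaf $\mathcal F^D = \mathcal Ext^c(\mathcal F, \omega)$. -/

import Mathlib

universe u
open CategoryTheory Limits TopologicalSpace AlgebraicGeometry

noncomputable section

namespace AlgebraicGeometry.Scheme.Modules

variable {X : Scheme.{u}}

/-- A homomorphism from `M|_U` to `N|_U`: a family of `Γ(X, V)`-linear maps `Γ(M, V) → Γ(N, V)`,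
for all open `V ≤ U`, compatible with restriction. -/
@[ext]
structure LocalHom (M N : X.Modules) (U : X.Opens) : Type u where
  app (V : X.Opens) (hV : V ≤ U) : Γ(M, V) →ₗ[Γ(X, V)] Γ(N, V)
  naturality (V W : X.Opens) (hV : V ≤ U) (h : W ≤ V) (s : Γ(M, V)) :
    app W (h.trans hV) (M.presheaf.map (homOfLE h).op s) =
      N.presheaf.map (homOfLE h).op (app V hV s)

namespace LocalHom

variable {M N : X.Modules} {U : X.Opens}

instance : Zero (LocalHom M N U) := ⟨⟨fun _ _ ↦ 0, fun _ _ _ _ _ ↦ by simp⟩⟩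
instance : Add (LocalHom M N U) :=
  ⟨fun f g ↦ ⟨fun V hV ↦ f.app V hV + g.app V hV, fun V W hV h s ↦ by
    simp [f.naturality V W hV h, g.naturality V W hV h]⟩⟩
instance : Neg (LocalHom M N U) :=
  ⟨fun f ↦ ⟨fun V hV ↦ -f.app V hV, fun V W hV h s ↦ by simp [f.naturality V W hV h]⟩⟩

@[simp] lemma zero_app (V : X.Opens) (hV : V ≤ U) : (0 : LocalHom M N U).app V hV = 0 := rfl
@[simp] lemma add_app (f g : LocalHom M N U) (V : X.Opens) (hV : V ≤ U) :
    (f + g).app V hV = f.app V hV + g.app V hV := rfl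
@[simp] lemma neg_app (f : LocalHom M N U) (V : X.Opens) (hV : V ≤ U) :
    (-f).app V hV = -f.app V hV := rfl

lemma ext' {f g : LocalHom M N U} (h : ∀ V hV s, f.app V hV s = g.app V hV s) : f = g := by
  apply LocalHom.ext
  funext V hV
  exact LinearMap.ext (h V hV)

instance : AddCommGroup (LocalHom M N U) where
  add_assoc _ _ _ := ext' fun _ _ _ ↦ add_assoc _ _ _
  zero_add _ := ext' fun _ _ _ ↦ zero_add _
  add_zero _ := ext' fun _ _ _ ↦ add_zero _
  add_comm _ _ := ext' fun _ _ _ ↦ add_comm _ _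
  neg_add_cancel _ := ext' fun _ _ _ ↦ neg_add_cancel _
  nsmul := nsmulRec
  zsmul := zsmulRec

instance : SMul Γ(X, U) (LocalHom M N U) :=
  ⟨fun r f ↦ ⟨fun V hV ↦ X.presheaf.map (homOfLE hV).op r • f.app V hV, fun V W hV h s ↦ by
    have : X.presheaf.map (homOfLE (h.trans hV)).op r =
        X.presheaf.map (homOfLE h).op (X.presheaf.map (homOfLE hV).op r) := by
      rw [← CommRingCat.comp_apply, ← Functor.map_comp]; rfl
    simp [f.naturality V W hV h, this]⟩⟩

@[simp] lemma smul_app (r : Γ(X, U)) (f : LocalHom M N U) (V : X.Opens) (hV : V ≤ U) :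
    (r • f).app V hV = X.presheaf.map (homOfLE hV).op r • f.app V hV := rfl

instance : Module Γ(X, U) (LocalHom M N U) where
  one_smul _ := ext' fun _ _ _ ↦ by simp
  mul_smul _ _ _ := ext' fun _ _ _ ↦ by simp [mul_smul]
  smul_zero _ := ext' fun _ _ _ ↦ by simp
  smul_add _ _ _ := ext' fun _ _ _ ↦ by simp
  add_smul _ _ _ := ext' fun _ _ _ ↦ by simp [add_smul]
  zero_smul _ := ext' fun _ _ _ ↦ by simp

/-- The restriction of a homomorphism `M|_U ⟶ N|_U` to a smaller open set. -/
def res {U' : X.Opens} (h : U' ≤ U) : LocalHom M N U →+ LocalHom M N U' where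
  toFun f := ⟨fun V hV ↦ f.app V (hV.trans h), fun V W hV hW s ↦ f.naturality V W (hV.trans h) hW s⟩
  map_zero' := rfl
  map_add' _ _ := rfl

@[simp] lemma res_app {U' : X.Opens} (h : U' ≤ U) (f : LocalHom M N U) (V : X.Opens)
    (hV : V ≤ U') : (res h f).app V hV = f.app V (hV.trans h) := rfl

/-- Composition with homomorphisms `M' ⟶ M` and `N ⟶ N'`. -/
def comp {M' N' : X.Modules} (a : M' ⟶ M) (b : N ⟶ N') : LocalHom M N U →+ LocalHom M' N' U where
  toFun f :=
    { app V hV :=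
        { toFun s := b.app V (f.app V hV (a.app V s))
          map_add' := by simp
          map_smul' := by simp }
      naturality V W hV h s := by
        have ha := ConcreteCategory.congr_hom (a.mapPresheaf.naturality (homOfLE h).op) s
        have hb := ConcreteCategory.congr_hom (b.mapPresheaf.naturality (homOfLE h).op)
          (f.app V hV (a.app V s))
        have hf := f.naturality V W hV h (a.app V s)
        simp at ha hb
        simp [ha, ← hb, hf] }
  map_zero' := ext' fun _ _ _ ↦ by simp
  map_add' _ _ := ext' fun _ _ _ ↦ by simp

@[simp] lemma comp_app {M' N' : X.Modules} (a : M' ⟶ M) (b : N ⟶ N') (f : LocalHom M N U)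
    (V : X.Opens) (hV : V ≤ U) (s : Γ(M', V)) :
    (comp a b f).app V hV s = b.app V (f.app V hV (a.app V s)) := rfl

lemma comp_smul {M' N' : X.Modules} (a : M' ⟶ M) (b : N ⟶ N') (r : Γ(X, U))
    (f : LocalHom M N U) : comp a b (r • f) = r • comp a b f :=
  ext' fun _ _ _ ↦ by simp

end LocalHom

variable (M N : X.Modules)

/-- The presheaf of abelian groups `U ↦ Hom(M|_U, N|_U)`. -/
def homPresheaf : TopCat.Presheaf Ab.{u} X where
  obj U := AddCommGrpCat.of (LocalHom M N U.unop)
  map i := AddCommGrpCat.ofHom (LocalHom.res (leOfHom i.unop))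
  map_id _ := rfl
  map_comp _ _ := rfl

instance (U : X.Opensᵒᵖ) : Module (X.ringCatSheaf.obj.obj U) ((homPresheaf M N).obj U) :=
  inferInstanceAs (Module Γ(X, U.unop) (LocalHom M N U.unop))

lemma homPresheaf_map_smul ⦃U V : X.Opensᵒᵖ⦄ (i : U ⟶ V) (r : X.ringCatSheaf.obj.obj U)
    (m : (homPresheaf M N).obj U) :
    (homPresheaf M N).map i (r • m) = X.ringCatSheaf.obj.map i r • (homPresheaf M N).map i m := by
  have key (r : Γ(X, U.unop)) (W : X.Opens) (hW : W ≤ V.unop) :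
      X.presheaf.map (homOfLE (hW.trans (leOfHom i.unop))).op r =
        X.presheaf.map (homOfLE hW).op (X.presheaf.map i r) := by
    rw [← CommRingCat.comp_apply, ← Functor.map_comp]; rfl
  exact LocalHom.ext' (M := M) (N := N) fun W hW s ↦ congr($(key r W hW) • _)

lemma presheaf_map_map {U V W : X.Opens} (h : V ≤ U) (h' : W ≤ V) (s : Γ(M, U)) :
    M.presheaf.map (homOfLE h').op (M.presheaf.map (homOfLE h).op s) =
      M.presheaf.map (homOfLE (h'.trans h)).op s := by
  rw [← CategoryTheory.comp_apply, ← Functor.map_comp]; rfl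

lemma homPresheaf_isSheaf : TopCat.Presheaf.IsSheaf (homPresheaf M N) := by
  rw [TopCat.Presheaf.isSheaf_iff_isSheafUniqueGluing]
  intro ι U sf hsf
  let f (i : ι) : LocalHom M N (U i) := sf i
  replace hsf (i j : ι) (W : X.Opens) (hi : W ≤ U i) (hj : W ≤ U j) (s : Γ(M, W)) :
      (f i).app W hi s = (f j).app W hj s :=
    congr(LocalHom.app (M := M) (N := N) $(hsf i j) W (le_inf hi hj) s)
  have cov (V : X.Opens) (hV : V ≤ iSup U) : V ≤ ⨆ i, V ⊓ U i := by
    rw [← inf_iSup_eq]; exact le_inf le_rfl hV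
  have uniq (V : X.Opens) (hV : V ≤ iSup U) (s t : Γ(N, V))
      (h : ∀ i, N.presheaf.map (homOfLE (inf_le_left : V ⊓ U i ≤ V)).op s =
        N.presheaf.map (homOfLE (inf_le_left : V ⊓ U i ≤ V)).op t) : s = t :=
    TopCat.Sheaf.eq_of_locally_eq' ⟨N.presheaf, N.isSheaf⟩ (fun i ↦ V ⊓ U i) V
      (fun i ↦ homOfLE inf_le_left) (cov V hV) s t h
  have ex (V : X.Opens) (hV : V ≤ iSup U) (s : Γ(M, V)) : ∃ t : Γ(N, V), ∀ i (W : X.Opens)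
      (hW : W ≤ V) (hi : W ≤ U i), N.presheaf.map (homOfLE hW).op t =
        (f i).app W hi (M.presheaf.map (homOfLE hW).op s) := by
    obtain ⟨t, ht, -⟩ := TopCat.Sheaf.existsUnique_gluing' ⟨N.presheaf, N.isSheaf⟩
      (fun i ↦ V ⊓ U i) V (fun i ↦ homOfLE inf_le_left) (cov V hV)
      (fun i ↦ (f i).app (V ⊓ U i) inf_le_right
        (M.presheaf.map (homOfLE inf_le_left).op s)) (fun i j ↦ by
        have hi := (f i).naturality (V ⊓ U i) ((V ⊓ U i) ⊓ (V ⊓ U j)) inf_le_right inf_le_left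
          (M.presheaf.map (homOfLE inf_le_left).op s)
        have hj := (f j).naturality (V ⊓ U j) ((V ⊓ U i) ⊓ (V ⊓ U j)) inf_le_right inf_le_right
          (M.presheaf.map (homOfLE inf_le_left).op s)
        rw [presheaf_map_map] at hi hj
        exact hi.symm.trans ((hsf _ _ _ _ _ _).trans hj))
    replace ht (i : ι) : N.presheaf.map (homOfLE inf_le_left).op t =
      (f i).app (V ⊓ U i) inf_le_right (M.presheaf.map (homOfLE inf_le_left).op s) := ht i
    refine ⟨t, fun i W hW hi ↦ ?_⟩
    rw [← presheaf_map_map N (inf_le_left : V ⊓ U i ≤ V) (le_inf hW hi), ht,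
      ← (f i).naturality, presheaf_map_map]
  choose g hg using ex
  have hg' (V : X.Opens) (hV : V ≤ iSup U) (s : Γ(M, V)) (t : Γ(N, V))
      (h : ∀ i, N.presheaf.map (homOfLE (inf_le_left : V ⊓ U i ≤ V)).op t =
        (f i).app (V ⊓ U i) inf_le_right (M.presheaf.map (homOfLE inf_le_left).op s)) :
      g V hV s = t :=
    uniq V hV _ _ fun i ↦ by rw [h, hg V hV s i]
  let φ : LocalHom M N (iSup U) :=
    { app V hV :=
        { toFun := g V hV
          map_add' a b := hg' _ _ _ _ fun i ↦ by
            simp [hg V hV _ i (V ⊓ U i) inf_le_left inf_le_right]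
          map_smul' r a := hg' _ _ _ _ fun i ↦ by
            simp [hg V hV _ i (V ⊓ U i) inf_le_left inf_le_right] }
      naturality V W hV h s := hg' _ _ _ _ fun i ↦ by
        rw [presheaf_map_map]
        erw [hg V hV s i (W ⊓ U i) (inf_le_left.trans h) inf_le_right]
        rw [presheaf_map_map] }
  refine ⟨φ, fun i ↦ LocalHom.ext' (M := M) (N := N) fun V hV s ↦ ?_, fun ψ hψ ↦
    LocalHom.ext' (M := M) (N := N) fun V hV s ↦ (hg' V hV s _ fun i ↦ ?_).symm⟩
  · have := hg V (hV.trans (le_iSup U i)) s i V le_rfl hV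
    simp only [homOfLE_refl, op_id, CategoryTheory.Functor.map_id] at this
    exact this
  · let ψ' : LocalHom M N (iSup U) := ψ
    have h1 := ψ'.naturality V (V ⊓ U i) hV inf_le_left s
    have h2 : ψ'.app (V ⊓ U i) (inf_le_left.trans hV) (M.presheaf.map (homOfLE inf_le_left).op s) =
        (f i).app (V ⊓ U i) inf_le_right (M.presheaf.map (homOfLE inf_le_left).op s) :=
      congr(LocalHom.app (M := M) (N := N) $(hψ i) (V ⊓ U i) inf_le_right
        (M.presheaf.map (homOfLE inf_le_left).op s))
    exact h1.symm.trans h2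

/-- The sheaf `ℋom(M, N)` of `𝒪_X`-linear homomorphisms, `U ↦ Hom(M|_U, N|_U)`. -/
def sheafHom : X.Modules :=
  { val := PresheafOfModules.ofPresheaf (homPresheaf M N) (homPresheaf_map_smul M N)
    isSheaf := homPresheaf_isSheaf M N }

variable {M N}

/-- The morphism `ℋom(M, N) ⟶ ℋom(M', N')` induced by `M' ⟶ M` and `N ⟶ N'`. -/
def sheafHomMap {M' N' : X.Modules} (a : M' ⟶ M) (b : N ⟶ N') :
    sheafHom M N ⟶ sheafHom M' N' :=
  (⟨PresheafOfModules.homMk (M₁ := (sheafHom M N).val) (M₂ := (sheafHom M' N').val)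
    { app _ := AddCommGrpCat.ofHom (LocalHom.comp a b)
      naturality _ _ _ := rfl }
    (fun _ r m ↦ LocalHom.comp_smul a b r m)⟩ : SheafOfModules.Hom _ _)

lemma sheafHom_ext {P : X.Modules} {f g : P ⟶ sheafHom M N}
    (h : ∀ (U : X.Opens) (p : Γ(P, U)) (V : X.Opens) (hV : V ≤ U) (s : Γ(M, V)),
      LocalHom.app (M := M) (N := N) (f.app U p) V hV s =
        LocalHom.app (M := M) (N := N) (g.app U p) V hV s) : f = g := by
  apply hom_ext
  intro U
  ext p
  exact LocalHom.ext' (M := M) (N := N) (h U p)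

lemma sheafHomMap_id : sheafHomMap (𝟙 M) (𝟙 N) = 𝟙 _ := rfl

lemma sheafHomMap_comp {M' N' M'' N'' : X.Modules} (a : M' ⟶ M) (b : N ⟶ N')
    (a' : M'' ⟶ M') (b' : N' ⟶ N'') :
    sheafHomMap a b ≫ sheafHomMap a' b' = sheafHomMap (a' ≫ a) (b ≫ b') := rfl

lemma sheafHomMap_zero_left {M' N' : X.Modules} (b : N ⟶ N') :
    sheafHomMap (0 : M' ⟶ M) b = 0 :=
  sheafHom_ext fun U p V hV s ↦ by
    let p' : LocalHom M N U := p
    change b.app V (p'.app V hV ((0 : M' ⟶ M).app V s)) = 0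
    simp

lemma sheafHomMap_add_right {M' N' : X.Modules} (a : M' ⟶ M) (b b' : N ⟶ N') :
    sheafHomMap a (b + b') = sheafHomMap a b + sheafHomMap a b' := rfl

variable (M) in
/-- The functor `ℋom(M, -)`. -/
def sheafHomFunctor : X.Modules ⥤ X.Modules where
  obj N := sheafHom M N
  map b := sheafHomMap (𝟙 M) b
  map_id _ := rfl
  map_comp _ _ := rfl

instance : (sheafHomFunctor M).Additive where
  map_add := sheafHomMap_add_right _ _ _

variable (X) in
/-- The category of `𝒪_X`-modules is a Grothendieck abelian category. -/
instance : IsGrothendieckAbelian.{u} X.Modules := by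
  let adj := PresheafOfModules.sheafificationAdjunction (𝟙 X.ringCatSheaf.obj)
  have h1 : AB5OfSize.{u, u} X.PresheafOfModules :=
    ⟨fun K _ _ ↦ HasExactColimitsOfShape.domain_of_functor K (PresheafOfModules.toPresheaf _)⟩
  have h2 : AB5OfSize.{u, u} (SheafOfModules.{u} X.ringCatSheaf) :=
    ⟨fun K _ _ ↦ adj.hasExactColimitsOfShape K⟩
  have h3 : ObjectProperty.IsSeparating (C := SheafOfModules.{u} X.ringCatSheaf)
      (.ofObj fun U : X.Opens ↦ (PresheafOfModules.sheafification (𝟙 X.ringCatSheaf.obj)).obj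
        ((PresheafOfModules.free _).obj (yoneda.obj U))) := by
    intro M N f g h
    refine (SheafOfModules.forget _).map_injective
      (PresheafOfModules.freeYoneda.isSeparating _ _ _ ?_)
    rintro _ ⟨U⟩ a
    have key (x : SheafOfModules.{u} X.ringCatSheaf) (p : M ⟶ x) :=
      adj.homEquiv_naturality_right ((adj.homEquiv _ _).symm a) p
    have hfg := (key N f).symm.trans
      (congr(adj.homEquiv _ _ $(h _ ⟨U⟩ ((adj.homEquiv _ _).symm a))).trans (key N g))
    have e := (adj.homEquiv ((PresheafOfModules.free _).obj (yoneda.obj U)) M).apply_symm_apply a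
    exact (congr($e ≫ (SheafOfModules.forget _).map f).symm.trans hfg).trans
      congr($e ≫ (SheafOfModules.forget _).map g)
  have h4 : HasSeparator (SheafOfModules.{u} X.ringCatSheaf) := ⟨_, h3.isSeparator_coproduct⟩
  exact (IsGrothendieckAbelian.mk : IsGrothendieckAbelian.{u} (SheafOfModules.{u} X.ringCatSheaf))

/-- The sheaf `ℰxt^i(M, N)`: the `i`-th right derived functor of `ℋom(M, -)`, applied to `N`. -/
def sheafExt (i : ℕ) (M N : X.Modules) : X.Modules :=
  ((sheafHomFunctor M).rightDerived i).obj N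

end AlgebraicGeometry.Scheme.Modules

section exteriorPower

variable {A B M N Q : Type*} [CommRing A] [CommRing B] [AddCommGroup M] [AddCommGroup N]
  [AddCommGroup Q] [Module A M] [Module B N] [Module B Q] {φ : A →+* B}

/-- The semilinear map `⋀ⁿ_A M → ⋀ⁿ_B N` sending `m₁ ∧ ⋯ ∧ mₙ` to `f m₁ ∧ ⋯ ∧ f mₙ`, for a
semilinear map `f : M → N`; more generally, with any alternating map on `N` in place of `∧`. -/
def exteriorPower.semilinearDesc (f : M →ₛₗ[φ] N) {n : ℕ} (g : N [⋀^Fin n]→ₗ[B] Q) :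
    ⋀[A]^n M →ₛₗ[φ] Q :=
  letI : Module A Q := Module.compHom Q φ
  let h : M [⋀^Fin n]→ₗ[A] Q :=
    { toFun x := g (f ∘ x)
      map_update_add' x i a b := by
        have hu (c) : f ∘ Function.update x i c = Function.update (f ∘ x) i (f c) :=
          Function.comp_update _ _ _ _
        have hd : ‹DecidableEq (Fin n)› = instDecidableEqFin n := Subsingleton.elim _ _
        subst hd
        simp [hu]
      map_update_smul' x i r a := by
        have hu (c) : f ∘ Function.update x i c = Function.update (f ∘ x) i (f c) :=
          Function.comp_update _ _ _ _
        have hd : ‹DecidableEq (Fin n)› = instDecidableEqFin n := Subsingleton.elim _ _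
        subst hd
        simp only [hu, map_smulₛₗ, AlternatingMap.map_update_smul]
        rfl
      map_eq_zero_of_eq' x i j hx hij := g.map_eq_zero_of_eq _ (by simp [hx]) hij }
  let l := exteriorPower.alternatingMapLinearEquiv h
  { toFun := l
    map_add' := l.map_add
    map_smul' := l.map_smul }

@[simp]
lemma exteriorPower.semilinearDesc_ιMulti (f : M →ₛₗ[φ] N) {n : ℕ} (g : N [⋀^Fin n]→ₗ[B] Q)
    (x : Fin n → M) :
    exteriorPower.semilinearDesc f g (exteriorPower.ιMulti A n x) = g (f ∘ x) := by
  let _ : Module A Q := Module.compHom Q φ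
  exact exteriorPower.alternatingMapLinearEquiv_apply_ιMulti _ _

lemma exteriorPower.induction_on_ιMulti {n : ℕ} {p : ⋀[A]^n M → Prop} (x : ⋀[A]^n M)
    (zero : p 0) (add : ∀ x y, p x → p y → p (x + y)) (smul : ∀ (a : A) x, p x → p (a • x))
    (wedge : ∀ x, p (exteriorPower.ιMulti A n x)) : p x := by
  have hx : x ∈ Submodule.span A (Set.range (exteriorPower.ιMulti A n (M := M))) := by
    rw [exteriorPower.ιMulti_span]; trivial
  induction hx using Submodule.span_induction with
  | mem x h => obtain ⟨y, rfl⟩ := h; exact wedge y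
  | zero => exact zero
  | add x y _ _ hx hy => exact add x y hx hy
  | smul a x _ hx => exact smul a x hx

end exteriorPower

namespace PresheafOfModules

variable {D : Type*} [Category* D] {R : Dᵒᵖ ⥤ CommRingCat.{u}}

section exteriorPower

variable (P : PresheafOfModules.{u} (R ⋙ forget₂ CommRingCat RingCat)) (n : ℕ)

/-- The map `⋀ⁿ P(U) → ⋀ⁿ P(V)` induced by `P(U) → P(V)`. -/
def exteriorPowerRes {U V : Dᵒᵖ} (f : U ⟶ V) :
    ⋀[R.obj U]^n (P.obj U) →ₛₗ[(R.map f).hom] ⋀[R.obj V]^n (P.obj V) :=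
  exteriorPower.semilinearDesc (φ := (R.map f).hom) (A := R.obj U) (B := R.obj V)
    (P.restrictₛₗ f) (exteriorPower.ιMulti (R.obj V) n)

@[simp]
lemma exteriorPowerRes_ιMulti {U V : Dᵒᵖ} (f : U ⟶ V) (x : Fin n → P.obj U) :
    P.exteriorPowerRes n f (exteriorPower.ιMulti (R.obj U) n x) =
      exteriorPower.ιMulti (R.obj V) n (P.restrictₛₗ f ∘ x) :=
  exteriorPower.semilinearDesc_ιMulti _ _ _

lemma exteriorPowerRes_id (U : Dᵒᵖ) (x : ⋀[R.obj U]^n (P.obj U)) :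
    P.exteriorPowerRes n (𝟙 U) x = x := by
  induction x using exteriorPower.induction_on_ιMulti with
  | zero => simp
  | add x y hx hy => simp [hx, hy]
  | smul a x hx => simp [map_smulₛₗ, hx]
  | wedge x =>
    refine (P.exteriorPowerRes_ιMulti n _ x).trans
      (congrArg (exteriorPower.ιMulti (R.obj U) n) (funext fun i ↦ ?_))
    change P.presheaf.map (𝟙 U) (x i) = x i
    rw [CategoryTheory.Functor.map_id]
    rfl

lemma exteriorPowerRes_comp {U V W : Dᵒᵖ} (f : U ⟶ V) (g : V ⟶ W)
    (x : ⋀[R.obj U]^n (P.obj U)) :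
    P.exteriorPowerRes n (f ≫ g) x = P.exteriorPowerRes n g (P.exteriorPowerRes n f x) := by
  induction x using exteriorPower.induction_on_ιMulti with
  | zero => simp
  | add x y hx hy => simp [hx, hy]
  | smul a x hx => simp [map_smulₛₗ, hx]
  | wedge x =>
    refine ((P.exteriorPowerRes_ιMulti n _ x).trans ((congrArg (exteriorPower.ιMulti (R.obj W) n)
      (funext fun i ↦ ?_)).trans (P.exteriorPowerRes_ιMulti n g _).symm)).trans
      (congrArg (P.exteriorPowerRes n g) (P.exteriorPowerRes_ιMulti n f x)).symm
    exact map_comp_apply P f g (x i)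

/-- The `n`-th exterior power of a presheaf of modules: `U ↦ ⋀ⁿ P(U)`. -/
def exteriorPower : PresheafOfModules.{u} (R ⋙ forget₂ CommRingCat RingCat) :=
  letI F : Dᵒᵖ ⥤ Ab.{u} :=
    { obj U := AddCommGrpCat.of (⋀[R.obj U]^n (P.obj U))
      map f := AddCommGrpCat.ofHom (P.exteriorPowerRes n f).toAddMonoidHom
      map_id U := ConcreteCategory.hom_ext _ _ fun x ↦ P.exteriorPowerRes_id n U x
      map_comp f g := ConcreteCategory.hom_ext _ _ fun x ↦ P.exteriorPowerRes_comp n f g x }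
  letI (U : Dᵒᵖ) : Module ((R ⋙ forget₂ CommRingCat RingCat).obj U) (F.obj U) :=
    inferInstanceAs (Module (R.obj U) (⋀[R.obj U]^n (P.obj U)))
  ofPresheaf F (fun _ _ f r m ↦ (P.exteriorPowerRes n f).map_smulₛₗ r m)

end exteriorPower

end PresheafOfModules

namespace AlgebraicGeometry.Scheme

/-- The pullback `k → Γ(X, U)`, as a morphism from a constant presheaf,
for a scheme `X` over `Spec k`. -/
def constantsToPresheaf {k : CommRingCat.{u}} {X : Scheme.{u}} (f : X ⟶ Spec k) :
    (Functor.const X.Opensᵒᵖ).obj k ⟶ X.presheaf where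
  app U := (ΓSpecIso k).inv ≫ f.appTop ≫ X.presheaf.map (homOfLE le_top).op
  naturality U V i := by
    simp only [Functor.const_obj_obj, Functor.const_obj_map, Category.id_comp, Category.assoc,
      ← Functor.map_comp]
    rfl

/-- The sheaf `Ω^n_{X/k}` of relative differential forms of degree `n` for a scheme `X` over
`Spec k`: the sheaf associated to the presheaf `U ↦ ⋀ⁿ Ω_{Γ(X, U)/k}` of exterior powers of
Kähler differentials. -/
def differentialForms {k : CommRingCat.{u}} {X : Scheme.{u}} (f : X ⟶ Spec k) (n : ℕ) :
    X.Modules :=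
  (PresheafOfModules.sheafification (𝟙 X.ringCatSheaf.obj)).obj
    ((PresheafOfModules.DifferentialsConstruction.relativeDifferentials'
      (constantsToPresheaf f)).exteriorPower n)

end AlgebraicGeometry.Scheme

namespace AlgebraicGeometry

attribute [local instance] MvPolynomial.gradedAlgebra

/-- The projective space `ℙⁿ` over `k`, i.e. `Proj k[x₀, …, xₙ]`. -/
def projectiveSpace (k : Type u) [CommRing k] (n : ℕ) : Scheme.{u} :=
  Proj (MvPolynomial.homogeneousSubmodule (Fin (n + 1)) k)

/-- The structure morphism `ℙⁿ ⟶ Spec k`. -/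
def projectiveSpace.toSpec (k : Type u) [CommRing k] (n : ℕ) : projectiveSpace k n ⟶ Spec (.of k) :=
  Proj.toSpecZero (MvPolynomial.homogeneousSubmodule (Fin (n + 1)) k) ≫
    Spec.map (CommRingCat.ofHom
      (algebraMap k (MvPolynomial.homogeneousSubmodule (Fin (n + 1)) k 0)))

/-- The canonical sheaf `ω` of `ℙⁿ`: the sheaf of differential forms of top degree `n`. -/
def projectiveSpace.canonicalSheaf (k : Type u) [CommRing k] (n : ℕ) : (projectiveSpace k n).Modules :=
  Scheme.differentialForms (projectiveSpace.toSpec k n) n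

namespace Scheme.Modules

variable {X : Scheme.{u}}

/-- Coherent sheaves on a locally Noetherian scheme: the `𝒪_X`-modules that are locally
the cokernel of a homomorphism between free `𝒪_X`-modules of finite rank. -/
def IsCoherent (M : X.Modules) : Prop :=
  SheafOfModules.IsFinitePresentation (R := X.ringCatSheaf) M

/-- The support of `M`: the points where the stalk is nonzero. -/
def support (M : X.Modules) : Set X :=
  {x | Nontrivial (M.presheaf.stalk x)}

/-- A line bundle: an `𝒪_X`-module that is locally isomorphic to `𝒪_X`. -/
def IsLineBundle (L : X.Modules) : Prop :=
  ∀ x : X, ∃ U : X.Opens, x ∈ U ∧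
    Nonempty (L.restrict U.ι ≅ SheafOfModules.unit (U : Scheme.{u}).ringCatSheaf)

/-- `M` is a finite direct sum of line bundles. -/
def IsSumOfLineBundles (M : X.Modules) : Prop :=
  ∃ (m : ℕ) (L : Fin m → X.Modules), (∀ j, (L j).IsLineBundle) ∧ Nonempty (M ≅ ∐ L)

/-- `C` is a free monad for `M`, with terms in degrees `a` to `b`: a complex
`0 ⟶ C^a ⟶ ⋯ ⟶ C^b ⟶ 0` whose terms are finite direct sums of line bundles, and which is exact
except in degree `0`, where the cohomology is `M`. -/
structure IsFreeMonad (C : CochainComplex X.Modules ℤ) (a b : ℤ) (M : X.Modules) : Prop where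
  isSumOfLineBundles (i : ℤ) : (C.X i).IsSumOfLineBundles
  isZero_of_lt (i : ℤ) (hi : i < a) : IsZero (C.X i)
  isZero_of_gt (i : ℤ) (hi : b < i) : IsZero (C.X i)
  exactAt (i : ℤ) (hi : i ≠ 0) : C.ExactAt i
  nonempty_iso : Nonempty (C.homology 0 ≅ M)

/-- The complex with terms `ℋom(C^{-i-c}, N)` in degree `i`, and with the differentials
`ℋom(C^{-i-c}, N) ⟶ ℋom(C^{-(i+1)-c}, N)` induced by the differentials of `C`. -/
def dualComplex (C : CochainComplex X.Modules ℤ) (N : X.Modules) (c : ℤ) :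
    CochainComplex X.Modules ℤ where
  X i := sheafHom (C.X (-i - c)) N
  d i j := sheafHomMap (C.d (-j - c) (-i - c)) (𝟙 N)
  shape i j hij := by
    rw [C.shape _ _ fun h ↦ hij (by simp only [ComplexShape.up_Rel] at h ⊢; omega)]
    exact sheafHomMap_zero_left _
  d_comp_d' i j k _ _ := by
    rw [sheafHomMap_comp, C.d_comp_d, Category.comp_id]
    exact sheafHomMap_zero_left _

end Scheme.Modules

end AlgebraicGeometry

/-- The codimension of a subset `Z` of a topological space `T`: the infimum, over the irreducible
closed subsets `Y ⊆ Z`, of the codimension of `Y` in `T`, which is the supremum of the lengths of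
chains `Y ⊂ Y₁ ⊂ ⋯ ⊂ Yₗ` of irreducible closed subsets of `T`. It is `⊤` if `Z` is empty. -/
def topologicalCodim {T : Type*} [TopologicalSpace T] (Z : Set T) : ℕ∞ :=
  ⨅ (Y : IrreducibleCloseds T) (_ : (Y : Set T) ⊆ Z), Order.coheight Y

end

/-! The dual complex has the term ℋom(C^{-i-c}, ω) in degree `i`. The sheaf ω is a line bundle,
because it is generated by dY₁ ∧ ⋯ ∧ dYₙ on each standard chart. Hence the dual terms are again sums
of line bundles, their range is the mirror image of the given one, and only the cohomology needs an
argument.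

Degrees `i` with `i + c ≥ 1`: the sheaves C^m are locally free, so ℰxt^j(C^m, ω) = 0 for j > 0, and
dimension shifting along the cokernels of the differentials identifies the cohomology in degree `i`
with ℰxt^{i+c}(F, ω) (`nonempty_homology_dualComplex_iso`). As `c ≥ 1`, this gives the dual sheaf in
degree `0`, and the hypothesis on ℰxt kills the positive degrees. The long exact sequences in the
first variable come from the exactness of ℋom(-, I) for injective I, which rests on extension by
zero (`LocalHom.exists_extension`).

Degrees `i < 0`: this is a grade argument on stalks (`exactAt_dualComplex_of_lt`). The annihilator
of the stalk of F at x has height at least `c`, and therefore contains a regular sequence of length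
`c` (`exists_isWeaklyRegular_annihilates`). An element killing the cohomology of a bounded above
complex of projectives, exact outside degree `0`, acts on it null-homotopically. Induction on the
length of the sequence then shows that the dual complex of modules is exact in degrees below `c`
(`exists_comp_eq_of_isWeaklyRegular`). Local bases carry this back to sheaves, so stalks of ℰxt
never occur.

The height bound holds because a prime minimal over the annihilator corresponds to a generization y
of x whose closure lies in the support. The regular sequence is first built in a polynomial ring
(`MvPolynomial.exists_isWeaklyRegular_of_le_height`), by Nagata's change of variables and induction
on the number of variables, and is then localized. -/

noncomputable section

/-! ### Nagata's change of variables -/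

section Nagata

open Polynomial MvPolynomial

variable {k : Type*} [Field k] {n : ℕ}

namespace MvPolynomial

/-- The substitution `X₀ ↦ X₀`, `Xᵢ ↦ Xᵢ + c X₀ ^ (Nⁱ)` for `i ≠ 0`. -/
def nagataHom (N : ℕ) (c : k) :
    MvPolynomial (Fin (n + 1)) k →ₐ[k] MvPolynomial (Fin (n + 1)) k :=
  aeval fun i ↦ if i = 0 then X 0 else X i + c • X 0 ^ N ^ i.1

lemma nagataHom_comp_neg (N : ℕ) (c : k) :
    (nagataHom (n := n) N c).comp (nagataHom N (-c)) = AlgHom.id _ _ := by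
  rw [nagataHom, nagataHom, comp_aeval, ← MvPolynomial.aeval_X_left]
  ext i v
  cases i using Fin.cases <;> simp

/-- The automorphism of the polynomial ring given by `MvPolynomial.nagataHom`. -/
def nagataEquiv (N : ℕ) :
    MvPolynomial (Fin (n + 1)) k ≃ₐ[k] MvPolynomial (Fin (n + 1)) k :=
  AlgEquiv.ofAlgHom (nagataHom N 1) (nagataHom N (-1)) (nagataHom_comp_neg N 1)
    (by simpa using nagataHom_comp_neg (k := k) (n := n) N (-1))

lemma nagataEquiv_apply (N : ℕ) (f : MvPolynomial (Fin (n + 1)) k) :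
    nagataEquiv N f = nagataHom N 1 f := rfl

/-- The exponents are digits in base `N`, and digits of bounded length determine the number. -/
lemma sum_pow_mul_ne {N : ℕ} (hN : 1 < N) {v w : Fin (n + 1) →₀ ℕ} (hv : ∀ i, v i < N)
    (hw : ∀ i, w i < N) (ne : v ≠ w) :
    ∑ i : Fin (n + 1), N ^ i.1 * v i ≠ ∑ i : Fin (n + 1), N ^ i.1 * w i := by
  intro h
  refine ne <| Finsupp.ext <| congrFun <| List.ofFn_inj.mp ?_
  apply Nat.ofDigits_inj_of_len_eq hN (by simp)
    (fun l hl ↦ by obtain ⟨i, rfl⟩ := (List.mem_ofFn' _ _).mp hl; exact hv i)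
    (fun l hl ↦ by obtain ⟨i, rfl⟩ := (List.mem_ofFn' _ _).mp hl; exact hw i)
  simpa only [Nat.ofDigits_eq_sum_mapIdx, List.mapIdx_eq_ofFn, List.get_ofFn, List.length_ofFn,
    Fin.val_cast, mul_comm, List.sum_ofFn] using! h

lemma finSuccEquiv_nagataHom_X_leadingCoeff {N : ℕ} (hN : 1 < N) (i : Fin (n + 1)) :
    (finSuccEquiv k n (nagataHom N 1 (X i))).leadingCoeff = 1 := by
  cases i using Fin.cases with
  | zero => simp [nagataHom, finSuccEquiv_X_zero]
  | succ j =>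
    simp only [nagataHom, aeval_X, Fin.succ_ne_zero, ite_false, one_smul, map_add, map_pow,
      finSuccEquiv_X_succ, finSuccEquiv_X_zero, Fin.val_succ]
    rw [add_comm, leadingCoeff_X_pow_add_C (by positivity)]

lemma finSuccEquiv_nagataHom_X_natDegree {N : ℕ} (i : Fin (n + 1)) :
    (finSuccEquiv k n (nagataHom N 1 (X i))).natDegree = N ^ i.1 := by
  cases i using Fin.cases with
  | zero => simp [nagataHom, finSuccEquiv_X_zero]
  | succ j =>
    simp only [nagataHom, aeval_X, Fin.succ_ne_zero, ite_false, one_smul, map_add, map_pow,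
      finSuccEquiv_X_succ, finSuccEquiv_X_zero, Fin.val_succ]
    rw [add_comm, natDegree_X_pow_add_C]

/-- Each variable `X i` becomes monic of degree `N ^ i` in the first variable, including `i = 0`,
and leading coefficients and degrees multiply out over a domain. -/
lemma finSuccEquiv_nagataHom_monomial {N : ℕ} (hN : 1 < N) (v : Fin (n + 1) →₀ ℕ) (a : k) :
    (finSuccEquiv k n (nagataHom N 1 (monomial v a))).leadingCoeff = C a ∧
      (a ≠ 0 → (finSuccEquiv k n (nagataHom N 1 (monomial v a))).natDegree =
        ∑ i, N ^ i.1 * v i) := by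
  have hX (i : Fin (n + 1)) : finSuccEquiv k n (nagataHom N 1 (X i)) ≠ 0 := fun h ↦ by
    simpa [h] using finSuccEquiv_nagataHom_X_leadingCoeff (k := k) hN i
  have hC : finSuccEquiv k n (nagataHom N 1 (C a)) = Polynomial.C (C a) := by
    rw [algHom_C, algebraMap_eq]
    simp [finSuccEquiv_apply]
  rw [monomial_eq, Finsupp.prod_fintype _ _ fun i ↦ pow_zero _]
  simp only [map_mul, map_prod, map_pow, hC]
  constructor
  · simp [leadingCoeff_mul, leadingCoeff_prod, finSuccEquiv_nagataHom_X_leadingCoeff hN]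
  · intro ha
    rw [natDegree_mul (by simpa using ha) (Finset.prod_ne_zero_iff.mpr fun i _ ↦
      pow_ne_zero _ (hX i)), natDegree_prod _ _ fun i _ ↦ pow_ne_zero _ (hX i)]
    simp [natDegree_pow, finSuccEquiv_nagataHom_X_natDegree, mul_comm]

/-- **Nagata**: after a change of coordinates, a nonzero polynomial over a field is monic, up to a
unit, in the first variable. -/
theorem isUnit_leadingCoeff_finSuccEquiv_nagataEquiv {f : MvPolynomial (Fin (n + 1)) k}
    (hf : f ≠ 0) :
    IsUnit (finSuccEquiv k n (nagataEquiv (2 + f.totalDegree) f)).leadingCoeff := by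
  -- `N` exceeds every exponent occurring in `f`; the summand `2` keeps `1 < N` when `f` is
  -- constant.
  set N := 2 + f.totalDegree
  have hN : 1 < N := by omega
  set h := fun w ↦ finSuccEquiv k n (nagataEquiv N (monomial w (coeff w f)))
  -- Distinct monomials of `f` acquire distinct degrees in the first variable, so exactly one of
  -- them, `v`, supplies the leading term, and its leading coefficient is a nonzero constant.
  obtain ⟨v, hv, hmax⟩ := Finset.exists_max_image f.support
    (fun w ↦ (h w).natDegree) (support_nonempty.mpr hf)
  have hlt (w : Fin (n + 1) →₀ ℕ) (hw : w ∈ f.support) (i : Fin (n + 1)) : w i < N :=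
    ((monomial_le_degreeOf i hw).trans (degreeOf_le_totalDegree f i)).trans_lt (by omega)
  have hdeg (w : Fin (n + 1) →₀ ℕ) (hw : w ∈ f.support) :
      (h w).natDegree = ∑ i, N ^ i.1 * w i :=
    (finSuccEquiv_nagataHom_monomial hN w _).2 (mem_support_iff.mp hw)
  have hv0 : h v ≠ 0 := by
    simpa [h] using mem_support_iff.mp hv
  have hsum : (∑ w ∈ f.support \ {v}, h w).degree < (h v).degree := by
    refine (degree_sum_le _ _).trans_lt ((Finset.sup_lt_iff
      (Ne.bot_lt fun hb ↦ hv0 (degree_eq_bot.mp hb))).mpr fun w hw ↦ ?_)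
    obtain ⟨hw1, hw2⟩ := Finset.mem_sdiff.mp hw
    refine degree_lt_degree (lt_of_le_of_ne (hmax w hw1) ?_)
    rw [hdeg w hw1, hdeg v hv]
    exact sum_pow_mul_ne hN (hlt w hw1) (hlt v hv) (by simpa using hw2)
  have heq : finSuccEquiv k n (nagataEquiv N f) = ∑ w ∈ f.support \ {v}, h w + h v := by
    conv_lhs => rw [← f.support_sum_monomial_coeff]
    rw [map_sum, map_sum, Finset.sum_eq_add_sum_sdiff_singleton_of_mem hv, add_comm]
  rw [heq, leadingCoeff_add_of_degree_lt hsum]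
  have := (finSuccEquiv_nagataHom_monomial hN v (coeff v f)).1
  rw [← nagataEquiv_apply] at this
  rw [this]
  exact (mem_support_iff.mp hv).isUnit.map C

end MvPolynomial

end Nagata

/-! ### Heights of ideals in `A[X]` and of their contractions to `A` -/

section Height

open Polynomial

-- Inverting the nonzero constants preserves the height of such a prime and leads to `K[X]`, which
-- has dimension one.
attribute [local instance] Polynomial.algebra Polynomial.isLocalization in
lemma Polynomial.height_le_one_of_comap_C_eq_bot {D : Type*} [CommRing D] [IsDomain D]
    (P : Ideal D[X]) [P.IsPrime] (h : P.comap C = ⊥) : P.height ≤ 1 := by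
  let K := FractionRing D
  have disj : Disjoint (((nonZeroDivisors D).map C : Submonoid D[X]) : Set D[X]) P := by
    refine Set.disjoint_left.mpr ?_
    rintro _ ⟨b, hb, rfl⟩ ha
    have : b ∈ P.comap C := ha
    rw [h] at this
    exact nonZeroDivisors.ne_zero hb this
  rw [← IsLocalization.height_map_of_disjoint (S := K[X]) _ P disj]
  have hp := IsLocalization.isPrime_of_isPrime_disjoint _ K[X] P ‹_› disj
  have h1 := Ideal.height_le_ringKrullDim_of_ne_top hp.ne_top
  rw [Polynomial.ringKrullDim_of_isNoetherianRing, ringKrullDim_eq_zero_of_field, zero_add] at h1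
  exact_mod_cast h1

/-- The height of `P` is at most the height of `p` plus that of `P / p A[X]`, and the latter is a
prime of `(A / p)[X]` meeting the constants in zero. -/
lemma Polynomial.height_le_height_comap_C_add_one {A : Type*} [CommRing A] [IsNoetherianRing A]
    (P : Ideal A[X]) [P.IsPrime] : P.height ≤ (P.comap C).height + 1 := by
  set p := P.comap (C : A →+* A[X]) with hp
  have : P.LiesOver p := ⟨hp⟩
  refine (Ideal.height_le_height_add_of_liesOver p P).trans (add_le_add_right ?_ _)
  let e : (A[X] ⧸ (p.map (algebraMap A A[X]))) ≃+* (A ⧸ p)[X] :=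
    (Ideal.polynomialQuotientEquivQuotientPolynomial p).symm
  have hle : p.map (algebraMap A A[X]) ≤ P := Ideal.map_comap_le
  have hP1 : (P.map (Ideal.Quotient.mk (p.map (algebraMap A A[X])))).IsPrime :=
    Ideal.map_isPrime_of_surjective Ideal.Quotient.mk_surjective (by rwa [Ideal.mk_ker])
  rw [← e.height_map]
  have hP2 := Ideal.map_isPrime_of_equiv e (I := P.map (Ideal.Quotient.mk (p.map (algebraMap A A[X]))))
  refine Polynomial.height_le_one_of_comap_C_eq_bot _ (eq_bot_iff.mpr fun x hx ↦ ?_)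
  obtain ⟨a, rfl⟩ := Ideal.Quotient.mk_surjective x
  rw [Ideal.mem_comap, ← Ideal.comap_symm, Ideal.mem_comap] at hx
  have h3 : e.symm (C (Ideal.Quotient.mk p a)) = Ideal.Quotient.mk _ (C a) := by
    rw [RingEquiv.symm_apply_eq]
    simp [e]
  erw [h3] at hx
  rw [Ideal.mem_quotient_iff_mem hle] at hx
  exact Ideal.Quotient.eq_zero_iff_mem.mpr hx

/-- A monic element makes `A[X] ⧸ J` integral over `A`, so by lying over each minimal prime `q` of
the contraction is itself the contraction of a prime containing `J`. The case of primes then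
applies. -/
lemma Polynomial.height_le_height_comap_C_add_one_of_monic {A : Type*} [CommRing A]
    [IsNoetherianRing A] (J : Ideal A[X]) {g : A[X]} (hg : g.Monic) (hgJ : g ∈ J) :
    J.height ≤ (J.comap C).height + 1 := by
  rw [(J.comap C).height_eq_inf_minimalPrimes, ENat.iInf_add]
  refine le_iInf fun q ↦ ?_
  by_cases hq : q ∈ (J.comap C).minimalPrimes
  · simp only [hq, ciInf_pos]
    have := hq.isPrime
    have : Algebra.IsIntegral A (A[X] ⧸ J) := ⟨hg.quotient_isIntegral hgJ⟩
    obtain ⟨Q, -, hQ, hQq⟩ := Ideal.exists_ideal_over_prime_of_isIntegral q (⊥ : Ideal (A[X] ⧸ J)) (by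
      refine le_trans (fun a ha ↦ ?_) hq.1.2
      have h : Ideal.Quotient.mk J (C a) = 0 := ha
      exact Ideal.mem_comap.mpr (Ideal.Quotient.eq_zero_iff_mem.mp h))
    let P := Q.comap (Ideal.Quotient.mk J)
    have hP : J ≤ P := fun a ha ↦ by
      rw [Ideal.mem_comap, Ideal.Quotient.eq_zero_iff_mem.mpr ha]; exact Q.zero_mem
    have hPq : P.comap C = q := by rw [← hQq]; rfl
    rw [← hPq]
    exact (Ideal.height_mono hP).trans (Polynomial.height_le_height_comap_C_add_one P)
  · simp [hq]

end Height

/-! ### Regular sequences in ideals of polynomial rings -/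

section RegularSequence

open RingTheory.Sequence

/-- Weak regularity puts no condition on the final quotient, so units are allowed. This serves the
unit ideal, whose height is infinite. -/
lemma RingTheory.Sequence.isWeaklyRegular_replicate_one (R M : Type*) [CommRing R]
    [AddCommGroup M] [Module R M] (c : ℕ) : IsWeaklyRegular M (List.replicate c (1 : R)) := by
  induction c generalizing M with
  | zero => exact .nil R M
  | succ c ih => exact (isWeaklyRegular_cons_iff _ _ _).mpr ⟨IsSMulRegular.one M, ih _⟩

/-- The quotient is `(A ⧸ I)[X]`, where the image of `g` is still monic, hence a nonzerodivisor. -/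
lemma Polynomial.Monic.isSMulRegular_quotient_map {A : Type*} [CommRing A] (I : Ideal A)
    {g : Polynomial A} (hg : g.Monic) :
    IsSMulRegular (Polynomial A ⧸ (I.map Polynomial.C • ⊤ : Submodule (Polynomial A) (Polynomial A))) g := by
  have hI : (I.map Polynomial.C • ⊤ : Submodule (Polynomial A) (Polynomial A)) =
      I.map Polynomial.C := by simp
  rw [isSMulRegular_iff_right_eq_zero_of_smul]
  intro x hx
  obtain ⟨x, rfl⟩ := Submodule.Quotient.mk_surjective _ x
  rw [← Submodule.Quotient.mk_smul, Submodule.Quotient.mk_eq_zero, hI,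
    ← Ideal.mk_ker (I := I), ← Polynomial.ker_mapRingHom, RingHom.mem_ker] at hx
  rw [Submodule.Quotient.mk_eq_zero, hI,
    ← Ideal.mk_ker (I := I), ← Polynomial.ker_mapRingHom, RingHom.mem_ker]
  simp only [smul_eq_mul, map_mul, Polynomial.coe_mapRingHom] at hx ⊢
  exact ((hg.map _).mul_right_eq_zero_iff).mp hx

/-- An ideal of height at least `c` in a polynomial ring over a field contains a weakly regular
sequence of length `c`. -/
theorem MvPolynomial.exists_isWeaklyRegular_of_le_height {k : Type*} [Field k] {n : ℕ}
    (I : Ideal (MvPolynomial (Fin n) k)) (c : ℕ) (hc : (c : ℕ∞) ≤ I.height) :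
    ∃ rs : List (MvPolynomial (Fin n) k), rs.length = c ∧ (∀ r ∈ rs, r ∈ I) ∧
      IsWeaklyRegular (MvPolynomial (Fin n) k) rs := by
  by_cases hI : I = ⊤
  · exact ⟨List.replicate c 1, by simp, by simp [hI], isWeaklyRegular_replicate_one _ _ _⟩
  induction n generalizing c with
  | zero =>
    have : I.height ≤ 0 := by
      have h := Ideal.height_le_ringKrullDim_of_ne_top hI
      rw [MvPolynomial.ringKrullDim_of_isNoetherianRing, ringKrullDim_eq_zero_of_field] at h
      simpa using h
    obtain rfl : c = 0 := by simpa using hc.trans this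
    exact ⟨[], rfl, by simp, .nil _ _⟩
  | succ n ih =>
    obtain _ | c := c
    · exact ⟨[], rfl, by simp, .nil _ _⟩
    have hI0 : I ≠ ⊥ := by
      rintro rfl
      rw [Ideal.height_bot] at hc
      simp at hc
    obtain ⟨f, hfI, hf⟩ := Submodule.exists_mem_ne_zero_of_ne_bot hI0
    -- In the new coordinates `f` is monic in one variable up to a unit. The contraction of `J` to
    -- the remaining variables loses at most one in height; it provides `c` elements by induction,
    -- which stay regular by flatness, and the monic polynomial `g` is the last one.
    let e := ((nagataEquiv (k := k) (n := n) (2 + f.totalDegree)).trans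
      (finSuccEquiv k n)).toRingEquiv
    have hu := isUnit_leadingCoeff_finSuccEquiv_nagataEquiv hf
    let J := I.map e
    have hJ : J.height = I.height := e.height_map I
    let g := hu.unit⁻¹ • e f
    have hg : g.Monic := Polynomial.monic_of_isUnit_leadingCoeff_inv_smul hu
    have hgJ : g ∈ J := Submodule.smul_of_tower_mem _ hu.unit⁻¹.val (Ideal.mem_map_of_mem _ hfI)
    have hJC : (c : ℕ∞) ≤ (J.comap Polynomial.C).height := by
      have := Polynomial.height_le_height_comap_C_add_one_of_monic J hg hgJ
      rw [hJ] at this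
      have h2 := hc.trans this
      push_cast at h2
      exact (ENat.add_le_add_iff_right (by simp)).mp h2
    have hJtop : J.comap Polynomial.C ≠ ⊤ := by
      intro h
      have h1 : (1 : Polynomial _) ∈ J := by
        have : (1 : MvPolynomial (Fin n) k) ∈ J.comap Polynomial.C := h ▸ Submodule.mem_top
        simpa using this
      apply hI
      rw [Ideal.eq_top_iff_one]
      obtain ⟨x, hx, hx1⟩ := (Ideal.mem_map_of_equiv e 1).mp h1
      rwa [(map_eq_one_iff e e.injective).mp hx1] at hx
    obtain ⟨rs, hlen, hmem, hreg⟩ := ih _ c hJC hJtop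
    have hreg' : IsWeaklyRegular (Polynomial (MvPolynomial (Fin n) k))
        (rs.map Polynomial.C ++ [g]) := by
      rw [isWeaklyRegular_append_iff, isWeaklyRegular_singleton_iff, ← Ideal.map_ofList]
      exact ⟨hreg.of_flat (S := Polynomial (MvPolynomial (Fin n) k)),
        hg.isSMulRegular_quotient_map _⟩
    refine ⟨(rs.map Polynomial.C ++ [g]).map e.symm, by simp [hlen], fun r hr ↦ ?_, ?_⟩
    · obtain ⟨s, hs, rfl⟩ := List.mem_map.mp hr
      have hsJ : s ∈ J := by
        rcases List.mem_append.mp hs with h | h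
        · obtain ⟨t, ht, rfl⟩ := List.mem_map.mp h
          exact hmem t ht
        · rw [List.mem_singleton.mp h]; exact hgJ
      obtain ⟨x, hx, rfl⟩ := (Ideal.mem_map_of_equiv e s).mp hsJ
      rwa [e.symm_apply_apply]
    · refine (AddEquiv.isWeaklyRegular_congr (e := e.symm.toAddEquiv) ?_).mp hreg'
      exact List.forall₂_map_right_iff.mpr (List.forall₂_same.mpr fun r _ x ↦ by simp)

end RegularSequence

/-! ### Null-homotopies and duals of complexes of projective modules -/

section Grade

open RingTheory.Sequence
open scoped Pointwise

variable {R : Type*} [CommRing R] {P : ℤ → Type*} [∀ m, AddCommGroup (P m)] [∀ m, Module R (P m)]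
  (d : ∀ m, P m →ₗ[R] P (m + 1))

/-- Multiplication by `b` is null-homotopic on the term of degree `m + 1` of a complex. -/
def IsNullHomotopicAt (m : ℤ) (b : R) : Prop :=
  ∃ (s : P (m + 1) →ₗ[R] P m) (t : P (m + 1 + 1) →ₗ[R] P (m + 1)),
    ∀ z, d m (s z) + t (d (m + 1) z) = b • z

variable {d}

lemma LinearMap.exists_comp_eq_of_projective {M N L : Type*} [AddCommGroup M] [Module R M]
    [AddCommGroup N] [Module R N] [AddCommGroup L] [Module R L] [Module.Projective R L]
    (f : M →ₗ[R] N) (g : L →ₗ[R] N) (h : ∀ z, ∃ y, f y = g z) :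
    ∃ s : L →ₗ[R] M, ∀ z, f (s z) = g z := by
  obtain ⟨s, hs⟩ := Module.projective_lifting_property f.rangeRestrict
    (g.codRestrict (LinearMap.range f) h) f.surjective_rangeRestrict
  exact ⟨s, fun z ↦ congr_arg Subtype.val (LinearMap.congr_fun hs z)⟩

/-- Homotopies are built downwards. A homotopy one degree higher makes `b - s' d` take values in
cocycles; after multiplication by `c` these are boundaries, and projectivity lifts the map through
`d m`. -/
lemma IsNullHomotopicAt.step [∀ m, Module.Projective R (P m)]
    (hd : ∀ m z, d (m + 1) (d m z) = 0) {m : ℤ} {b c : R} (h : IsNullHomotopicAt d (m + 1) b)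
    (hc : ∀ z, d (m + 1) z = 0 → ∃ u, d m u = c • z) : IsNullHomotopicAt d m (c * b) := by
  obtain ⟨s', t', h'⟩ := h
  obtain ⟨s, hs⟩ := LinearMap.exists_comp_eq_of_projective (d m)
    (c • (b • LinearMap.id - s' ∘ₗ d (m + 1))) (fun z ↦ hc _ (by
      have h2 := h' (d (m + 1) z)
      rw [hd, map_zero, add_zero] at h2
      simp [h2]))
  refine ⟨s, c • s', fun z ↦ ?_⟩
  rw [hs]
  simp [smul_sub, mul_smul]

variable [∀ m, Module.Projective R (P m)] (hd : ∀ m z, d (m + 1) (d m z) = 0) {q : ℤ}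
  (hq : ∀ m, q < m → Subsingleton (P m))
  (hex : ∀ m, 0 ≤ m → ∀ z, d (m + 1) z = 0 → ∃ u, d m u = z)

include hd hq hex

/-- Descending induction starting above `q`, where the terms vanish; exactness in positive degrees
costs no factor. -/
lemma isNullHomotopicAt_one (m : ℤ) (hm : 0 ≤ m) : IsNullHomotopicAt d m 1 := by
  obtain ⟨n, hn⟩ : ∃ n : ℕ, q - m ≤ n := ⟨(q - m).toNat, Int.self_le_toNat _⟩
  induction n generalizing m with
  | zero =>
    have := hq (m + 1) (by push_cast at hn; omega)
    exact ⟨0, 0, fun z ↦ Subsingleton.elim _ _⟩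
  | succ n ih =>
    simpa using (ih (m + 1) (by omega) (by push_cast at hn ⊢; omega)).step hd (c := 1)
      (by simpa using hex m hm)

/-- Going down, the factor `a` is picked up only on passing degree `0`, that is at `m = -1`. -/
lemma isNullHomotopicAt_of_annihilates {a : R}
    (ha : ∀ m z, d (m + 1) z = 0 → ∃ u, d m u = a • z)
    (hex' : ∀ m, m + 1 < 0 → ∀ z, d (m + 1) z = 0 → ∃ u, d m u = z) (m : ℤ) :
    IsNullHomotopicAt d m a := by
  by_cases hm : 0 ≤ m
  · obtain ⟨s, t, h⟩ := isNullHomotopicAt_one hd hq hex m hm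
    exact ⟨a • s, a • t, fun z ↦ by simp [← smul_add, h]⟩
  obtain ⟨n, hn⟩ : ∃ n : ℕ, -1 - m = n := ⟨(-1 - m).toNat, by omega⟩
  induction n generalizing m with
  | zero =>
    simpa using (isNullHomotopicAt_one hd hq hex (m + 1) (by push_cast at hn; omega)).step hd
      (ha m)
  | succ n ih =>
    simpa using (ih (m + 1) (by push_cast at hn ⊢; omega) (by push_cast at hn ⊢; omega)).step hd
      (c := 1) (by simpa using hex' m (by push_cast at hn ⊢; omega))

/-- Let `P` be a bounded above complex of projective modules which is exact except in degree `0`.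
If the cohomology of `P` is annihilated by an `N`-regular sequence of length `c`, then
the complex `Hom(P, N)` is exact in degrees less than `c`. -/
theorem exists_comp_eq_of_isWeaklyRegular
    (hex' : ∀ m, m + 1 < 0 → ∀ z, d (m + 1) z = 0 → ∃ u, d m u = z)
    {N : Type*} [AddCommGroup N] [Module R N] (rs : List R)
    (hrs : ∀ r ∈ rs, ∀ m z, d (m + 1) z = 0 → ∃ u, d m u = r • z)
    (hreg : IsWeaklyRegular N rs) (m : ℤ) (hm : -(rs.length : ℤ) ≤ m)
    (f : P (m + 1) →ₗ[R] N) (hf : f ∘ₗ d m = 0) :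
    ∃ g : P (m + 1 + 1) →ₗ[R] N, f = g ∘ₗ d (m + 1) := by
  induction rs generalizing N m with
  | nil =>
    obtain ⟨s, t, h⟩ := isNullHomotopicAt_one hd hq hex m (by simpa using hm)
    refine ⟨f ∘ₗ t, LinearMap.ext fun z ↦ ?_⟩
    have h1 := congr_arg f (h z)
    have h2 : f (d m (s z)) = 0 := LinearMap.congr_fun hf _
    rw [map_add, h2, zero_add, one_smul] at h1
    exact h1.symm
  | cons b rs ih =>
    obtain ⟨hb, hreg'⟩ := (isWeaklyRegular_cons_iff N b rs).mp hreg
    obtain ⟨s, t, h⟩ := isNullHomotopicAt_of_annihilates hd hq hex (hrs b (by simp)) hex' m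
    -- The homotopy for `b` makes `b • f` a coboundary; it remains to divide by `b`. Modulo `b` the
    -- map `f ∘ t` is a cocycle one index higher, so the shorter sequence applies to it on `N / bN`.
    have h0 (z) : b • f z = f (t (d (m + 1) z)) := by
      have h1 := congr_arg f (h z)
      have h2 : f (d m (s z)) = 0 := LinearMap.congr_fun hf _
      rw [map_add, h2, zero_add, map_smul] at h1
      exact h1.symm
    let π := (b • (⊤ : Submodule R N)).mkQ
    obtain ⟨h', hh'⟩ := ih (N := QuotSMulTop b N) (fun r hr ↦ hrs r (by simp [hr])) hreg' (m + 1)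
      (by simp at hm; omega) (π ∘ₗ f ∘ₗ t) (LinearMap.ext fun z ↦ by
        change π (f (t (d (m + 1) z))) = 0
        rw [← h0, ← LinearMap.mem_ker, Submodule.ker_mkQ]
        exact Submodule.smul_mem_pointwise_smul _ _ _ trivial)
    obtain ⟨l, hl⟩ := Module.projective_lifting_property π h' (Submodule.mkQ_surjective _)
    -- Subtracting `l ∘ d` does not change the composite with `d (m + 1)`, but makes `f ∘ t`
    -- divisible by `b`. Regularity of `b` on `N` then cancels it.
    obtain ⟨g, hg⟩ := LinearMap.exists_comp_eq_of_projective (LinearMap.lsmul R N b)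
      (f ∘ₗ t - l ∘ₗ d (m + 1 + 1)) (fun z ↦ by
        have h1 : π (f (t z)) = h' (d _ z) := LinearMap.congr_fun hh' z
        have h2 : π (l (d _ z)) = h' (d _ z) := LinearMap.congr_fun hl _
        have h3 : (f ∘ₗ t - l ∘ₗ d (m + 1 + 1)) z ∈ LinearMap.ker π := by
          rw [LinearMap.mem_ker, LinearMap.sub_apply, map_sub]
          exact sub_eq_zero.mpr (h1.trans h2.symm)
        rw [Submodule.ker_mkQ] at h3
        obtain ⟨y, -, hy⟩ := h3
        exact ⟨y, hy⟩)
    refine ⟨g, LinearMap.ext fun z ↦ hb ?_⟩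
    have h1 := hg (d (m + 1) z)
    simp only [LinearMap.lsmul_apply, LinearMap.sub_apply, LinearMap.comp_apply, hd, map_zero,
      sub_zero, ← h0] at h1
    exact h1.symm

end Grade

/-! ### Exactness of sheaves of modules on stalks and on sections -/

namespace AlgebraicGeometry.Scheme.Modules

variable {X : Scheme.{u}}

variable (X) in
/-- The forgetful functor from `𝒪_X`-modules to sheaves of abelian groups. -/
def toAbSheaf : X.Modules ⥤ TopCat.Sheaf Ab.{u} X :=
  SheafOfModules.toSheaf.{u} X.ringCatSheaf

instance : (toAbSheaf X).Additive :=
  inferInstanceAs (SheafOfModules.toSheaf.{u} X.ringCatSheaf).Additive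
instance : (toAbSheaf X).Faithful :=
  inferInstanceAs (SheafOfModules.toSheaf.{u} X.ringCatSheaf).Faithful
instance : PreservesFiniteLimits (toAbSheaf X) :=
  inferInstanceAs (PreservesFiniteLimits (SheafOfModules.toSheaf.{u} X.ringCatSheaf))

/-- Colimits of sheaves of modules are sheafified colimits of presheaves of modules, and
sheafification commutes with forgetting the module structure. With left exactness this allows
exactness to be tested on stalks of abelian groups. -/
instance : PreservesFiniteColimits (toAbSheaf X) where
  preservesFiniteColimits K _ _ := by
    let R := X.ringCatSheaf
    let a := PresheafOfModules.sheafification.{u} (𝟙 R.obj)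
    have ha : PreservesColimitsOfShape K a :=
      (PresheafOfModules.sheafificationAdjunction (𝟙 R.obj)).leftAdjoint_preservesColimits.1
    have hs : PreservesColimitsOfShape K (presheafToSheaf (Opens.grothendieckTopology X) Ab.{u}) :=
      (sheafificationAdjunction _ _).leftAdjoint_preservesColimits.1
    have hat : PreservesColimitsOfShape K (a ⋙ SheafOfModules.toSheaf.{u} R) :=
      preservesColimitsOfShape_of_natIso (PresheafOfModules.sheafificationCompToSheaf (𝟙 R.obj)).symm
    refine ⟨fun {D} ↦ ?_⟩
    let D₀ : K ⥤ SheafOfModules.{u} R := D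
    let c := colimit.cocone (D₀ ⋙ SheafOfModules.forget R)
    have hc := isColimitOfPreserves a (colimit.isColimit (D₀ ⋙ SheafOfModules.forget R))
    have hc' : IsColimit ((SheafOfModules.toSheaf.{u} R).mapCocone (a.mapCocone c)) :=
      isColimitOfPreserves (a ⋙ SheafOfModules.toSheaf.{u} R)
        (colimit.isColimit (D₀ ⋙ SheafOfModules.forget R))
    have h1 : PreservesColimit ((D₀ ⋙ SheafOfModules.forget R) ⋙ a)
        (SheafOfModules.toSheaf.{u} R) := preservesColimit_of_preserves_colimit_cocone hc hc'
    let e : (D₀ ⋙ SheafOfModules.forget R) ⋙ a ≅ D₀ :=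
      Functor.isoWhiskerLeft D₀ (asIso (PresheafOfModules.sheafificationAdjunction (𝟙 R.obj)).counit)
    exact preservesColimit_of_iso_diagram (SheafOfModules.toSheaf.{u} R) e

/-- The stalk of an `𝒪_X`-module at a point, as an abelian group. -/
def stalkAb (x : X) : X.Modules ⥤ Ab.{u} :=
  toAbSheaf X ⋙ TopCat.Sheaf.forget Ab.{u} X ⋙ TopCat.Presheaf.stalkFunctor Ab.{u} x

instance (x : X) :
    (TopCat.Sheaf.forget Ab.{u} X ⋙ TopCat.Presheaf.stalkFunctor Ab.{u} x).Additive :=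
  Functor.additive_of_preserves_binary_products _

instance (x : X) : (stalkAb x).Additive := by unfold stalkAb; infer_instance

instance (x : X) : PreservesFiniteLimits (stalkAb x) := by unfold stalkAb; infer_instance
instance (x : X) : PreservesFiniteColimits (stalkAb x) := by unfold stalkAb; infer_instance

/-- Exactness of a sequence of `𝒪_X`-modules can be checked on stalks. -/
lemma exact_iff_stalkAb (S : ShortComplex X.Modules) :
    S.Exact ↔ ∀ x : X, (S.map (stalkAb x)).Exact := by
  rw [← ShortComplex.exact_map_iff_of_faithful S (toAbSheaf X),
    TopCat.Sheaf.exact_iff_stalkFunctor_map_exact]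
  rfl

section Stalk

variable (M : X.Modules) {N K : X.Modules} (x : X)

instance : Module (X.presheaf.stalk x) (M.presheaf.stalk x) :=
  let P : _root_.PresheafOfModules.{u} (X.presheaf ⋙ forget₂ CommRingCat RingCat) := M.val
  inferInstanceAs (Module (X.presheaf.stalk x) (TopCat.Presheaf.stalk (C := Ab.{u}) (X := X.toPresheafedSpace) P.presheaf x))

variable {M}

lemma germ_smul {U : X.Opens} (hx : x ∈ U) (r : Γ(X, U)) (s : Γ(M, U)) :
    M.presheaf.germ U x hx (r • s) = X.presheaf.germ U x hx r • M.presheaf.germ U x hx s :=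
  let P : _root_.PresheafOfModules.{u} (X.presheaf ⋙ forget₂ CommRingCat RingCat) := M.val
  _root_.PresheafOfModules.germ_smul (R := X.presheaf) P x U hx r s

/-- The linear map between stalks induced by a morphism of `𝒪_X`-modules. -/
def stalkMap (f : M ⟶ N) : M.presheaf.stalk x →ₗ[X.presheaf.stalk x] N.presheaf.stalk x where
  toFun := (TopCat.Presheaf.stalkFunctor Ab.{u} x).map f.mapPresheaf
  map_add' := map_add _
  map_smul' r s := by
    obtain ⟨U, hU, r, rfl⟩ := TopCat.Presheaf.exists_germ_eq X.presheaf r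
    obtain ⟨V, hVU, hV, s, rfl⟩ := TopCat.Presheaf.exists_le_germ_eq M.presheaf s hU
    rw [← TopCat.Presheaf.germ_res_apply X.presheaf (homOfLE hVU) x hV, ← germ_smul]
    erw [TopCat.Presheaf.stalkFunctor_map_germ_apply, TopCat.Presheaf.stalkFunctor_map_germ_apply]
    rw [RingHom.id_apply, ← germ_smul]
    congr 1
    exact f.app_smul _ _

@[simp]
lemma stalkMap_germ (f : M ⟶ N) {U : X.Opens} (hx : x ∈ U) (s : Γ(M, U)) :
    stalkMap x f (M.presheaf.germ U x hx s) = N.presheaf.germ U x hx (f.app U s) :=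
  TopCat.Presheaf.stalkFunctor_map_germ_apply U x hx f.mapPresheaf s

lemma exact_iff_stalkMap (S : ShortComplex X.Modules) :
    S.Exact ↔ ∀ x : X, Function.Exact (stalkMap x S.f) (stalkMap x S.g) := by
  rw [exact_iff_stalkAb]
  exact forall_congr' fun x ↦ ShortComplex.ab_exact_iff_function_exact _

lemma stalkMap_injective (f : M ⟶ N) [Mono f] : Function.Injective (stalkMap x f) :=
  (AddCommGrpCat.mono_iff_injective ((stalkAb x).map f)).mp inferInstance

variable {x}

lemma germ_eq_iff {U V : X.Opens} (hU : x ∈ U) (hV : x ∈ V) (s : Γ(M, U)) (t : Γ(M, V)) :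
    M.presheaf.germ U x hU s = M.presheaf.germ V x hV t ↔
      ∃ (W : X.Opens) (hWU : W ≤ U) (hWV : W ≤ V), x ∈ W ∧
        M.presheaf.map (homOfLE hWU).op s = M.presheaf.map (homOfLE hWV).op t := by
  constructor
  · intro h
    obtain ⟨W, hW, i, j, e⟩ := TopCat.Presheaf.germ_eq M.presheaf x hU hV s t h
    exact ⟨W, leOfHom i, leOfHom j, hW, e⟩
  · rintro ⟨W, hWU, hWV, hW, e⟩
    exact TopCat.Presheaf.germ_ext M.presheaf W hW (homOfLE hWU) (homOfLE hWV) e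

@[simp]
lemma germ_map {U V : X.Opens} (h : V ≤ U) (hx : x ∈ V) (s : Γ(M, U)) :
    M.presheaf.germ V x hx (M.presheaf.map (homOfLE h).op s) = M.presheaf.germ U x (h hx) s :=
  TopCat.Presheaf.germ_res_apply M.presheaf (homOfLE h) x hx s

lemma exists_germ_eq (s : M.presheaf.stalk x) {W : X.Opens} (hW : x ∈ W) :
    ∃ (U : X.Opens) (_ : U ≤ W) (hU : x ∈ U) (t : Γ(M, U)), M.presheaf.germ U x hU t = s := by
  obtain ⟨V, h, hV, s, rfl⟩ := TopCat.Presheaf.exists_le_germ_eq M.presheaf s hW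
  exact ⟨V, h, hV, s, rfl⟩

lemma section_eq_of_germ_eq {U : X.Opens} {s t : Γ(M, U)}
    (h : ∀ x (hx : x ∈ U), M.presheaf.germ U x hx s = M.presheaf.germ U x hx t) : s = t :=
  TopCat.Presheaf.section_ext ⟨M.presheaf, M.isSheaf⟩ U s t h

lemma app_map (f : M ⟶ N) {U V : X.Opens} (h : V ≤ U) (s : Γ(M, U)) :
    f.app V (M.presheaf.map (homOfLE h).op s) = N.presheaf.map (homOfLE h).op (f.app U s) :=
  ConcreteCategory.congr_hom (f.mapPresheaf.naturality (homOfLE h).op) s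

lemma app_injective (f : M ⟶ N) [Mono f] (U : X.Opens) : Function.Injective (f.app U) := by
  intro s t h
  refine section_eq_of_germ_eq fun x hx ↦ stalkMap_injective x f ?_
  rw [stalkMap_germ, stalkMap_germ, h]

/-- Exactness of a sequence of `𝒪_X`-modules in terms of sections. -/
lemma exact_iff_locally (S : ShortComplex X.Modules) :
    S.Exact ↔ ∀ (U : X.Opens) (s : Γ(S.X₂, U)), S.g.app U s = 0 → ∀ x ∈ U,
      ∃ (V : X.Opens) (h : V ≤ U) (t : Γ(S.X₁, V)), x ∈ V ∧
        S.f.app V t = S.X₂.presheaf.map (homOfLE h).op s := by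
  rw [exact_iff_stalkMap]
  constructor
  · intro H U s hs x hx
    obtain ⟨t, ht⟩ := (H x (S.X₂.presheaf.germ U x hx s)).mp (by
      rw [stalkMap_germ, hs, map_zero])
    obtain ⟨V, h, hV, t, rfl⟩ := exists_germ_eq t hx
    rw [stalkMap_germ, germ_eq_iff] at ht
    obtain ⟨W, hWV, hWU, hW, e⟩ := ht
    exact ⟨W, hWU, S.X₁.presheaf.map (homOfLE hWV).op t, hW, by rw [app_map, e]⟩
  · intro H x s
    constructor
    · intro hs
      obtain ⟨U, -, hU, s, rfl⟩ := exists_germ_eq s (W := ⊤) trivial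
      rw [stalkMap_germ, ← map_zero (S.X₃.presheaf.germ U x hU).hom, germ_eq_iff] at hs
      obtain ⟨W, hW, _, hxW, e⟩ := hs
      rw [map_zero, ← app_map] at e
      obtain ⟨V, h, t, hV, e⟩ := H W _ e x hxW
      exact ⟨S.X₁.presheaf.germ V x hV t, by rw [stalkMap_germ, e, germ_map, germ_map]⟩
    · rintro ⟨t, rfl⟩
      obtain ⟨U, -, hU, t, rfl⟩ := exists_germ_eq t (W := ⊤) trivial
      rw [stalkMap_germ, stalkMap_germ]
      have : S.g.app U (S.f.app U t) = (S.f ≫ S.g).app U t := rfl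
      rw [this, S.zero]
      exact map_zero (S.X₃.presheaf.germ U x hU).hom

lemma exists_app_eq_of_epi (f : M ⟶ N) [Epi f] {U : X.Opens} (s : Γ(N, U)) {x : X} (hx : x ∈ U) :
    ∃ (V : X.Opens) (h : V ≤ U) (t : Γ(M, V)), x ∈ V ∧
      f.app V t = N.presheaf.map (homOfLE h).op s := by
  have : (ShortComplex.mk f (0 : N ⟶ N) (by simp)).Exact :=
    (ShortComplex.exact_iff_epi _ rfl).mpr ‹_›
  exact (exact_iff_locally _).mp this U s rfl x hx

lemma epi_of_locally_surjective (f : M ⟶ N) (H : ∀ (U : X.Opens) (s : Γ(N, U)), ∀ x ∈ U,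
    ∃ (V : X.Opens) (h : V ≤ U) (t : Γ(M, V)), x ∈ V ∧
      f.app V t = N.presheaf.map (homOfLE h).op s) : Epi f := by
  have : (ShortComplex.mk f (0 : N ⟶ N) (by simp)).Exact :=
    (exact_iff_locally _).mpr fun U s _ x hx ↦ H U s x hx
  exact (ShortComplex.exact_iff_epi _ rfl).mp this

lemma mono_of_app_injective (f : M ⟶ N) (H : ∀ U, Function.Injective (f.app U)) : Mono f := by
  have : (ShortComplex.mk (0 : M ⟶ M) f (by simp)).Exact :=
    (exact_iff_locally _).mpr fun U s hs x hx ↦ ⟨U, le_rfl, 0, hx, by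
      rw [map_zero, show s = 0 from H U (by rw [hs, map_zero]), map_zero]⟩
  exact (ShortComplex.exact_iff_mono _ rfl).mp this

/-- Exactness on the left of a short exact sequence, on sections. -/
lemma exists_app_eq_of_exact_of_mono {S : ShortComplex X.Modules} (hS : S.Exact) [Mono S.f]
    {U : X.Opens} (s : Γ(S.X₂, U)) (hs : S.g.app U s = 0) : ∃ t, S.f.app U t = s := by
  have H := (exact_iff_locally S).mp hS U s hs
  choose V hV t hx e using H
  obtain ⟨y, hy, -⟩ := TopCat.Sheaf.existsUnique_gluing' ⟨S.X₁.presheaf, S.X₁.isSheaf⟩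
    (fun i : U ↦ V i.1 i.2) U (fun i ↦ homOfLE (hV i.1 i.2))
    (fun z hz ↦ Opens.mem_iSup.mpr ⟨⟨z, hz⟩, hx z hz⟩) (fun i ↦ t i.1 i.2) (fun i j ↦ by
      apply app_injective S.f
      change S.f.app _ (S.X₁.presheaf.map (homOfLE inf_le_left).op _) =
        S.f.app _ (S.X₁.presheaf.map (homOfLE inf_le_right).op _)
      rw [app_map, app_map, e, e, presheaf_map_map, presheaf_map_map])
  refine ⟨y, section_eq_of_germ_eq fun z hz ↦ ?_⟩
  have h1 : S.X₁.presheaf.map (homOfLE (hV z hz)).op y = t z hz := hy ⟨z, hz⟩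
  rw [← germ_map (hV z hz) (hx z hz), ← germ_map (hV z hz) (hx z hz) s, ← app_map, h1, e]

end Stalk

end AlgebraicGeometry.Scheme.Modules

/-! ### Extension by zero, and exactness of ℋom in the first variable -/

namespace AlgebraicGeometry.Scheme.Modules

variable {X : Scheme.{u}} {M N : X.Modules}

/-- The subpresheaf of `M` which agrees with `M` on open subsets of `U`, and vanishes elsewhere. -/
def extendByZero (M : X.Modules) (U : X.Opens) :
    _root_.PresheafOfModules.Submodule (toPresheafOfModules X |>.obj M) where
  obj V :=
    { carrier := {s | ¬ V.unop ≤ U → s = 0}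
      add_mem' := fun ha hb h ↦ by rw [ha h, hb h, add_zero]
      zero_mem' := fun _ ↦ rfl
      smul_mem' := fun r s hs h ↦ by rw [hs h, smul_zero] }
  map {V W} i s hs h := by
    have : s = 0 := hs fun h' ↦ h ((leOfHom i.unop).trans h')
    rw [this, map_zero]

open Classical in
/-- The morphism from the extension by zero of `M` to `N` given by a homomorphism
`M|_U ⟶ N|_U`. -/
def LocalHom.fromExtendByZero {U : X.Opens} (f : LocalHom M N U) :
    (extendByZero M U).toPresheafOfModules ⟶ (toPresheafOfModules X).obj N := by
  let φ (V : X.Opens) : Γ(M, V) →ₗ[Γ(X, V)] Γ(N, V) := if h : V ≤ U then f.app V h else 0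
  refine _root_.PresheafOfModules.homMk
    (M₁ := (extendByZero M U).toPresheafOfModules) (M₂ := (toPresheafOfModules X).obj N)
    { app V := AddCommGrpCat.ofHom
        ((φ V.unop).toAddMonoidHom.comp ((extendByZero M U).obj V).subtype.toAddMonoidHom)
      naturality V W i := ?_ } ?_
  · ext s
    obtain ⟨s, hs⟩ := s
    have key : φ W.unop (M.presheaf.map i s) = N.presheaf.map i (φ V.unop s) := by
      by_cases h : V.unop ≤ U
      · have h' : W.unop ≤ U := (leOfHom i.unop).trans h
        simp only [φ, h, h', dite_true]
        exact f.naturality V.unop W.unop h (leOfHom i.unop) s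
      · have h0 : s = 0 := hs h
        subst h0
        erw [map_zero, map_zero, map_zero, map_zero]
    exact key
  · intro V r m
    exact (φ V.unop).map_smul r m.1

open Classical in
lemma LocalHom.fromExtendByZero_app {U : X.Opens} (f : LocalHom M N U) (V : X.Opens) (hV : V ≤ U)
    (s : Γ(M, V)) (hs : s ∈ (extendByZero M U).obj (.op V)) :
    (LocalHom.fromExtendByZero f).app (.op V) ⟨s, hs⟩ = f.app V hV s := by
  change (if h : V ≤ U then f.app V h else 0 : Γ(M, V) →ₗ[Γ(X, V)] Γ(N, V)) s = _
  rw [dif_pos hV]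

/-- A local homomorphism into an injective module extends along monomorphisms,
to a global homomorphism. -/
lemma LocalHom.exists_extension {A B I : X.Modules} [Injective I] (a : A ⟶ B) [Mono a]
    {U : X.Opens} (f : LocalHom A I U) :
    ∃ h : B ⟶ I, ∀ (V : X.Opens) (hV : V ≤ U) (s : Γ(A, V)),
      h.app V (a.app V s) = f.app V hV s := by
  let adj := PresheafOfModules.sheafificationAdjunction (𝟙 X.ringCatSheaf.obj)
  let I₀ : SheafOfModules.{u} X.ringCatSheaf := I
  have hI₀ : Injective I₀ := ‹Injective I›
  -- Sheafification preserves monomorphisms, so its right adjoint keeps `I` injective among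
  -- presheaves. This is needed because `extendByZero` is only a presheaf.
  have hI : Injective ((SheafOfModules.forget _ ⋙
      PresheafOfModules.restrictScalars (𝟙 X.ringCatSheaf.obj)).obj I₀) :=
    Injective.injective_of_adjoint adj I₀
  let i : (extendByZero A U).toPresheafOfModules ⟶ (toPresheafOfModules X).obj B :=
    (extendByZero A U).ι ≫ (toPresheafOfModules X).map a
  have : Mono i := mono_comp _ _
  let f' : (extendByZero A U).toPresheafOfModules ⟶ ((SheafOfModules.forget _ ⋙
      PresheafOfModules.restrictScalars (𝟙 X.ringCatSheaf.obj)).obj I₀) := f.fromExtendByZero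
  let h' := Injective.factorThru f' i
  let h : (toPresheafOfModules X).obj B ⟶ (toPresheafOfModules X).obj I := h'
  have hh' : i ≫ h' = f' := Injective.comp_factorThru f' i
  have hh : i ≫ h = f.fromExtendByZero := hh'
  refine ⟨(toPresheafOfModules X).preimage h, fun V hV s ↦ ?_⟩
  have hs : s ∈ (extendByZero A U).obj (.op V) := fun h ↦ (h hV).elim
  rw [← LocalHom.fromExtendByZero_app f V hV s hs, ← hh]
  have h1 : (toPresheafOfModules X).map ((toPresheafOfModules X).preimage h) = h :=
    Functor.map_preimage _ _
  conv_rhs => rw [← h1]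
  rfl

/-- A homomorphism out of the middle term of a right exact sequence which vanishes on the first
term vanishes on the kernel of the second map. -/
lemma LocalHom.app_eq_zero_of_exact {S : ShortComplex X.Modules} (hS : S.Exact) {U : X.Opens}
    {f : LocalHom S.X₂ N U} (hf : LocalHom.comp S.f (𝟙 N) f = 0) (V : X.Opens) (hV : V ≤ U)
    (b : Γ(S.X₂, V)) (hb : S.g.app V b = 0) : f.app V hV b = 0 := by
  refine section_eq_of_germ_eq fun x hx ↦ ?_
  obtain ⟨W, hW, a, hxW, e⟩ := (exact_iff_locally S).mp hS V b hb x hx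
  have h0 : f.app W (hW.trans hV) (S.f.app W a) = 0 := by
    have := congr(LocalHom.app $hf W (hW.trans hV) a)
    simpa using this
  rw [← germ_map hW hxW, ← f.naturality V W hV hW, ← e, h0, map_zero, map_zero]

/-- Local preimages of `s` differ by elements killed by `f`, so their images glue. Quantifying over
every local preimage `b` pins `t` down, which lets `LocalHom.exists_desc` deduce linearity and
naturality. -/
lemma LocalHom.exists_desc_app {S : ShortComplex X.Modules} (hS : S.Exact) [Epi S.g]
    {U : X.Opens} {f : LocalHom S.X₂ N U} (hf : LocalHom.comp S.f (𝟙 N) f = 0)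
    (V : X.Opens) (hV : V ≤ U) (s : Γ(S.X₃, V)) :
    ∃ t : Γ(N, V), ∀ (W : X.Opens) (hW : W ≤ V) (b : Γ(S.X₂, W)),
      S.g.app W b = S.X₃.presheaf.map (homOfLE hW).op s →
        f.app W (hW.trans hV) b = N.presheaf.map (homOfLE hW).op t := by
  have H (x : X) (hx : x ∈ V) := exists_app_eq_of_epi S.g s hx
  choose W hW b hxW e using H
  have compat (x y : V) : N.presheaf.map (homOfLE (inf_le_left : W x.1 x.2 ⊓ W y.1 y.2 ≤ _)).op
      (f.app (W x.1 x.2) ((hW _ _).trans hV) (b x.1 x.2)) =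
      N.presheaf.map (homOfLE (inf_le_right : W x.1 x.2 ⊓ W y.1 y.2 ≤ _)).op
      (f.app (W y.1 y.2) ((hW _ _).trans hV) (b y.1 y.2)) := by
    rw [← f.naturality, ← f.naturality, ← sub_eq_zero, ← map_sub]
    apply app_eq_zero_of_exact hS hf
    rw [map_sub, app_map, app_map, e, e, presheaf_map_map, presheaf_map_map, sub_self]
  obtain ⟨t, ht, -⟩ := TopCat.Sheaf.existsUnique_gluing' ⟨N.presheaf, N.isSheaf⟩
    (fun x : V ↦ W x.1 x.2) V (fun x ↦ homOfLE (hW x.1 x.2))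
    (fun z hz ↦ Opens.mem_iSup.mpr ⟨⟨z, hz⟩, hxW z hz⟩)
    (fun x ↦ f.app (W x.1 x.2) ((hW _ _).trans hV) (b x.1 x.2)) compat
  replace ht (x : V) : N.presheaf.map (homOfLE (hW x.1 x.2)).op t =
    f.app (W x.1 x.2) ((hW _ _).trans hV) (b x.1 x.2) := ht x
  refine ⟨t, fun W' hW' b' e' ↦ section_eq_of_germ_eq fun x hx ↦ ?_⟩
  have hx' : x ∈ V := hW' hx
  have h1 : W' ⊓ W x hx' ≤ W' := inf_le_left
  have h2 : W' ⊓ W x hx' ≤ W x hx' := inf_le_right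
  have hxi : x ∈ W' ⊓ W x hx' := ⟨hx, hxW x hx'⟩
  rw [← germ_map h1 hxi, ← germ_map h1 hxi (N.presheaf.map _ t), presheaf_map_map,
    ← presheaf_map_map N (hW x hx') h2, ht ⟨x, hx'⟩, ← f.naturality, ← f.naturality]
  congr 1
  rw [← sub_eq_zero, ← map_sub]
  apply app_eq_zero_of_exact hS hf
  rw [map_sub, app_map, app_map, e, e', presheaf_map_map, presheaf_map_map, sub_self]

/-- A homomorphism out of the middle term of a right exact sequence which vanishes on the first
term descends to the last term. -/
lemma LocalHom.exists_desc {S : ShortComplex X.Modules} (hS : S.Exact) [Epi S.g] {U : X.Opens}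
    (f : LocalHom S.X₂ N U) (hf : LocalHom.comp S.f (𝟙 N) f = 0) :
    ∃ h : LocalHom S.X₃ N U, LocalHom.comp S.g (𝟙 N) h = f := by
  choose h hh using fun V hV s ↦ exists_desc_app (V := V) hS hf hV s
  have hadd (V : X.Opens) (hV : V ≤ U) (s s' : Γ(S.X₃, V)) :
      h V hV (s + s') = h V hV s + h V hV s' := by
    refine section_eq_of_germ_eq fun x hx ↦ ?_
    obtain ⟨W, hW, b, hxW, e⟩ := exists_app_eq_of_epi S.g s hx
    obtain ⟨W', hW', b', hxW', e'⟩ := exists_app_eq_of_epi S.g s' hx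
    have h1 : W ⊓ W' ≤ W := inf_le_left
    have h2 : W ⊓ W' ≤ W' := inf_le_right
    have e1 := hh V hV s _ (h1.trans hW) (S.X₂.presheaf.map (homOfLE h1).op b) (by
      rw [app_map, e, presheaf_map_map])
    have e2 := hh V hV s' _ (h1.trans hW) (S.X₂.presheaf.map (homOfLE h2).op b') (by
      rw [app_map, e', presheaf_map_map])
    have e3 := hh V hV (s + s') _ (h1.trans hW) (S.X₂.presheaf.map (homOfLE h1).op b +
      S.X₂.presheaf.map (homOfLE h2).op b') (by
      rw [map_add, map_add, app_map, app_map, e, e', presheaf_map_map, presheaf_map_map])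
    rw [map_add, e1, e2, ← map_add] at e3
    have hxi : x ∈ W ⊓ W' := ⟨hxW, hxW'⟩
    rw [← germ_map (h1.trans hW) hxi, ← e3, germ_map]
  have hsmul (V : X.Opens) (hV : V ≤ U) (r : Γ(X, V)) (s : Γ(S.X₃, V)) :
      h V hV (r • s) = r • h V hV s := by
    refine section_eq_of_germ_eq fun x hx ↦ ?_
    obtain ⟨W, hW, b, hxW, e⟩ := exists_app_eq_of_epi S.g s hx
    have e1 := hh V hV (r • s) W hW (X.presheaf.map (homOfLE hW).op r • b) (by
      rw [Hom.app_smul, e, map_smul])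
    rw [_root_.map_smul, hh V hV s W hW b e, ← map_smul] at e1
    rw [← germ_map hW hxW, ← e1, germ_map]
  have hnat (V W : X.Opens) (hV : V ≤ U) (hW : W ≤ V) (s : Γ(S.X₃, V)) :
      h W (hW.trans hV) (S.X₃.presheaf.map (homOfLE hW).op s) =
        N.presheaf.map (homOfLE hW).op (h V hV s) := by
    refine section_eq_of_germ_eq fun x hx ↦ ?_
    obtain ⟨W', hW', b, hxW, e⟩ :=
      exists_app_eq_of_epi S.g (S.X₃.presheaf.map (homOfLE hW).op s) hx
    have e1 := hh W (hW.trans hV) _ W' hW' b e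
    rw [presheaf_map_map] at e
    rw [← germ_map hW' hxW, ← e1, hh V hV s W' (hW'.trans hW) b e, germ_map, germ_map]
  refine ⟨⟨fun V hV ↦ ⟨⟨h V hV, hadd V hV⟩, hsmul V hV⟩, hnat⟩, LocalHom.ext' fun V hV b ↦ ?_⟩
  have := hh V hV (S.g.app V b) V le_rfl b (by simp)
  simpa using this.symm

section SheafHom

lemma mono_sheafHomMap_of_epi {A B : X.Modules} (g : A ⟶ B) [Epi g] (N : X.Modules) :
    Mono (sheafHomMap g (𝟙 N)) := by
  refine mono_of_app_injective _ fun U f f' e ↦ ?_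
  let f₁ : LocalHom B N U := f
  let f₂ : LocalHom B N U := f'
  replace e (V : X.Opens) (hV : V ≤ U) (a : Γ(A, V)) :
      f₁.app V hV (g.app V a) = f₂.app V hV (g.app V a) :=
    congr(LocalHom.app (M := A) (N := N) $e V hV a)
  refine LocalHom.ext' (f := f₁) (g := f₂) fun V hV b ↦ section_eq_of_germ_eq fun x hx ↦ ?_
  obtain ⟨W, hW, a, hxW, e'⟩ := exists_app_eq_of_epi g b hx
  rw [← germ_map hW hxW, ← germ_map hW hxW (f₂.app V hV b), ← f₁.naturality, ← f₂.naturality,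
    ← e', e]

lemma exact_sheafHomMap {S : ShortComplex X.Modules} (hS : S.Exact) [Epi S.g] (N : X.Modules) :
    (ShortComplex.mk (sheafHomMap S.g (𝟙 N)) (sheafHomMap S.f (𝟙 N)) (by
      rw [sheafHomMap_comp, S.zero, sheafHomMap_zero_left])).Exact := by
  rw [exact_iff_locally]
  intro U f hf x hx
  obtain ⟨h, hh⟩ := LocalHom.exists_desc hS (N := N) (U := U) f hf
  refine ⟨U, le_rfl, h, hx, ?_⟩
  simp only [homOfLE_refl, op_id, CategoryTheory.Functor.map_id]
  exact hh

lemma epi_sheafHomMap_of_injective {A B : X.Modules} (a : A ⟶ B) [Mono a] (I : X.Modules)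
    [Injective I] : Epi (sheafHomMap a (𝟙 I)) := by
  refine epi_of_locally_surjective _ fun U f x hx ↦ ?_
  -- The extension is global, so no shrinking of `U` is needed: its restriction to `U` is the
  -- preimage.
  obtain ⟨h, hh⟩ := LocalHom.exists_extension (I := I) a (U := U) f
  let h' : LocalHom B I U :=
    { app V _ :=
        { toFun := h.app V
          map_add' := map_add _
          map_smul' := h.app_smul }
      naturality V W _ hW s := app_map h hW s }
  refine ⟨U, le_rfl, h', hx, ?_⟩
  simp only [homOfLE_refl, op_id, CategoryTheory.Functor.map_id]
  exact LocalHom.ext' hh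

/-- `ℋom(-, I)` is exact if `I` is injective. -/
lemma shortExact_sheafHomMap {S : ShortComplex X.Modules} (hS : S.ShortExact) (I : X.Modules)
    [Injective I] : (ShortComplex.mk (sheafHomMap S.g (𝟙 I)) (sheafHomMap S.f (𝟙 I)) (by
      rw [sheafHomMap_comp, S.zero, sheafHomMap_zero_left])).ShortExact :=
  have := hS.epi_g
  have := hS.mono_f
  { exact := exact_sheafHomMap hS.exact I
    mono_f := mono_sheafHomMap_of_epi S.g I
    epi_g := epi_sheafHomMap_of_injective S.f I }

end SheafHom

end AlgebraicGeometry.Scheme.Modules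

/-! ### Computing ℰxt from an injective resolution of the second variable -/

namespace AlgebraicGeometry.Scheme.Modules

variable {X : Scheme.{u}} {M M' M'' N : X.Modules}

lemma mono_sheafHomMap_of_mono (M : X.Modules) {A B : X.Modules} (g : A ⟶ B) [Mono g] :
    Mono (sheafHomMap (𝟙 M) g) := by
  refine mono_of_app_injective _ fun U f f' e ↦ ?_
  let f₁ : LocalHom M A U := f
  let f₂ : LocalHom M A U := f'
  replace e (V : X.Opens) (hV : V ≤ U) (a : Γ(M, V)) :
      g.app V (f₁.app V hV a) = g.app V (f₂.app V hV a) :=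
    congr(LocalHom.app (M := M) (N := B) $e V hV a)
  exact LocalHom.ext' (f := f₁) (g := f₂) fun V hV b ↦ app_injective g V (e V hV b)

/-- A homomorphism into the middle term of a left exact sequence which is killed by the second map
lifts to the first term. -/
lemma LocalHom.exists_lift {S : ShortComplex X.Modules} (hS : S.Exact) [Mono S.f] {U : X.Opens}
    (f : LocalHom M S.X₂ U) (hf : LocalHom.comp (𝟙 M) S.g f = 0) :
    ∃ h : LocalHom M S.X₁ U, LocalHom.comp (𝟙 M) S.f h = f := by
  have H (V : X.Opens) (hV : V ≤ U) (s : Γ(M, V)) :=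
    exists_app_eq_of_exact_of_mono hS (f.app V hV s) congr(LocalHom.app $hf V hV s)
  choose h hh using H
  refine ⟨⟨fun V hV ↦ ⟨⟨h V hV, fun s t ↦ ?_⟩, fun r s ↦ ?_⟩, fun V W hV hW s ↦ ?_⟩, ?_⟩
  · exact app_injective S.f V (by rw [map_add, hh, hh, hh, map_add])
  · exact app_injective S.f V (by rw [Hom.app_smul, hh, hh, _root_.map_smul, RingHom.id_apply])
  · refine app_injective S.f W ?_
    erw [app_map, hh, hh]
    exact f.naturality V W hV hW s
  · exact LocalHom.ext' fun V hV s ↦ hh V hV s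

/-- `ℋom(M, -)` is left exact. -/
lemma exact_sheafHomMap_right (M : X.Modules) {S : ShortComplex X.Modules} (hS : S.Exact)
    [Mono S.f] : (S.map (sheafHomFunctor M)).Exact := by
  rw [exact_iff_locally]
  intro U f hf x hx
  obtain ⟨h, hh⟩ := LocalHom.exists_lift hS (M := M) (U := U) f hf
  refine ⟨U, le_rfl, h, hx, ?_⟩
  simp only [homOfLE_refl, op_id, CategoryTheory.Functor.map_id]
  exact hh

/-- The morphism of functors `ℋom(M, -) ⟶ ℋom(M', -)` given by a morphism `M' ⟶ M`. -/
def sheafHomFunctorMap (a : M' ⟶ M) : sheafHomFunctor M ⟶ sheafHomFunctor M' where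
  app N := sheafHomMap a (𝟙 N)
  naturality _ _ _ := rfl

variable (I : InjectiveResolution N)

/-- The complex obtained by applying `ℋom(M, -)` to an injective resolution. -/
def homComplex (M : X.Modules) : CochainComplex X.Modules ℕ :=
  ((sheafHomFunctor M).mapHomologicalComplex _).obj I.cocomplex

/-- The contravariant functoriality of `homComplex`. -/
def homComplexMap (a : M' ⟶ M) : homComplex I M ⟶ homComplex I M' :=
  (NatTrans.mapHomologicalComplex (sheafHomFunctorMap a) _).app _

lemma homComplexMap_comp (a : M' ⟶ M) (b : M'' ⟶ M') :
    homComplexMap I a ≫ homComplexMap I b = homComplexMap I (b ≫ a) := rfl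

lemma homComplexMap_zero : homComplexMap I (0 : M' ⟶ M) = 0 := by
  ext i : 1
  exact sheafHomMap_zero_left _

/-- The short complex of complexes computing the long exact sequence of `ℰxt(-, N)`. -/
def homShortComplex (S : ShortComplex X.Modules) : ShortComplex (CochainComplex X.Modules ℕ) where
  f := homComplexMap I S.g
  g := homComplexMap I S.f
  zero := by rw [homComplexMap_comp, S.zero, homComplexMap_zero]

lemma homShortComplex_shortExact {S : ShortComplex X.Modules} (hS : S.ShortExact) :
    (homShortComplex I S).ShortExact :=
  HomologicalComplex.shortExact_of_degreewise_shortExact _ fun i ↦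
    shortExact_sheafHomMap hS (I.cocomplex.X i)

/-- The comparison of `ℋom(M, N)` with the cycles of `homComplex` in degree zero. -/
lemma exists_isLimit_homComplex (M : X.Modules) :
    ∃ h : sheafHomMap (𝟙 M) (I.ι.f 0) ≫ (homComplex I M).d 0 1 = 0,
      Nonempty (IsLimit (KernelFork.ofι _ h)) := by
  let S : ShortComplex X.Modules := ShortComplex.mk _ _ I.ι_f_zero_comp_complex_d
  have hS : S.Exact := I.exact₀
  have : Mono S.f := inferInstanceAs (Mono (I.ι.f 0))
  have h := exact_sheafHomMap_right M hS
  have : Mono (S.map (sheafHomFunctor M)).f := mono_sheafHomMap_of_mono M S.f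
  exact ⟨(S.map (sheafHomFunctor M)).zero, ⟨h.fIsKernel⟩⟩

/-- The isomorphism of `ℋom(M, N)` with the cycles of `homComplex` in degree zero. -/
def sheafHomIsoCycles (M : X.Modules) : sheafHom M N ≅ (homComplex I M).cycles 0 :=
  IsLimit.conePointUniqueUpToIso (exists_isLimit_homComplex I M).choose_spec.some
    ((homComplex I M).cyclesIsKernel 0 1 (by simp))

lemma sheafHomIsoCycles_hom_iCycles (M : X.Modules) :
    (sheafHomIsoCycles I M).hom ≫ (homComplex I M).iCycles 0 =
      sheafHomMap (𝟙 M) (I.ι.f 0) :=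
  IsLimit.conePointUniqueUpToIso_hom_comp _ _ WalkingParallelPair.zero

/-- The isomorphism of `ℋom(M, N)` with the homology of `homComplex` in degree zero. -/
def sheafHomIsoHomology (M : X.Modules) : sheafHom M N ≅ (homComplex I M).homology 0 :=
  sheafHomIsoCycles I M ≪≫ CochainComplex.isoHomologyπ₀ _

/-- This identifies the degree-zero maps of the long exact sequence with the maps `sheafHomMap`.
Cycles embed in the term of degree zero, where the comparison is immediate. -/
lemma sheafHomIsoHomology_naturality (a : M' ⟶ M) :
    (sheafHomIsoHomology I M).hom ≫ HomologicalComplex.homologyMap (homComplexMap I a) 0 =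
      sheafHomMap a (𝟙 N) ≫ (sheafHomIsoHomology I M').hom := by
  have h : (sheafHomIsoCycles I M).hom ≫ HomologicalComplex.cyclesMap (homComplexMap I a) 0 =
      sheafHomMap a (𝟙 N) ≫ (sheafHomIsoCycles I M').hom := by
    rw [← cancel_mono ((homComplex I M').iCycles 0), Category.assoc, Category.assoc,
      HomologicalComplex.cyclesMap_i, sheafHomIsoCycles_hom_iCycles, ← Category.assoc,
      sheafHomIsoCycles_hom_iCycles]
    rfl
  change ((sheafHomIsoCycles I M).hom ≫ (homComplex I M).homologyπ 0) ≫ _ =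
    _ ≫ (sheafHomIsoCycles I M').hom ≫ (homComplex I M').homologyπ 0
  rw [Category.assoc, HomologicalComplex.homologyπ_naturality, reassoc_of% h]

/-- The functor is always left exact, so preservation of epimorphisms is all that exactness
requires. -/
lemma preservesHomology_sheafHomFunctor [(sheafHomFunctor M).PreservesEpimorphisms] :
    (sheafHomFunctor M).PreservesHomology := by
  refine ((sheafHomFunctor M).exact_tfae.out 0 2).mp fun S hS ↦ ?_
  have := hS.mono_f
  have := hS.epi_g
  exact { exact := exact_sheafHomMap_right M hS.exact
          mono_f := mono_sheafHomMap_of_mono M S.f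
          epi_g := (sheafHomFunctor M).map_epi S.g }

/-- `ℰxt^i(M, N)` vanishes for `i ≥ 1`, provided `ℋom(M, -)` is exact. -/
lemma isZero_homology_homComplex [(sheafHomFunctor M).PreservesEpimorphisms] (i : ℕ) :
    IsZero ((homComplex I M).homology (i + 1)) := by
  rw [← HomologicalComplex.exactAt_iff_isZero_homology,
    HomologicalComplex.exactAt_iff' _ i (i + 1) (i + 2) (by simp) (by simp)]
  have := preservesHomology_sheafHomFunctor (M := M)
  exact (I.exact_succ i).map (sheafHomFunctor M)

/-- `ℰxt^i(M, N)` is the cohomology of `homComplex`. -/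
def sheafExtIso (i : ℕ) (M N : X.Modules) (I : InjectiveResolution N) :
    sheafExt i M N ≅ (homComplex I M).homology i :=
  I.isoRightDerivedObj (sheafHomFunctor M) i

end AlgebraicGeometry.Scheme.Modules

/-! ### Short exact sequences of cokernels of differentials -/

namespace HomologicalComplex

variable {A : Type*} [Category* A] [Abelian A] (K : CochainComplex A ℤ)

/-- The sequence `K.opcycles m ⟶ K.X n ⟶ K.opcycles n`, where `n = m + 1`. -/
def opcyclesShortComplex (m n : ℤ) : ShortComplex A where
  f := K.fromOpcycles m n
  g := K.pOpcycles n
  zero := by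
    rw [← cancel_epi (K.pOpcycles m), p_fromOpcycles_assoc, d_pOpcycles, comp_zero]

lemma exact_d_pOpcycles (m n : ℤ) (h : m + 1 = n) :
    (ShortComplex.mk (K.d m n) (K.pOpcycles n) (K.d_pOpcycles m n)).Exact :=
  ShortComplex.exact_of_g_is_cokernel _ (K.opcyclesIsCokernel m n (by simp [← h]))

/-- The kernel of this map is the homology in degree `m`. -/
lemma mono_fromOpcycles {m : ℤ} (n : ℤ) (h : m + 1 = n) (hm : K.ExactAt m) :
    Mono (K.fromOpcycles m n) := by
  rw [exactAt_iff_isZero_homology] at hm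
  exact Preadditive.mono_of_isZero_kernel' _ (K.homologyIsKernel m n (by simp [← h])) hm

lemma opcyclesShortComplex_exact (m n : ℤ) (h : m + 1 = n) :
    (K.opcyclesShortComplex m n).Exact := by
  let φ : ShortComplex.mk (K.d m n) (K.pOpcycles n) (K.d_pOpcycles m n) ⟶
      K.opcyclesShortComplex m n :=
    { τ₁ := K.pOpcycles m
      τ₂ := 𝟙 _
      τ₃ := 𝟙 _
      comm₁₂ := by simp [opcyclesShortComplex]
      comm₂₃ := by simp [opcyclesShortComplex] }
  have h1 : Epi φ.τ₁ := inferInstanceAs (Epi (K.pOpcycles m))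
  have h2 : IsIso φ.τ₂ := inferInstanceAs (IsIso (𝟙 _))
  have h3 : Mono φ.τ₃ := inferInstanceAs (Mono (𝟙 _))
  exact (ShortComplex.exact_iff_of_epi_of_isIso_of_mono φ).mp (K.exact_d_pOpcycles m n h)

lemma opcyclesShortComplex_shortExact {m n : ℤ} (h : m + 1 = n) (hm : K.ExactAt m) :
    (K.opcyclesShortComplex m n).ShortExact where
  exact := K.opcyclesShortComplex_exact m n h
  mono_f := K.mono_fromOpcycles n h hm
  epi_g := inferInstanceAs (Epi (K.pOpcycles n))

end HomologicalComplex

lemma CategoryTheory.ShortComplex.Exact.nonempty_isColimit_cokernelCofork {A : Type*} [Category* A]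
    [Abelian A] {S : ShortComplex A} (hS : S.Exact) [Epi S.g] {Y₁ Y₂ : A} (e₁ : Y₁ ≅ S.X₁)
    (e₂ : Y₂ ≅ S.X₂) (f : Y₁ ⟶ Y₂) (h : e₁.hom ≫ S.f = f ≫ e₂.hom) :
    ∃ w : f ≫ e₂.hom ≫ S.g = 0, Nonempty (IsColimit (CokernelCofork.ofπ (e₂.hom ≫ S.g) w)) := by
  have w : f ≫ e₂.hom ≫ S.g = 0 := by rw [← reassoc_of% h, S.zero, comp_zero]
  have hT : (ShortComplex.mk _ _ w).Exact :=
    ShortComplex.exact_of_iso (ShortComplex.isoMk e₁.symm e₂.symm (Iso.refl _)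
      (by
      rw [Iso.symm_hom, Iso.symm_hom, Iso.inv_comp_eq, ← Category.assoc, h, Category.assoc,
        Iso.hom_inv_id, Category.comp_id]) (by simp)) hS
  have : Epi (ShortComplex.mk _ _ w).g := epi_comp _ _
  exact ⟨w, ⟨hT.gIsCokernel⟩⟩

/-! ### Long exact sequences of ℰxt in the first variable -/

namespace AlgebraicGeometry.Scheme.Modules

variable {X : Scheme.{u}} {M M' N : X.Modules} (I : InjectiveResolution N)

/-- `ℰxt^j(-, N)` is functorial for isomorphisms. -/
lemma nonempty_homology_homComplex_iso (e : M ≅ M') (j : ℕ) :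
    Nonempty ((homComplex I M).homology j ≅ (homComplex I M').homology j) := by
  let e' : homComplex I M ≅ homComplex I M' :=
    { hom := homComplexMap I e.inv
      inv := homComplexMap I e.hom
      hom_inv_id := by rw [homComplexMap_comp, e.hom_inv_id]; rfl
      inv_hom_id := by rw [homComplexMap_comp, e.inv_hom_id]; rfl }
  exact ⟨HomologicalComplex.homologyMapIso e' j⟩

lemma isZero_homology_homComplex_of_isZero (hM : IsZero M) (j : ℕ) :
    IsZero ((homComplex I M).homology j) := by
  have h : 𝟙 (homComplex I M) = 0 := by
    rw [← homComplexMap_zero I, ← hM.eq_of_src (𝟙 M) 0]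
    rfl
  rw [IsZero.iff_id_eq_zero, ← HomologicalComplex.homologyMap_id, h,
    HomologicalComplex.homologyMap_zero]

variable {S : ShortComplex X.Modules} (hS : S.ShortExact)
include hS

/-- The dual sequence is reversed, so its third term belongs to `S.X₁`: the relevant piece is
ℰxt^j(S.X₂) → ℰxt^j(S.X₁) → ℰxt^{j+1}(S.X₃). -/
lemma isZero_homology_homComplex_left {j : ℕ} (h₂ : IsZero ((homComplex I S.X₂).homology j))
    (h₃ : IsZero ((homComplex I S.X₃).homology (j + 1))) :
    IsZero ((homComplex I S.X₁).homology j) :=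
  ((homShortComplex_shortExact I hS).homology_exact₃ j (j + 1) rfl).isZero_of_both_zeros
    (h₂.eq_of_src _ _) (h₃.eq_of_tgt _ _)

lemma nonempty_homology_homComplex_iso_of_middle {j : ℕ}
    (h₂ : IsZero ((homComplex I S.X₂).homology j))
    (h₂' : IsZero ((homComplex I S.X₂).homology (j + 1))) :
    Nonempty ((homComplex I S.X₁).homology j ≅ (homComplex I S.X₃).homology (j + 1)) :=
  ⟨(homShortComplex_shortExact I hS).δIso j (j + 1) rfl h₂ h₂'⟩

lemma nonempty_homology_homComplex_iso_of_right {j : ℕ}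
    (h₃ : IsZero ((homComplex I S.X₃).homology j))
    (h₃' : IsZero ((homComplex I S.X₃).homology (j + 1))) :
    Nonempty ((homComplex I S.X₂).homology j ≅ (homComplex I S.X₁).homology j) := by
  have h := homShortComplex_shortExact I hS
  have h1 := (h.homology_exact₂ j).mono_g (h₃.eq_of_src _ _)
  have h2 := (h.homology_exact₃ j (j + 1) rfl).epi_f (h₃'.eq_of_tgt _ _)
  exact ⟨@asIso _ _ _ _ (HomologicalComplex.homologyMap (homShortComplex I S).g j)
    (@isIso_of_mono_of_epi _ _ _ _ _ _ h1 h2)⟩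

/-- The end of the exact sequence `ℋom(S.X₂, N) ⟶ ℋom(S.X₁, N) ⟶ ℰxt¹(S.X₃, N) ⟶ ℰxt¹(S.X₂, N)`. -/
lemma exists_isColimit_homology_homComplex (h₂ : IsZero ((homComplex I S.X₂).homology 1)) :
    ∃ (π : sheafHom S.X₁ N ⟶ (homComplex I S.X₃).homology 1) (w : sheafHomMap S.f (𝟙 N) ≫ π = 0),
      Nonempty (IsColimit (CokernelCofork.ofπ π w)) := by
  have h := homShortComplex_shortExact I hS
  have : Epi (ShortComplex.mk _ _ (h.comp_δ 0 1 rfl)).g := h.epi_δ 0 1 rfl h₂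
  obtain ⟨w, hw⟩ := (h.homology_exact₃ 0 1 rfl).nonempty_isColimit_cokernelCofork
    (sheafHomIsoHomology I S.X₂) (sheafHomIsoHomology I S.X₁) (sheafHomMap S.f (𝟙 N))
    (sheafHomIsoHomology_naturality I S.f)
  exact ⟨_, w, hw⟩

end AlgebraicGeometry.Scheme.Modules

/-! ### Dimension shifting: cohomology of the dual complex as ℰxt -/

namespace AlgebraicGeometry.Scheme.Modules

variable {X : Scheme.{u}} {N : X.Modules} (I : InjectiveResolution N)
  (K : CochainComplex X.Modules ℤ)

/-- The cocycles are ℋom(`K.opcycles m`, N). By the sequence `K.opcycles m ⟶ K.X n ⟶ K.opcycles n`,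
their quotient by the image of ℋom(`K.X n`, N) is ℰxt¹ of `K.opcycles n`. -/
lemma nonempty_homology_sheafHomMap_iso {l m n : ℤ} (hl : l + 1 = m) (hn : m + 1 = n)
    (hm : K.ExactAt m) (h : IsZero ((homComplex I (K.X n)).homology 1)) :
    Nonempty ((ShortComplex.mk (sheafHomMap (K.d m n) (𝟙 N)) (sheafHomMap (K.d l m) (𝟙 N)) (by
      rw [sheafHomMap_comp, K.d_comp_d, sheafHomMap_zero_left])).homology ≅
      (homComplex I (K.opcycles n)).homology 1) := by
  obtain ⟨π, w, ⟨hπ⟩⟩ := exists_isColimit_homology_homComplex I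
    (K.opcyclesShortComplex_shortExact hn hm) h
  have : Epi (ShortComplex.mk (K.d l m) (K.pOpcycles m) (K.d_pOpcycles l m)).g :=
    inferInstanceAs (Epi (K.pOpcycles m))
  have hex := exact_sheafHomMap (K.exact_d_pOpcycles l m hl) N
  have hmono : Mono (ShortComplex.mk (sheafHomMap (K.pOpcycles m) (𝟙 N))
    (sheafHomMap (K.d l m) (𝟙 N)) (by
      rw [sheafHomMap_comp, K.d_pOpcycles, sheafHomMap_zero_left])).f :=
    mono_sheafHomMap_of_epi (K.pOpcycles m) N
  have hi := hex.fIsKernel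
  let T := ShortComplex.mk (sheafHomMap (K.d m n) (𝟙 N)) (sheafHomMap (K.d l m) (𝟙 N)) (by
      rw [sheafHomMap_comp, K.d_comp_d, sheafHomMap_zero_left])
  have hf' : hi.lift (KernelFork.ofι _ T.zero) = sheafHomMap (K.fromOpcycles m n) (𝟙 N) := by
    apply Fork.IsLimit.hom_ext hi
    refine (Fork.IsLimit.lift_ι hi).trans ?_
    change sheafHomMap (K.d m n) (𝟙 N) = sheafHomMap _ _ ≫ sheafHomMap _ _
    rw [sheafHomMap_comp, K.p_fromOpcycles, Category.comp_id]
  -- Homology data require a cokernel of the lift itself, whereas `hπ` concerns a map only provably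
  -- equal to it. Generalizing over `g` permits the substitution.
  have hπ' (g) (hg : g = sheafHomMap (K.fromOpcycles m n) (𝟙 N)) (w' : g ≫ π = 0) :
      Nonempty (IsColimit (CokernelCofork.ofπ π w')) := by
    subst hg
    exact ⟨hπ⟩
  have wπ : hi.lift (KernelFork.ofι _ T.zero) ≫ π = 0 := by
    rw [hf']
    exact w
  let d : T.LeftHomologyData :=
    { K := sheafHom (K.opcycles m) N
      H := (homComplex I (K.opcycles n)).homology 1
      i := sheafHomMap (K.pOpcycles m) (𝟙 N)
      π := π
      wi := by rw [sheafHomMap_comp, K.d_pOpcycles, sheafHomMap_zero_left]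
      hi := hi
      wπ := wπ
      hπ := (hπ' _ hf' wπ).some }
  exact ⟨d.homologyIso⟩

variable {I} {K} (hK : ∀ m j, IsZero ((homComplex I (K.X m)).homology (j + 1)))
include hK

/-- In positive degrees `K.opcycles m` has a finite coresolution by the acyclic terms to its right.
The induction descends from degrees above `q`, where it is zero. -/
lemma isZero_homology_homComplex_opcycles {q : ℤ} (hq : ∀ m, q < m → IsZero (K.X m))
    (hex : ∀ m, 0 < m → K.ExactAt m) (m : ℤ) (hm : 0 < m) (j : ℕ) :
    IsZero ((homComplex I (K.opcycles m)).homology (j + 1)) := by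
  obtain ⟨r, hr⟩ : ∃ r : ℕ, q < m + r := ⟨(q + 1 - m).toNat, by omega⟩
  induction r generalizing m j with
  | zero =>
    refine isZero_homology_homComplex_of_isZero I ?_ _
    exact IsZero.of_epi (K.pOpcycles m) (hq m (by simpa using hr))
  | succ r ih =>
    exact isZero_homology_homComplex_left I (K.opcyclesShortComplex_shortExact rfl (hex m hm))
      (hK _ _) (ih (m + 1) (by omega) (j + 1) (by push_cast at hr; omega))

/-- Each step to the right through an acyclic term raises the ℰxt index by one. -/
lemma nonempty_homology_homComplex_opcycles_iso_zero (hex : ∀ m, m < 0 → K.ExactAt m) (b : ℕ)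
    (m : ℤ) (hm : m + b = 0) (j : ℕ) :
    Nonempty ((homComplex I (K.opcycles m)).homology (j + 1) ≅
      (homComplex I (K.opcycles 0)).homology (j + b + 1)) := by
  induction b generalizing m j with
  | zero =>
    obtain rfl : m = 0 := by simpa using hm
    exact ⟨Iso.refl _⟩
  | succ b ih =>
    obtain ⟨e₁⟩ := nonempty_homology_homComplex_iso_of_middle I
      (K.opcyclesShortComplex_shortExact rfl (hex m (by omega))) (hK (m + 1) j) (hK (m + 1) (j + 1))
    obtain ⟨e₂⟩ := ih (m + 1) (by push_cast at hm; omega) (j + 1)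
    rw [show j + (b + 1) + 1 = j + 1 + b + 1 by omega]
    exact ⟨e₁ ≪≫ e₂⟩

/-- The cohomology in degree `0` is the kernel of `K.opcycles 0 ⟶ K.X 1`. The image of this map is
also the kernel of `K.X 1 ⟶ K.opcycles 1`, hence has no higher ℰxt. -/
lemma nonempty_homology_homComplex_opcycles_zero_iso {q : ℤ} (hq : ∀ m, q < m → IsZero (K.X m))
    (hex : ∀ m, 0 < m → K.ExactAt m) (j : ℕ) :
    Nonempty ((homComplex I (K.opcycles 0)).homology (j + 1) ≅
      (homComplex I (K.homology 0)).homology (j + 1)) := by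
  let S₁ : ShortComplex X.Modules := ShortComplex.mk (K.homologyι 0)
    (Abelian.factorThruImage (K.fromOpcycles 0 1)) (by
      rw [← cancel_mono (Abelian.image.ι (K.fromOpcycles 0 1)), Category.assoc,
        Abelian.image.fac, K.homologyι_comp_fromOpcycles, zero_comp])
  let S₂ : ShortComplex X.Modules := ShortComplex.mk (Abelian.image.ι (K.fromOpcycles 0 1))
    (K.pOpcycles 1) (by
      rw [← cancel_epi (Abelian.factorThruImage (K.fromOpcycles 0 1)), ← Category.assoc,
        Abelian.image.fac, comp_zero]
      exact (K.opcyclesShortComplex 0 1).zero)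
  have hepi : Epi (Abelian.factorThruImage (K.fromOpcycles 0 1)) :=
    inferInstanceAs (Epi (Abelian.factorThruImage (C := X.Modules) _))
  have h₀ : (ShortComplex.mk _ _ (K.homologyι_comp_fromOpcycles 0 1)).Exact :=
    ShortComplex.exact_of_f_is_kernel _ (K.homologyIsKernel 0 1 (by simp))
  have h₁ : S₁.ShortExact :=
    { exact := by
        let φ : S₁ ⟶ ShortComplex.mk _ _ (K.homologyι_comp_fromOpcycles 0 1) :=
          { τ₁ := 𝟙 _
            τ₂ := 𝟙 _
            τ₃ := Abelian.image.ι (K.fromOpcycles 0 1)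
            comm₁₂ := by simp [S₁]
            comm₂₃ := by simp [S₁] }
        have h1 : Epi φ.τ₁ := inferInstanceAs (Epi (𝟙 _))
        have h2 : IsIso φ.τ₂ := inferInstanceAs (IsIso (𝟙 _))
        have h3 : Mono φ.τ₃ := inferInstanceAs (Mono (Abelian.image.ι _))
        exact (ShortComplex.exact_iff_of_epi_of_isIso_of_mono φ).mpr h₀
      mono_f := inferInstanceAs (Mono (K.homologyι 0))
      epi_g := hepi }
  have h₂ : S₂.ShortExact :=
    { exact := by
        let φ : K.opcyclesShortComplex 0 1 ⟶ S₂ :=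
          { τ₁ := Abelian.factorThruImage (K.fromOpcycles 0 1)
            τ₂ := 𝟙 _
            τ₃ := 𝟙 _
            comm₁₂ := by simp [S₂, HomologicalComplex.opcyclesShortComplex]
            comm₂₃ := by simp [S₂, HomologicalComplex.opcyclesShortComplex] }
        have h1 : Epi φ.τ₁ := hepi
        have h2 : IsIso φ.τ₂ := inferInstanceAs (IsIso (𝟙 _))
        have h3 : Mono φ.τ₃ := inferInstanceAs (Mono (𝟙 _))
        exact (ShortComplex.exact_iff_of_epi_of_isIso_of_mono φ).mp
          (K.opcyclesShortComplex_exact 0 1 rfl)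
      mono_f := inferInstanceAs (Mono (Abelian.image.ι _))
      epi_g := inferInstanceAs (Epi (K.pOpcycles 1)) }
  have hB (i : ℕ) : IsZero ((homComplex I S₂.X₁).homology (i + 1)) :=
    isZero_homology_homComplex_left I h₂ (hK 1 i)
      (isZero_homology_homComplex_opcycles hK hq hex 1 (by omega) (i + 1))
  exact nonempty_homology_homComplex_iso_of_right I h₁ (hB j) (hB (j + 1))

/-- The dual of a complex of `ℋom(-, N)`-acyclic modules with cohomology concentrated in degree
zero computes `ℰxt(-, N)` of this cohomology. -/
theorem nonempty_homology_dualComplex_iso {q : ℤ} (hq : ∀ m, q < m → IsZero (K.X m))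
    (hex : ∀ m, m ≠ 0 → K.ExactAt m) (c i : ℤ) (a : ℕ) (ha : i + c = a + 1) :
    Nonempty ((dualComplex K N c).homology i ≅ sheafExt (a + 1) (K.homology 0) N) := by
  -- Here `m = -(a + 1)` is nonzero, so `K` is exact there, and `n = -a`: ℰxt¹ of `K.opcycles (-a)`
  -- moves to ℰxt^{a+1} of `K.opcycles 0`.
  obtain ⟨e₀⟩ := nonempty_homology_sheafHomMap_iso I K (l := -(i + 1) - c) (m := -i - c)
    (n := -(i - 1) - c) (by omega) (by omega) (hex _ (by omega)) (hK _ 0)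
  obtain ⟨e₁⟩ := nonempty_homology_homComplex_opcycles_iso_zero hK (fun m hm ↦ hex m hm.ne) a
    (-(i - 1) - c) (by omega) 0
  obtain ⟨e₂⟩ := nonempty_homology_homComplex_opcycles_zero_iso hK hq
    (fun m hm ↦ hex m hm.ne') a
  let e₃ := ShortComplex.homologyMapIso ((dualComplex K N c).isoSc' (i - 1) i (i + 1)
    (by simp) (by simp))
  have h0 : 0 + a + 1 = a + 1 := by omega
  rw [h0] at e₁
  exact ⟨e₃ ≪≫ e₀ ≪≫ e₁ ≪≫ e₂ ≪≫ (sheafExtIso (a + 1) (K.homology 0) N I).symm⟩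

end AlgebraicGeometry.Scheme.Modules

/-! ### Local bases, line bundles and their sums -/

namespace AlgebraicGeometry.Scheme.Modules

variable {X : Scheme.{u}} {M N : X.Modules}

/-- A family of sections of `M` over `W` is a basis of `M|_W` if it is a basis of `Γ(M, V)` for
all open `V ≤ W`. -/
def IsBasisOn {ι : Type*} [Fintype ι] (M : X.Modules) (W : X.Opens) (e : ι → Γ(M, W)) : Prop :=
  ∀ (V : X.Opens) (h : V ≤ W), Function.Bijective
    (fun v : ι → Γ(X, V) ↦ ∑ i, v i • M.presheaf.map (homOfLE h).op (e i))

/-- A section `e` over `W` is a generator of `M|_W` if it is a basis of `Γ(M, V)` for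
all open `V ≤ W`. -/
def IsGeneratorOn (M : X.Modules) (W : X.Opens) (e : Γ(M, W)) : Prop :=
  ∀ (V : X.Opens) (h : V ≤ W), Function.Bijective
    (fun r : Γ(X, V) ↦ r • M.presheaf.map (homOfLE h).op e)

section

variable {ι : Type*} [Fintype ι] {W : X.Opens}

lemma IsBasisOn.res {e : ι → Γ(M, W)} (he : M.IsBasisOn W e) {V : X.Opens} (h : V ≤ W) :
    M.IsBasisOn V (fun i ↦ M.presheaf.map (homOfLE h).op (e i)) := fun V' h' ↦ by
  simpa only [presheaf_map_map] using he V' (h'.trans h)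

/-- A basis of sections of `M` over an open set. -/
def IsBasisOn.basis {e : ι → Γ(M, W)} (he : M.IsBasisOn W e) (V : X.Opens) (h : V ≤ W) :
    Module.Basis ι Γ(X, V) Γ(M, V) :=
  Module.Basis.ofEquivFun (LinearEquiv.ofBijective
    (Fintype.linearCombination Γ(X, V) fun i ↦ M.presheaf.map (homOfLE h).op (e i))
    (he V h)).symm

lemma IsBasisOn.basis_apply {e : ι → Γ(M, W)} (he : M.IsBasisOn W e) (V : X.Opens) (h : V ≤ W)
    (i : ι) : he.basis V h i = M.presheaf.map (homOfLE h).op (e i) := by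
  classical
  rw [IsBasisOn.basis, Module.Basis.coe_ofEquivFun, LinearEquiv.symm_symm]
  refine (Fintype.linearCombination_apply_single Γ(X, V) _ i 1).trans ?_
  rw [one_smul]

lemma IsBasisOn.basis_repr_map {e : ι → Γ(M, W)} (he : M.IsBasisOn W e) {V V' : X.Opens}
    (h : V ≤ W) (h' : V' ≤ V) (s : Γ(M, V)) (i : ι) :
    (he.basis V' (h'.trans h)).repr (M.presheaf.map (homOfLE h').op s) i =
      X.presheaf.map (homOfLE h').op ((he.basis V h).repr s i) := by
  conv_lhs => rw [← (he.basis V h).sum_repr s]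
  simp only [map_sum, map_smul, IsBasisOn.basis_apply, presheaf_map_map]
  simp only [← he.basis_apply V' (h'.trans h)]
  rw [← map_sum, Module.Basis.repr_sum_self]

/-- The local homomorphism with prescribed values on a basis. -/
def IsBasisOn.constr {e : ι → Γ(M, W)} (he : M.IsBasisOn W e) {V : X.Opens} (h : V ≤ W)
    (t : ι → Γ(N, V)) : LocalHom M N V where
  app V' h' := (he.basis V' (h'.trans h)).constr Γ(X, V') fun i ↦
    N.presheaf.map (homOfLE h').op (t i)
  naturality V' V'' h' h'' s := by
    rw [Module.Basis.constr_apply_fintype, Module.Basis.constr_apply_fintype]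
    simp only [Module.Basis.equivFun_apply]
    simp only [he.basis_repr_map (h'.trans h) h'', map_sum, map_smul, presheaf_map_map]

lemma IsBasisOn.constr_app {e : ι → Γ(M, W)} (he : M.IsBasisOn W e) {V : X.Opens} (h : V ≤ W)
    (t : ι → Γ(N, V)) (V' : X.Opens) (h' : V' ≤ V) (i : ι) :
    (he.constr h t).app V' h' (M.presheaf.map (homOfLE (h'.trans h)).op (e i)) =
      N.presheaf.map (homOfLE h').op (t i) := by
  rw [← he.basis_apply V' (h'.trans h)]
  exact Module.Basis.constr_basis _ _ _ _

lemma IsBasisOn.localHom_ext {e : ι → Γ(M, W)} (he : M.IsBasisOn W e) {V : X.Opens} (h : V ≤ W)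
    {f g : LocalHom M N V} (hfg : ∀ i, f.app V le_rfl (M.presheaf.map (homOfLE h).op (e i)) =
      g.app V le_rfl (M.presheaf.map (homOfLE h).op (e i))) : f = g := by
  refine LocalHom.ext' fun V' h' s ↦ ?_
  refine LinearMap.congr_fun ((he.basis V' (h'.trans h)).ext fun i ↦ ?_) s
  rw [he.basis_apply, ← presheaf_map_map M h h', f.naturality V V' le_rfl h', hfg,
    g.naturality V V' le_rfl h']

lemma isBasisOn_unique_iff [Unique ι] {e : ι → Γ(M, W)} :
    M.IsBasisOn W e ↔ M.IsGeneratorOn W (e default) := by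
  refine forall₂_congr fun V h ↦ ?_
  rw [← Function.Bijective.of_comp_iff _ (Equiv.funUnique ι Γ(X, V)).symm.bijective]
  refine iff_of_eq (congrArg _ (funext fun r ↦ ?_))
  simp

end

/-- `M` is locally free of finite rank. -/
def HasLocalBases (M : X.Modules) : Prop :=
  ∀ x : X, ∃ (W : X.Opens) (m : ℕ) (e : Fin m → Γ(M, W)), x ∈ W ∧ M.IsBasisOn W e

/-- `ℋom(M, -)` is exact if `M` is locally free of finite rank. -/
lemma HasLocalBases.preservesEpimorphisms (hM : M.HasLocalBases) :
    (sheafHomFunctor M).PreservesEpimorphisms where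
  preserves {A B} g _ := by
    refine epi_of_locally_surjective _ fun U f x hx ↦ ?_
    let f' : LocalHom M B U := f
    -- The images of the finitely many basis sections lift over a common neighbourhood `V'`, and a
    -- homomorphism may be prescribed on a basis.
    obtain ⟨W, m, e, hxW, he⟩ := hM x
    have hxi : x ∈ W ⊓ U := ⟨hxW, hx⟩
    choose V hV t hxV ht using fun i ↦ exists_app_eq_of_epi g (f'.app (W ⊓ U) inf_le_right
      (M.presheaf.map (homOfLE inf_le_left).op (e i))) hxi
    let V' : X.Opens := (W ⊓ U) ⊓ Finset.univ.inf V
    have hV' (i) : V' ≤ V i := inf_le_right.trans (Finset.inf_le (Finset.mem_univ i))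
    have hxV' : x ∈ V' := by
      refine ⟨hxi, ?_⟩
      simpa [TopologicalSpace.Opens.coe_finset_inf] using hxV
    have h1 : V' ≤ W := inf_le_left.trans inf_le_left
    have h2 : V' ≤ U := inf_le_left.trans inf_le_right
    let φ : LocalHom M A V' := he.constr h1 fun i ↦ A.presheaf.map (homOfLE (hV' i)).op (t i)
    refine ⟨V', h2, φ, hxV', ?_⟩
    change LocalHom.comp (𝟙 M) g φ = LocalHom.res h2 f'
    refine he.localHom_ext h1 fun i ↦ ?_
    have e1 := he.constr_app h1 (fun i ↦ A.presheaf.map (homOfLE (hV' i)).op (t i)) V' le_rfl i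
    have e2 : (LocalHom.comp (𝟙 M) g φ).app V' le_rfl (M.presheaf.map (homOfLE h1).op (e i)) =
      g.app V' (φ.app V' le_rfl (M.presheaf.map (homOfLE h1).op (e i))) := rfl
    have e3 := f'.naturality (W ⊓ U) V' inf_le_right inf_le_left
      (M.presheaf.map (homOfLE inf_le_left).op (e i))
    rw [e2, e1, presheaf_map_map, app_map, ht, presheaf_map_map, LocalHom.res_app, ← e3,
      presheaf_map_map]

section LineBundle

variable (X) in
/-- The structure sheaf, as an `𝒪_X`-module. -/
def unit : X.Modules := SheafOfModules.unit X.ringCatSheaf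

lemma isIso_of_bijective_app (φ : M ⟶ N) (h : ∀ V, Function.Bijective (φ.app V)) : IsIso φ := by
  rw [Hom.isIso_iff_isIso_app]
  intro V
  rw [ConcreteCategory.isIso_iff_bijective]
  exact h V

lemma bijective_app (φ : M ⟶ N) [h : IsIso φ] (V : X.Opens) : Function.Bijective (φ.app V) :=
  (ConcreteCategory.isIso_iff_bijective _).mp (Hom.isIso_iff_isIso_app.mp h V)

/-- An `𝒪_X`-module with a global generator is isomorphic to `𝒪_X`. -/
lemma nonempty_iso_unit {e : Γ(M, ⊤)} (he : M.IsGeneratorOn ⊤ e) : Nonempty (M ≅ unit X) := by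
  let s : SheafOfModules.sections (R := X.ringCatSheaf) M :=
    _root_.PresheafOfModules.sectionsMk
      (fun V ↦ M.presheaf.map (homOfLE (le_top : V.unop ≤ ⊤)).op e)
      fun V V' i ↦ presheaf_map_map M le_top (leOfHom i.unop) e
  let φ : unit X ⟶ M := (SheafOfModules.unitHomEquiv (R := X.ringCatSheaf) M).symm s
  have := isIso_of_bijective_app φ fun V ↦ he V le_top
  exact ⟨(asIso φ).symm⟩

lemma exists_isGeneratorOn_of_iso (φ : M ≅ unit X) : ∃ e : Γ(M, ⊤), M.IsGeneratorOn ⊤ e := by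
  let ψ : unit X ⟶ M := φ.inv
  have hψ : IsIso ψ := inferInstanceAs (IsIso φ.inv)
  let o (V : X.Opens) : Γ(unit X, V) := (1 : Γ(X, V))
  have ho (V : X.Opens) (r : Γ(X, V)) : r • o V = (r : Γ(unit X, V)) := mul_one r
  refine ⟨ψ.app ⊤ (o ⊤), fun V h ↦ ?_⟩
  have h2 (r : Γ(X, V)) : r • M.presheaf.map (homOfLE h).op (ψ.app ⊤ (o ⊤)) = ψ.app V r := by
    have h3 : (unit X).presheaf.map (homOfLE h).op (o ⊤) = o V :=
      map_one (X.presheaf.map (homOfLE h).op).hom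
    rw [← app_map, h3, ← Hom.app_smul, ho]
  rw [show (fun r : Γ(X, V) ↦ r • M.presheaf.map (homOfLE h).op (ψ.app ⊤ (o ⊤))) =
    ψ.app V from funext h2]
  exact bijective_app ψ V

/-- `W` is kept apart from `U.ι ''ᵁ ⊤` so that the lemma also applies with `W = U`, an equality that
is not definitional. -/
lemma isGeneratorOn_restrict {U : X.Opens} {W : X.Opens} (hW : W = U.ι ''ᵁ ⊤) (e : Γ(M, W)) :
    M.IsGeneratorOn W e ↔ (M.restrict U.ι).IsGeneratorOn ⊤
      ((M.restrictAppIso U.ι ⊤).inv (M.presheaf.map (homOfLE hW.ge).op e)) := by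
  have key (V' : (U : Scheme.{u}).Opens) (h : U.ι ''ᵁ V' ≤ W) :
      Function.Bijective (fun r : Γ(X, U.ι ''ᵁ V') ↦ r • M.presheaf.map (homOfLE h).op e) ↔
      Function.Bijective (fun r : Γ(U, V') ↦ r • (M.restrict U.ι).presheaf.map
        (homOfLE (le_top : V' ≤ ⊤)).op
        ((M.restrictAppIso U.ι ⊤).inv (M.presheaf.map (homOfLE hW.ge).op e))) := by
    have h2 : Function.Bijective (U.ι.appIso V').inv :=
      (ConcreteCategory.isIso_iff_bijective _).mp inferInstance
    rw [← Function.Bijective.of_comp_iff _ h2]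
    refine iff_of_eq (congrArg _ (funext fun r ↦ ?_))
    have h3 : M.presheaf.map (homOfLE h).op e =
      M.presheaf.map (homOfLE (Scheme.Hom.image_mono _ (le_top : V' ≤ ⊤))).op
        (M.presheaf.map (homOfLE hW.ge).op e) := (presheaf_map_map M _ _ _).symm
    rw [Function.comp_apply, h3]
    rfl
  constructor
  · intro H V' _
    exact (key V' ((Scheme.Hom.image_mono _ le_top).trans hW.ge)).mp (H _ _)
  · intro H V h
    obtain ⟨V', rfl⟩ : ∃ V' : (U : Scheme.{u}).Opens, V = U.ι ''ᵁ V' :=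
      ⟨U.ι ⁻¹ᵁ V, by
        rw [Scheme.Hom.image_preimage_eq_opensRange_inf, eq_comm, inf_eq_right]
        subst hW
        exact h.trans (Scheme.Hom.image_le_opensRange _ _)⟩
    exact (key V' h).mpr (H V' le_top)

/-- A trivialization over an open subscheme amounts to the section matching `1`. In this form
everything takes place on `X` itself. -/
lemma isLineBundle_iff : M.IsLineBundle ↔
    ∀ x : X, ∃ (W : X.Opens) (e : Γ(M, W)), x ∈ W ∧ M.IsGeneratorOn W e := by
  refine forall_congr' fun x ↦ ⟨?_, ?_⟩
  · rintro ⟨U, hx, ⟨φ⟩⟩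
    obtain ⟨e, he⟩ := exists_isGeneratorOn_of_iso φ
    refine ⟨U.ι ''ᵁ ⊤, (M.restrictAppIso U.ι ⊤).hom e, by simpa using hx,
      (isGeneratorOn_restrict rfl _).mpr ?_⟩
    convert he
    simp
  · rintro ⟨W, e, hx, he⟩
    exact ⟨W, hx, nonempty_iso_unit ((isGeneratorOn_restrict (U := W) (by simp) e).mp he)⟩

/-- `ℋom(L, N)` is a line bundle if `L` and `N` are. -/
lemma IsLineBundle.sheafHom (hM : M.IsLineBundle) (hN : N.IsLineBundle) :
    (sheafHom M N).IsLineBundle := by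
  rw [isLineBundle_iff] at *
  intro x
  obtain ⟨W₁, e, hx₁, he⟩ := hM x
  obtain ⟨W₂, f, hx₂, hf⟩ := hN x
  let W := W₁ ⊓ W₂
  have h1 : W ≤ W₁ := inf_le_left
  have h2 : W ≤ W₂ := inf_le_right
  have he' : M.IsBasisOn W₁ (fun _ : Unit ↦ e) := isBasisOn_unique_iff.mpr he
  -- The local generator of ℋom(M, N) carries the generator of `M` to that of `N`.
  let φ : LocalHom M N W := he'.constr h1 fun _ ↦ N.presheaf.map (homOfLE h2).op f
  have hφ (V : X.Opens) (h : V ≤ W) :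
      φ.app V h (M.presheaf.map (homOfLE (h.trans h1)).op e) =
        N.presheaf.map (homOfLE (h.trans h2)).op f := by
    have := he'.constr_app h1 (fun _ ↦ N.presheaf.map (homOfLE h2).op f) V h ()
    rwa [presheaf_map_map] at this
  refine ⟨W, φ, ⟨hx₁, hx₂⟩, fun V h ↦ ?_⟩
  have hf' := hf V (h.trans h2)
  have hs (r : Γ(X, V)) : (r • LocalHom.res h φ).app V le_rfl
      (M.presheaf.map (homOfLE (h.trans h1)).op e) =
        r • N.presheaf.map (homOfLE (h.trans h2)).op f := by
    simp [hφ]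
  change Function.Bijective fun r : Γ(X, V) ↦ r • LocalHom.res h φ
  constructor
  · intro r r' hr
    apply hf'.1
    change r • _ = r' • _
    rw [← hs, ← hs]
    exact congr(LocalHom.app $hr V le_rfl _)
  · intro ψ
    obtain ⟨r, hr⟩ := hf'.2 (ψ.app V le_rfl (M.presheaf.map (homOfLE (h.trans h1)).op e))
    exact ⟨r, he'.localHom_ext (h.trans h1) fun _ ↦ (hs r).trans hr⟩

end LineBundle

section Sum

/-- A finite direct sum of line bundles, in terms of inclusions and projections. -/
lemma isSumOfLineBundles_iff : M.IsSumOfLineBundles ↔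
    ∃ (m : ℕ) (L : Fin m → X.Modules) (ι : ∀ j, L j ⟶ M) (π : ∀ j, M ⟶ L j),
      (∀ j, (L j).IsLineBundle) ∧ (∀ j, ι j ≫ π j = 𝟙 _) ∧ (∀ j k, j ≠ k → ι j ≫ π k = 0) ∧
      ∑ j, π j ≫ ι j = 𝟙 M := by
  constructor
  · rintro ⟨m, L, hL, ⟨φ⟩⟩
    have : HasFiniteBiproducts X.Modules := HasFiniteBiproducts.of_hasFiniteCoproducts
    let ψ : M ≅ ⨁ L := φ ≪≫ (biproduct.isoCoproduct L).symm
    refine ⟨m, L, fun j ↦ biproduct.ι L j ≫ ψ.inv, fun j ↦ ψ.hom ≫ biproduct.π L j, hL,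
      fun j ↦ by simp, fun j k h ↦ by simp [biproduct.ι_π_ne _ h], ?_⟩
    have : ∑ j, ψ.hom ≫ (biproduct.π L j ≫ biproduct.ι L j) ≫ ψ.inv = 𝟙 M := by
      rw [← Preadditive.comp_sum, ← Preadditive.sum_comp, biproduct.total]
      simp
    simpa using this
  · rintro ⟨m, L, ι, π, hL, h1, h2, h3⟩
    let b : Bicone L :=
      { pt := M
        ι := ι
        π := π
        ι_π := fun j k ↦ by
          split_ifs with h
          · subst h; simpa using h1 j
          · exact h2 j k h }
    have hb : b.IsBilimit := isBilimitOfTotal b h3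
    exact ⟨m, L, hL, ⟨hb.isColimit.coconePointUniqueUpToIso (colimit.isColimit _)⟩⟩

lemma sheafHomMap_sum_left {J : Type*} (s : Finset J) (a : J → (M ⟶ M)) :
    sheafHomMap (∑ j ∈ s, a j) (𝟙 N) = ∑ j ∈ s, sheafHomMap (a j) (𝟙 N) := by
  classical
  have hadd (a b : M ⟶ M) : sheafHomMap (a + b) (𝟙 N) = sheafHomMap a (𝟙 N) + sheafHomMap b (𝟙 N) :=
    sheafHom_ext fun U f V hV s ↦ map_add (LocalHom.app (M := M) (N := N) f V hV) _ _
  induction s using Finset.induction_on with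
  | empty => simpa using sheafHomMap_zero_left _
  | insert i s hi ih => rw [Finset.sum_insert hi, Finset.sum_insert hi, hadd, ih]

lemma IsSumOfLineBundles.sheafHom (hM : M.IsSumOfLineBundles) (hN : N.IsLineBundle) :
    (sheafHom M N).IsSumOfLineBundles := by
  rw [isSumOfLineBundles_iff] at *
  obtain ⟨m, L, ι, π, hL, h1, h2, h3⟩ := hM
  refine ⟨m, fun j ↦ Modules.sheafHom (L j) N, fun j ↦ sheafHomMap (π j) (𝟙 N),
    fun j ↦ sheafHomMap (ι j) (𝟙 N), fun j ↦ (hL j).sheafHom hN, fun j ↦ ?_, fun j k h ↦ ?_, ?_⟩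
  · rw [sheafHomMap_comp, h1, Category.comp_id, sheafHomMap_id]
  · rw [sheafHomMap_comp, h2 _ _ h.symm, sheafHomMap_zero_left]
  · simp_rw [sheafHomMap_comp, Category.comp_id]
    rw [← sheafHomMap_sum_left, h3, sheafHomMap_id]

lemma Hom.sum_app {J : Type*} (s : Finset J) (a : J → (M ⟶ N)) (U : X.Opens) (t : Γ(M, U)) :
    (∑ j ∈ s, a j).app U t = ∑ j ∈ s, (a j).app U t := by
  classical
  induction s using Finset.induction_on with
  | empty => simp
  | insert i s hi ih => rw [Finset.sum_insert hi, Finset.sum_insert hi, Hom.add_app, ← ih]; rfl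

/-- A finite direct sum of line bundles is locally free. -/
lemma IsSumOfLineBundles.hasLocalBases (hM : M.IsSumOfLineBundles) : M.HasLocalBases := by
  rw [isSumOfLineBundles_iff] at hM
  obtain ⟨m, L, ι, π, hL, h1, h2, h3⟩ := hM
  intro x
  choose W' e' hxW' he' using fun j ↦ isLineBundle_iff.mp (hL j) x
  let W : X.Opens := Finset.univ.inf W'
  have hW (j) : W ≤ W' j := Finset.inf_le (Finset.mem_univ j)
  have hxW : x ∈ W := by
    rw [← SetLike.mem_coe, TopologicalSpace.Opens.coe_finset_inf]
    simpa using hxW'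
  refine ⟨W, m, fun j ↦ (ι j).app W ((L j).presheaf.map (homOfLE (hW j)).op (e' j)), hxW,
    fun V h ↦ ?_⟩
  let b (j) := (L j).presheaf.map (homOfLE (h.trans (hW j))).op (e' j)
  have hb (j) : Function.Bijective (fun r : Γ(X, V) ↦ r • b j) := he' j V (h.trans (hW j))
  have hs (v : Fin m → Γ(X, V)) : ∑ i, v i • M.presheaf.map (homOfLE h).op
      ((ι i).app W ((L i).presheaf.map (homOfLE (hW i)).op (e' i))) =
        ∑ i, (ι i).app V (v i • b i) := by
    refine Finset.sum_congr rfl fun i _ ↦ ?_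
    rw [← app_map, presheaf_map_map, Hom.app_smul]
  have hπ (v : ∀ i, Γ(L i, V)) (j) : (π j).app V (∑ i, (ι i).app V (v i)) = v j := by
    rw [map_sum, Finset.sum_eq_single j]
    · exact congr(Hom.app $(h1 j) V (v j))
    · intro i _ hij
      exact congr(Hom.app $(h2 i j hij) V (v i))
    · simp
  simp_rw [hs]
  constructor
  · intro v w hvw
    funext j
    refine (hb j).1 ?_
    have := congr((π j).app V $hvw)
    simpa only [hπ] using this
  · intro s
    choose v hv using fun j ↦ (hb j).2 ((π j).app V s)
    refine ⟨v, ?_⟩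
    dsimp only at hv ⊢
    simp_rw [hv]
    have := congr(Hom.app $h3 V s)
    rw [Hom.sum_app] at this
    exact this

end Sum

end AlgebraicGeometry.Scheme.Modules

/-! ### Top exterior powers and Kähler differentials -/

/-- A basis of `M` with `n` elements gives a generator of `⋀ⁿ M`. -/
lemma Module.Basis.bijective_smul_ιMulti {R M : Type*} [CommRing R] [AddCommGroup M] [Module R M]
    {n : ℕ} (b : Module.Basis (Fin n) R M) :
    Function.Bijective fun r : R ↦ r • exteriorPower.ιMulti R n b := by
  -- The standard basis of `⋀ⁿ M` is indexed by the `n`-element subsets of `Fin n`, of which there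
  -- is one.
  let s₀ : Set.powersetCard (Fin n) n := ⟨Finset.univ, by simp⟩
  let _ : Unique (Set.powersetCard (Fin n) n) :=
    { default := s₀
      uniq := fun s ↦ Subtype.ext ((Finset.card_eq_iff_eq_univ _).mp (by simp)) }
  let b' := b.exteriorPower n
  have h : b' default = exteriorPower.ιMulti R n b := by
    rw [exteriorPower.basis_apply]
    have h0 : Set.powersetCard.ofFinEmbEquiv.symm s₀ = RelEmbedding.refl (· ≤ ·) := by
      refine OrderEmbedding.range_inj.mp ?_
      rw [(Finite.injective_iff_surjective.mp (RelEmbedding.injective _)).range_eq,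
        (Finite.injective_iff_surjective.mp (RelEmbedding.injective _)).range_eq]
    change exteriorPower.ιMulti R n (b ∘ Set.powersetCard.ofFinEmbEquiv.symm s₀) = _
    rw [h0]
    rfl
  have h2 : (fun r : R ↦ r • exteriorPower.ιMulti R n b) =
      b'.equivFun.symm ∘ (Equiv.funUnique (Set.powersetCard (Fin n) n) R).symm := by
    funext r
    simp [← h, Module.Basis.equivFun_symm_apply]
  rw [h2]
  exact b'.equivFun.symm.bijective.comp (Equiv.bijective _)

open KaehlerDifferential in
/-- For an algebra `B` étale over `k[Y₁, …, Yₙ]`, the module of differential forms of degree `n` of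
`B` is free on `dY₁ ∧ ⋯ ∧ dYₙ`. -/
lemma KaehlerDifferential.bijective_smul_ιMulti_D (k B : Type*) [CommRing k] [CommRing B]
    (n : ℕ) [Algebra k B] [Algebra (MvPolynomial (Fin n) k) B]
    [IsScalarTower k (MvPolynomial (Fin n) k) B]
    [Algebra.FormallyEtale (MvPolynomial (Fin n) k) B] :
    Function.Bijective fun r : B ↦ r • exteriorPower.ιMulti B n
      (fun i ↦ D k B (algebraMap _ B (MvPolynomial.X i : MvPolynomial (Fin n) k))) := by
  -- Along a formally étale map Kähler differentials are obtained by base change, so the `dYᵢ`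
  -- remain a basis.
  let b := ((mvPolynomialBasis k (Fin n)).baseChange B).map
    (tensorKaehlerEquivOfFormallyEtale k (MvPolynomial (Fin n) k) B)
  convert b.bijective_smul_ιMulti using 5 with r i
  simp [b]

/-! ### The coordinate ring of a standard chart -/

namespace MvPolynomial

attribute [local instance] MvPolynomial.gradedAlgebra

open HomogeneousLocalization

variable (k : Type*) [CommRing k] {n : ℕ} (i : Fin (n + 1))

lemma X_mem_homogeneousSubmodule_one (j : Fin (n + 1)) :
    (X j : MvPolynomial (Fin (n + 1)) k) ∈ homogeneousSubmodule (Fin (n + 1)) k 1 :=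
  isHomogeneous_X k j

/-- The coordinates `xⱼ / xᵢ` of the standard chart `xᵢ ≠ 0` of projective space. -/
def chartCoord (j : Fin n) :
    Away (homogeneousSubmodule (Fin (n + 1)) k) (X i : MvPolynomial (Fin (n + 1)) k) :=
  Away.mk _ (X_mem_homogeneousSubmodule_one k i) 1 (X (i.succAbove j))
    (X_mem_homogeneousSubmodule_one k _)

/-- The ring homomorphism from `k[Y₁, …, Yₙ]` to the ring of functions of the standard chart
`xᵢ ≠ 0` of projective space. -/
def chartMap : MvPolynomial (Fin n) k →+*
    Away (homogeneousSubmodule (Fin (n + 1)) k) (X i : MvPolynomial (Fin (n + 1)) k) :=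
  eval₂Hom ((fromZeroRingHom _ _).comp (algebraMap k (homogeneousSubmodule (Fin (n + 1)) k 0)))
    (chartCoord k i)

/-- Setting `xᵢ = 1`. -/
def dehomogenize : MvPolynomial (Fin (n + 1)) k →+* MvPolynomial (Fin n) k :=
  eval₂Hom C (i.insertNth 1 X)

lemma dehomogenize_X_self : dehomogenize k i (X i) = 1 := by simp [dehomogenize]

lemma dehomogenize_X_succAbove (j : Fin n) : dehomogenize k i (X (i.succAbove j)) = X j := by
  simp [dehomogenize]

/-- The function `xᵢ` in the localization. -/
lemma val_chartMap_X (j : Fin n) : (chartMap k i (X j)).val *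
    algebraMap (MvPolynomial (Fin (n + 1)) k)
      (Localization.Away (X i : MvPolynomial (Fin (n + 1)) k)) (X i) =
      algebraMap (MvPolynomial (Fin (n + 1)) k) _ (X (i.succAbove j)) := by
  simp only [chartMap, chartCoord, eval₂Hom_X', Away.val_mk, pow_one]
  rw [Localization.mk_eq_mk'_apply, IsLocalization.mk'_spec]

lemma val_chartMap_C (r : k) : (chartMap k i (C r)).val =
    algebraMap (MvPolynomial (Fin (n + 1)) k)
      (Localization.Away (X i : MvPolynomial (Fin (n + 1)) k)) (C r) := by
  rw [chartMap, eval₂Hom_C]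
  exact Localization.mk_one_eq_algebraMap _

/-- Dehomogenization sends `X i` to `1`, so it extends to the localization and gives a left inverse.
-/
lemma chartMap_injective : Function.Injective (chartMap k i) := by
  have hu : IsUnit (dehomogenize k i (X i)) := by rw [dehomogenize_X_self]; exact isUnit_one
  let ρ₀ : Localization.Away (X i : MvPolynomial (Fin (n + 1)) k) →+* MvPolynomial (Fin n) k :=
    IsLocalization.Away.lift (X i) hu
  have hρ₀ (p) : ρ₀ (algebraMap _ _ p) = dehomogenize k i p := IsLocalization.Away.lift_eq _ hu p
  let ρ : Away (homogeneousSubmodule (Fin (n + 1)) k) (X i : MvPolynomial (Fin (n + 1)) k) →+*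
      MvPolynomial (Fin n) k := ρ₀.comp (algebraMap _ _)
  have h : ρ.comp (chartMap k i) = RingHom.id _ := by
    refine MvPolynomial.ringHom_ext (fun r ↦ ?_) fun j ↦ ?_
    · change ρ₀ (chartMap k i (C r)).val = C r
      rw [val_chartMap_C, hρ₀, dehomogenize, eval₂Hom_C]
    · change ρ₀ (chartMap k i (X j)).val = X j
      have := congr(ρ₀ $(val_chartMap_X k i j))
      rwa [map_mul, hρ₀, hρ₀, dehomogenize_X_self, dehomogenize_X_succAbove, mul_one] at this
  exact Function.LeftInverse.injective (g := ρ) fun p ↦ congr($h p)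

/-- A fraction `x / X i ^ d` is the image of the dehomogenized `x`. On each monomial the factor `X i
^ d` restores one factor `X i` per variable, because the monomial has degree `d`. -/
lemma chartMap_surjective : Function.Surjective (chartMap k i) := by
  intro z
  obtain ⟨d, x, hx, rfl⟩ := Away.mk_surjective _ (X_mem_homogeneousSubmodule_one k i) z
  refine ⟨dehomogenize k i x, ?_⟩
  apply HomogeneousLocalization.val_injective
  rw [Away.val_mk, Localization.mk_eq_mk'_apply, IsLocalization.eq_mk'_iff_mul_eq]
  let B := Localization.Away (X i : MvPolynomial (Fin (n + 1)) k)
  let a : MvPolynomial (Fin (n + 1)) k →+* B := algebraMap _ _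
  let τ : MvPolynomial (Fin (n + 1)) k →+* B :=
    ((algebraMap _ _).comp (chartMap k i)).comp (dehomogenize k i)
  have hτ (j) : τ (X j) * a (X i) = a (X j) := by
    refine Fin.succAboveCases i ?_ (fun j ↦ ?_) j
    · simp [τ, dehomogenize_X_self]
    · change (chartMap k i (dehomogenize k i _)).val * _ = _
      rw [dehomogenize_X_succAbove, val_chartMap_X]
  have hC (r) : τ (C r) = a (C r) := by
    change (chartMap k i (dehomogenize k i _)).val = _
    rw [dehomogenize, eval₂Hom_C, val_chartMap_C]
  have hx' : x.IsHomogeneous d := by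
    have : d • 1 = d := by simp
    rw [this] at hx
    exact hx
  have expand (f : MvPolynomial (Fin (n + 1)) k →+* B) :
      f x = ∑ s ∈ x.support, f (C (x.coeff s)) * ∏ j, f (X j) ^ s j := by
    conv_lhs => rw [x.as_sum]
    rw [map_sum]
    refine Finset.sum_congr rfl fun s _ ↦ ?_
    rw [monomial_eq, map_mul, Finsupp.prod_fintype _ _ (fun _ ↦ pow_zero _), map_prod]
    simp_rw [map_pow]
  change τ x * a (X i ^ d) = a x
  rw [expand τ, expand a, map_pow, Finset.sum_mul]
  refine Finset.sum_congr rfl fun s hs ↦ ?_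
  have hd : d = ∑ j, s j := by
    rw [← Finsupp.degree_eq_sum]
    by_contra hne
    exact (mem_support_iff.mp hs) (hx'.coeff_eq_zero (Ne.symm hne))
  rw [hC, mul_assoc, hd, ← Finset.prod_pow_eq_pow_sum, ← Finset.prod_mul_distrib]
  simp_rw [← mul_pow, hτ]

end MvPolynomial

/-! ### Generators of associated sheaves, and preparations for differential forms -/

namespace AlgebraicGeometry.Scheme.Modules

variable {X : Scheme.{u}} (P : _root_.PresheafOfModules.{u} (X.presheaf ⋙ forget₂ CommRingCat RingCat))

/-- The sheaf associated to a presheaf of `𝒪_X`-modules. -/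
def sheafify : X.Modules :=
  (PresheafOfModules.sheafification (𝟙 X.ringCatSheaf.obj)).obj P

instance (V : X.Opens) : Module Γ(X, V) (P.obj (.op V)) := inferInstanceAs (Module
  ((X.presheaf ⋙ forget₂ CommRingCat RingCat).obj (.op V)) (P.obj (.op V)))

/-- The canonical map from a presheaf to its associated sheaf, on sections. -/
def toSheafify (V : X.Opens) : P.obj (.op V) →ₗ[Γ(X, V)] Γ(sheafify P, V) :=
  (((PresheafOfModules.sheafificationAdjunction (𝟙 X.ringCatSheaf.obj)).unit.app P).app
    (.op V)).hom

variable {P}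

lemma toSheafify_restrict {V V' : X.Opens} (h : V' ≤ V) (s : P.obj (.op V)) :
    toSheafify P V' (P.restrictₛₗ (homOfLE h).op s) =
      (sheafify P).presheaf.map (homOfLE h).op (toSheafify P V s) :=
  ConcreteCategory.congr_hom ((CategoryTheory.toSheafify (Opens.grothendieckTopology X)
    P.presheaf).naturality (homOfLE h).op) s

lemma exists_restrict_eq_of_toSheafify_eq {V : X.Opens} {s t : P.obj (.op V)}
    (h : toSheafify P V s = toSheafify P V t) {x : X} (hx : x ∈ V) :
    ∃ (V' : X.Opens) (h : V' ≤ V), x ∈ V' ∧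
      P.restrictₛₗ (homOfLE h).op s = P.restrictₛₗ (homOfLE h).op t := by
  obtain ⟨V', f, hf, hxV'⟩ := Presheaf.equalizerSieve_mem (Opens.grothendieckTopology X)
    (CategoryTheory.toSheafify (Opens.grothendieckTopology X) P.presheaf) (X := .op V) s t h x hx
  exact ⟨V', leOfHom f, hxV', hf⟩

lemma exists_toSheafify_eq {V : X.Opens} (s : Γ(sheafify P, V)) {x : X} (hx : x ∈ V) :
    ∃ (V' : X.Opens) (h : V' ≤ V) (t : P.obj (.op V')), x ∈ V' ∧
      toSheafify P V' t = (sheafify P).presheaf.map (homOfLE h).op s := by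
  obtain ⟨V', f, ⟨t, ht⟩, hxV'⟩ := Presheaf.imageSieve_mem (Opens.grothendieckTopology X)
    (CategoryTheory.toSheafify (Opens.grothendieckTopology X) P.presheaf) (U := .op V) s x hx
  exact ⟨V', leOfHom f, t, hxV', ht⟩

lemma restrict_restrict {U V W : X.Opens} (h : V ≤ U) (h' : W ≤ V) (s : P.obj (.op U)) :
    P.restrictₛₗ (homOfLE h').op (P.restrictₛₗ (homOfLE h).op s) =
      P.restrictₛₗ (homOfLE (h'.trans h)).op s := by
  refine (CategoryTheory.comp_apply (P.presheaf.map (homOfLE h).op) (P.presheaf.map _) s).symm.trans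
    ?_
  rw [← Functor.map_comp]; rfl

lemma restrict_smul {V W : X.Opens} (h : W ≤ V) (r : Γ(X, V)) (s : P.obj (.op V)) :
    P.restrictₛₗ (homOfLE h).op (r • s) =
      X.presheaf.map (homOfLE h).op r • P.restrictₛₗ (homOfLE h).op s :=
  (P.restrictₛₗ (homOfLE h).op).map_smulₛₗ r s

/-- A section of a presheaf which is a generator over a basis of open sets is a generator of the
associated sheaf. -/
lemma isGeneratorOn_toSheafify {W : X.Opens} (e : P.obj (.op W)) (B : Set X.Opens)
    (hB : ∀ V ≤ W, ∀ x ∈ V, ∃ V' ∈ B, V' ≤ V ∧ x ∈ V')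
    (he : ∀ V ∈ B, ∀ (h : V ≤ W), Function.Bijective
      fun r : Γ(X, V) ↦ r • P.restrictₛₗ (homOfLE h).op e) :
    (sheafify P).IsGeneratorOn W (toSheafify P W e) := by
  have hsmul {V : X.Opens} (hV : V ≤ W) (r : Γ(X, V)) :
      r • (sheafify P).presheaf.map (homOfLE hV).op (toSheafify P W e) =
      toSheafify P V (r • P.restrictₛₗ (homOfLE hV).op e) := by
    rw [_root_.map_smul, toSheafify_restrict]
  have hcov {V : X.Opens} {V' : V → X.Opens} (h : ∀ x, x.1 ∈ V' x) : V ≤ ⨆ x, V' x :=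
    fun z hz ↦ Opens.mem_iSup.mpr ⟨⟨z, hz⟩, h ⟨z, hz⟩⟩
  have inj (V : X.Opens) (h : V ≤ W) : Function.Injective fun r : Γ(X, V) ↦
      r • (sheafify P).presheaf.map (homOfLE h).op (toSheafify P W e) := by
    intro r r' hr
    dsimp only at hr
    rw [hsmul, hsmul] at hr
    have H (x : V) : ∃ (V' : X.Opens) (h' : V' ≤ V), x.1 ∈ V' ∧
        X.presheaf.map (homOfLE h').op r = X.presheaf.map (homOfLE h').op r' := by
      obtain ⟨V₁, h₁, hxV₁, e₁⟩ := exists_restrict_eq_of_toSheafify_eq hr x.2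
      obtain ⟨V', hV', h', hxV'⟩ := hB V₁ (h₁.trans h) x.1 hxV₁
      refine ⟨V', h'.trans h₁, hxV', (he V' hV' ((h'.trans h₁).trans h)).1 ?_⟩
      have e₂ := congr(P.restrictₛₗ (homOfLE h').op $e₁)
      rw [restrict_restrict, restrict_restrict, restrict_smul, restrict_smul,
        restrict_restrict] at e₂
      exact e₂
    choose V' h' hxV' e' using H
    exact TopCat.Sheaf.eq_of_locally_eq' X.sheaf V' V (fun x ↦ homOfLE (h' x)) (hcov hxV') r r' e'
  intro V h
  refine ⟨inj V h, fun s ↦ ?_⟩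
  have H (x : V) : ∃ (V' : X.Opens) (h' : V' ≤ V) (r : Γ(X, V')), x.1 ∈ V' ∧
      r • (sheafify P).presheaf.map (homOfLE (h'.trans h)).op (toSheafify P W e) =
        (sheafify P).presheaf.map (homOfLE h').op s := by
    obtain ⟨V₁, h₁, t, hxV₁, e₁⟩ := exists_toSheafify_eq s x.2
    obtain ⟨V', hV', h', hxV'⟩ := hB V₁ (h₁.trans h) x.1 hxV₁
    obtain ⟨r, hr⟩ := (he V' hV' ((h'.trans h₁).trans h)).2 (P.restrictₛₗ (homOfLE h').op t)
    dsimp only at hr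
    refine ⟨V', h'.trans h₁, r, hxV', ?_⟩
    rw [hsmul, hr, toSheafify_restrict, e₁, presheaf_map_map]
  choose V' h' r hxV' e' using H
  have res {V V' : X.Opens} (h : V ≤ W) (h' : V' ≤ V) (r : Γ(X, V)) :
      (sheafify P).presheaf.map (homOfLE h').op
        (r • (sheafify P).presheaf.map (homOfLE h).op (toSheafify P W e)) =
      X.presheaf.map (homOfLE h').op r •
        (sheafify P).presheaf.map (homOfLE (h'.trans h)).op (toSheafify P W e) := by
    rw [map_smul, presheaf_map_map]
  -- The local coefficients agree on overlaps by `inj`, since both multiply the generator to the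
  -- restriction of `s`.
  obtain ⟨ρ, hρ, -⟩ := TopCat.Sheaf.existsUnique_gluing' X.sheaf V' V (fun x ↦ homOfLE (h' x))
    (hcov hxV') r (fun x y ↦ by
      refine inj (V' x ⊓ V' y) (inf_le_left.trans ((h' x).trans h)) ?_
      refine ((res ((h' x).trans h) inf_le_left (r x)).symm.trans ?_).trans
        (res ((h' y).trans h) inf_le_right (r y))
      rw [e', e', presheaf_map_map, presheaf_map_map])
  refine ⟨ρ, section_eq_of_germ_eq fun x hx ↦ ?_⟩
  rw [← germ_map (h' ⟨x, hx⟩) (hxV' ⟨x, hx⟩), ← germ_map (h' ⟨x, hx⟩) (hxV' ⟨x, hx⟩) s, ← e']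
  congr 1
  refine (res h (h' ⟨x, hx⟩) ρ).trans ?_
  congr 1
  exact hρ ⟨x, hx⟩

end AlgebraicGeometry.Scheme.Modules

/-- A localization of a ring isomorphic to a polynomial ring is formally étale over it. Algebra
structures enter as ring homomorphisms because sheaves provide maps rather than instances. -/
lemma KaehlerDifferential.bijective_smul_ιMulti_of_isLocalization {k A B : Type*} [CommRing k]
    [CommRing A] [CommRing B] {n : ℕ} {α : MvPolynomial (Fin n) k →+* A}
    (hα : Function.Bijective α) (ρ : A →+* B) (γ : k →+* B)
    (hγ : ∀ r, γ r = ρ (α (MvPolynomial.C r))) (g : A)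
    (hg : letI := ρ.toAlgebra; IsLocalization.Away g B) :
    letI := γ.toAlgebra
    Function.Bijective fun r : B ↦ r • exteriorPower.ιMulti B n fun j ↦
      KaehlerDifferential.D k B (ρ (α (MvPolynomial.X j))) := by
  let _ : Algebra k B := γ.toAlgebra
  let _ : Algebra (MvPolynomial (Fin n) k) A := α.toAlgebra
  let _ : Algebra A B := ρ.toAlgebra
  let _ : Algebra (MvPolynomial (Fin n) k) B := (ρ.comp α).toAlgebra
  have : IsScalarTower (MvPolynomial (Fin n) k) A B := .of_algebraMap_eq' rfl
  have : IsScalarTower k (MvPolynomial (Fin n) k) B := .of_algebraMap_eq hγ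
  have : Algebra.FormallyEtale A B := .of_isLocalization (.powers g)
  have : Algebra.FormallyEtale (MvPolynomial (Fin n) k) A :=
    .of_equiv (AlgEquiv.ofBijective (Algebra.ofId _ A) hα)
  have : Algebra.FormallyEtale (MvPolynomial (Fin n) k) B := .comp _ A B
  exact KaehlerDifferential.bijective_smul_ιMulti_D k B n

/-- Take global sections of the factorization `h`. It lets the constants on a chart be read off from
a map of affine schemes. -/
lemma AlgebraicGeometry.Scheme.constantsToPresheaf_app_eq {k R S : CommRingCat.{u}}
    {X : Scheme.{u}} {W : X.Opens} (f : X ⟶ Spec R) (φ : k ⟶ R) (ψ : R ⟶ S) (a : S ⟶ Γ(X, W))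
    (h : W.ι ≫ f = (W.toSpecΓ ≫ Spec.map a) ≫ Spec.map ψ) :
    (Scheme.constantsToPresheaf (f ≫ Spec.map φ)).app (.op W) = (φ ≫ ψ) ≫ a := by
  have h' : W.ι ≫ f ≫ Spec.map φ = W.toSpecΓ ≫ Spec.map ((φ ≫ ψ) ≫ a) := by
    simp only [reassoc_of% h, Spec.map_comp, Category.assoc]
  have h1 := congr((Scheme.ΓSpecIso k).inv ≫ Scheme.Hom.appTop $h' ≫ W.topIso.hom)
  simp only [Scheme.Hom.comp_appTop, Category.assoc, ← Scheme.ΓSpecIso_inv_naturality_assoc,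
    Scheme.Opens.toSpecΓ_appTop, Iso.inv_hom_id, Category.comp_id] at h1
  rw [Category.assoc, ← h1]
  change _ ≫ (f ≫ Spec.map φ).appTop ≫ X.presheaf.map _ = _
  rw [Scheme.Hom.comp_appTop, Category.assoc]
  refine (Scheme.ΓSpecIso_inv_naturality_assoc φ _).symm.trans ?_
  congr 3
  rw [Scheme.Opens.ι_appTop]
  exact X.presheaf.map_comp _ _

lemma AlgebraicGeometry.Scheme.constantsToPresheaf_app_restrict {k : CommRingCat.{u}}
    {X : Scheme.{u}} (f : X ⟶ Spec k) {V W : X.Opens} (h : V ≤ W) (r : k) :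
    (Scheme.constantsToPresheaf f).app (.op V) r =
      X.presheaf.map (homOfLE h).op ((Scheme.constantsToPresheaf f).app (.op W) r) := by
  have := congr($((Scheme.constantsToPresheaf f).naturality (homOfLE h).op) r)
  exact this

/-! ### The canonical sheaf of projective space is a line bundle -/

namespace AlgebraicGeometry.projectiveSpace

attribute [local instance] MvPolynomial.gradedAlgebra

open MvPolynomial

variable (k : Type u) [CommRing k] {n : ℕ} (i : Fin (n + 1))

/-- The standard open subset `xᵢ ≠ 0` of projective space. -/
def chart : (projectiveSpace k n).Opens :=
  Proj.basicOpen (homogeneousSubmodule (Fin (n + 1)) k) (X i)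

lemma isAffineOpen_chart : IsAffineOpen (chart k i) :=
  Proj.isAffineOpen_basicOpen _ _ (X_mem_homogeneousSubmodule_one k i) one_pos

lemma exists_mem_chart (x : projectiveSpace k n) : ∃ i, x ∈ chart k i := by
  have h := Proj.iSup_basicOpen_eq_top' (homogeneousSubmodule (Fin (n + 1)) k)
    (fun i : Fin (n + 1) ↦ X i) (fun i ↦ ⟨1, X_mem_homogeneousSubmodule_one k i⟩) (by
      rw [Algebra.eq_top_iff]
      intro p
      induction p using MvPolynomial.induction_on with
      | C r =>
        let c : homogeneousSubmodule (Fin (n + 1)) k 0 := ⟨C r, isHomogeneous_C _ r⟩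
        exact Subalgebra.algebraMap_mem _ c
      | add p q hp hq => exact add_mem hp hq
      | mul_X p i hp => exact mul_mem hp (Algebra.subset_adjoin ⟨i, rfl⟩))
  have hx : x ∈ ⨆ i, Proj.basicOpen (homogeneousSubmodule (Fin (n + 1)) k) (X i) := by
    rw [h]; trivial
  exact Opens.mem_iSup.mp hx

/-- The isomorphism of `k[Y₁, …, Yₙ]` with the ring of functions of a standard chart. -/
def chartRingHom : MvPolynomial (Fin n) k →+* Γ(projectiveSpace k n, chart k i) :=
  (Proj.awayToSection (homogeneousSubmodule (Fin (n + 1)) k) (X i)).hom.comp (chartMap k i)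

lemma chartRingHom_bijective : Function.Bijective (chartRingHom k i) := by
  have : IsIso (Proj.awayToSection (homogeneousSubmodule (Fin (n + 1)) k) (X i)) := by
    rw [← Proj.basicOpenIsoAway_hom _ _ (X_mem_homogeneousSubmodule_one k i) one_pos]
    infer_instance
  exact ((ConcreteCategory.isIso_iff_bijective _).mp this).comp
    ⟨chartMap_injective k i, chartMap_surjective k i⟩

lemma constantsToPresheaf_app_chart :
    (Scheme.constantsToPresheaf (toSpec k n)).app (.op (chart k i)) =
      CommRingCat.ofHom ((HomogeneousLocalization.fromZeroRingHom
        (homogeneousSubmodule (Fin (n + 1)) k) (.powers (X i))).comp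
          (algebraMap k (homogeneousSubmodule (Fin (n + 1)) k 0))) ≫
        Proj.awayToSection (homogeneousSubmodule (Fin (n + 1)) k) (X i) := by
  have h := Proj.awayι_toSpecZero (homogeneousSubmodule (Fin (n + 1)) k) (X i)
    (X_mem_homogeneousSubmodule_one k i) one_pos
  rw [Proj.awayι, Category.assoc, Iso.inv_comp_eq, Proj.basicOpenIsoSpec_hom] at h
  exact Scheme.constantsToPresheaf_app_eq _ (CommRingCat.ofHom (algebraMap k _)) _ _ h

lemma chartRingHom_C (r : k) : chartRingHom k i (C r) =
    (Scheme.constantsToPresheaf (toSpec k n)).app (.op (chart k i)) r := by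
  rw [constantsToPresheaf_app_chart]
  have h : chartMap k i (C r) = HomogeneousLocalization.fromZeroRingHom
      (homogeneousSubmodule (Fin (n + 1)) k) (.powers (X i)) (algebraMap k _ r) := by
    rw [chartMap, eval₂Hom_C]
    rfl
  exact congrArg (Proj.awayToSection (homogeneousSubmodule (Fin (n + 1)) k) (X i)) h

/-- The `n`-form `dY₁ ∧ ⋯ ∧ dYₙ` on a standard chart. -/
def chartForm : ((PresheafOfModules.DifferentialsConstruction.relativeDifferentials'
      (Scheme.constantsToPresheaf (toSpec k n))).exteriorPower n).obj (.op (chart k i)) :=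
  exteriorPower.ιMulti Γ(projectiveSpace k n, chart k i) n fun j ↦
    CommRingCat.KaehlerDifferential.d
      (f := (Scheme.constantsToPresheaf (toSpec k n)).app (.op (chart k i)))
      (chartRingHom k i (X j))

lemma restrict_chartForm {V : (projectiveSpace k n).Opens} (h : V ≤ chart k i) :
    ((PresheafOfModules.DifferentialsConstruction.relativeDifferentials'
      (Scheme.constantsToPresheaf (toSpec k n))).exteriorPower n).restrictₛₗ (homOfLE h).op
        (chartForm k i) =
  exteriorPower.ιMulti Γ(projectiveSpace k n, V) n fun j ↦
    CommRingCat.KaehlerDifferential.d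
      (f := (Scheme.constantsToPresheaf (toSpec k n)).app (.op V))
      ((projectiveSpace k n).presheaf.map (homOfLE h).op (chartRingHom k i (X j))) := by
  refine (PresheafOfModules.exteriorPowerRes_ιMulti _ n (homOfLE h).op _).trans ?_
  exact congrArg (exteriorPower.ιMulti _ n) (funext fun j ↦
    PresheafOfModules.DifferentialsConstruction.relativeDifferentials'_map_d _ _ _)

lemma bijective_smul_restrict_chartForm (g : Γ(projectiveSpace k n, chart k i))
    (h : (projectiveSpace k n).basicOpen g ≤ chart k i) :
    Function.Bijective fun r : Γ(projectiveSpace k n, (projectiveSpace k n).basicOpen g) ↦ r •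
      ((PresheafOfModules.DifferentialsConstruction.relativeDifferentials'
      (Scheme.constantsToPresheaf (toSpec k n))).exteriorPower n).restrictₛₗ (homOfLE h).op
        (chartForm k i) := by
  have hr := restrict_chartForm k i h
  rw [hr]
  refine KaehlerDifferential.bijective_smul_ιMulti_of_isLocalization
    (chartRingHom_bijective k i)
    ((projectiveSpace k n).presheaf.map (homOfLE h).op).hom
    ((Scheme.constantsToPresheaf (toSpec k n)).app
      (.op ((projectiveSpace k n).basicOpen g))).hom (fun r ↦ ?_) g
    ((isAffineOpen_chart k i).isLocalization_basicOpen g)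
  rw [chartRingHom_C]
  exact Scheme.constantsToPresheaf_app_restrict (toSpec k n) h r

/-- The canonical sheaf of projective space is a line bundle. -/
theorem isLineBundle_canonicalSheaf : (canonicalSheaf k n).IsLineBundle := by
  rw [Scheme.Modules.isLineBundle_iff]
  intro x
  obtain ⟨i, hx⟩ := exists_mem_chart k x
  refine ⟨chart k i, _, hx, Scheme.Modules.isGeneratorOn_toSheafify (chartForm k i)
    (Set.range fun g : Γ(projectiveSpace k n, chart k i) ↦ (projectiveSpace k n).basicOpen g)
    (fun V hV x hx ↦ ?_) ?_⟩
  · obtain ⟨g, hg, hxg⟩ := (isAffineOpen_chart k i).exists_basicOpen_le ⟨x, hx⟩ (hV hx)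
    exact ⟨_, ⟨g, rfl⟩, hg, hxg⟩
  · rintro _ ⟨g, rfl⟩ h
    exact bijective_smul_restrict_chartForm k i g h

end AlgebraicGeometry.projectiveSpace

/-! ### Passing between local homomorphisms and maps of stalks -/

/-- Finitely many germs at `x` are germs of sections over a common neighbourhood of `x`. -/
lemma TopCat.Presheaf.exists_germ_eq_of_finite {X : TopCat.{u}} {C : Type*} [Category.{u} C]
    {FC : C → C → Type*} {CC : C → Type u} [∀ A B, FunLike (FC A B) (CC A) (CC B)]
    [ConcreteCategory C FC] [HasColimits C] [PreservesFilteredColimits (forget C)]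
    (F : X.Presheaf C) {x : X} {ι : Type*} [Finite ι] (v : ι → ToType (F.stalk x)) {W : Opens X}
    (hW : x ∈ W) : ∃ (U : Opens X) (_ : U ≤ W) (hU : x ∈ U)
      (t : ∀ _ : ι, ToType (F.obj (.op U))), ∀ i, F.germ U x hU (t i) = v i := by
  have := Fintype.ofFinite ι
  choose U hUW hxU t ht using fun i ↦ F.exists_le_germ_eq (v i) hW
  let U' : Opens X := W ⊓ Finset.univ.inf U
  have hU' (i) : U' ≤ U i := inf_le_right.trans (Finset.inf_le (Finset.mem_univ i))
  have hx : x ∈ U' := by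
    refine ⟨hW, ?_⟩
    rw [Opens.coe_finset_inf]
    simpa using hxU
  exact ⟨U', inf_le_left, hx, fun i ↦ F.map (homOfLE (hU' i)).op (t i), fun i ↦ by
    rw [F.germ_res_apply, ht]⟩

/-- Sections that have the same germs at `x` agree on a neighbourhood of `x`. -/
lemma TopCat.Presheaf.exists_map_eq_of_finite {X : TopCat.{u}} {C : Type*} [Category.{u} C]
    {FC : C → C → Type*} {CC : C → Type u} [∀ A B, FunLike (FC A B) (CC A) (CC B)]
    [ConcreteCategory C FC] [HasColimits C] [PreservesFilteredColimits (forget C)]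
    (F : X.Presheaf C) {x : X} {ι : Type*} [Finite ι] {W : Opens X} (hW : x ∈ W)
    (s t : ∀ _ : ι, ToType (F.obj (.op W))) (h : ∀ i, F.germ W x hW (s i) = F.germ W x hW (t i)) :
    ∃ (U : Opens X) (hU : U ≤ W), x ∈ U ∧
      ∀ i, F.map (homOfLE hU).op (s i) = F.map (homOfLE hU).op (t i) := by
  have := Fintype.ofFinite ι
  choose U hxU i₁ i₂ e using fun i ↦ F.germ_eq x hW hW _ _ (h i)
  let U' : Opens X := W ⊓ Finset.univ.inf U
  have hU' (i) : U' ≤ U i := inf_le_right.trans (Finset.inf_le (Finset.mem_univ i))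
  have hx : x ∈ U' := by
    refine ⟨hW, ?_⟩
    rw [Opens.coe_finset_inf]
    simpa using hxU
  refine ⟨U', inf_le_left, hx, fun i ↦ ?_⟩
  have := congr(F.map (homOfLE (hU' i)).op $(e i))
  rw [← ConcreteCategory.comp_apply, ← ConcreteCategory.comp_apply, ← F.map_comp,
    ← F.map_comp] at this
  exact this

namespace AlgebraicGeometry.Scheme.Modules

variable {X : Scheme.{u}} {M N : X.Modules} {W : X.Opens} {ι : Type} [Fintype ι] {x : X}

lemma IsBasisOn.bijective_stalk {e : ι → Γ(M, W)} (he : M.IsBasisOn W e) (hx : x ∈ W) :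
    Function.Bijective (fun v : ι → X.presheaf.stalk x ↦ ∑ i, v i • M.presheaf.germ W x hx (e i)) := by
  have key {V : X.Opens} (hV : V ≤ W) (hxV : x ∈ V) (v : ι → Γ(X, V)) :
      ∑ i, X.presheaf.germ V x hxV (v i) • M.presheaf.germ W x hx (e i) =
        M.presheaf.germ V x hxV (∑ i, v i • M.presheaf.map (homOfLE hV).op (e i)) := by
    rw [map_sum]
    refine Finset.sum_congr rfl fun i _ ↦ ?_
    rw [germ_smul, germ_map]
  let φ : (ι → X.presheaf.stalk x) →ₗ[X.presheaf.stalk x] M.presheaf.stalk x :=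
    Fintype.linearCombination _ fun i ↦ M.presheaf.germ W x hx (e i)
  change Function.Bijective φ
  constructor
  · rw [injective_iff_map_eq_zero]
    intro v hv
    obtain ⟨V, hV, hxV, t, ht⟩ := X.presheaf.exists_germ_eq_of_finite v hx
    obtain rfl : (fun i ↦ X.presheaf.germ V x hxV (t i)) = v := funext ht
    have h := (key hV hxV t).symm.trans hv
    rw [← map_zero (M.presheaf.germ V x hxV).hom] at h
    obtain ⟨V', h₁, h₂, hxV', e'⟩ := (germ_eq_iff hxV hxV _ _).mp h
    rw [map_zero, map_sum] at e'
    simp_rw [map_smul, presheaf_map_map] at e'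
    have h0 := (he V' (h₁.trans hV)).1 (e'.trans (by simp : _ = ∑ i : ι, (0 : Γ(X, V')) • _))
    funext i
    rw [Pi.zero_apply, ← X.presheaf.germ_res_apply (homOfLE h₁) x hxV']
    exact (congrArg _ (congrFun h0 i)).trans (map_zero _)
  · intro m
    obtain ⟨V, hV, hxV, t, rfl⟩ := exists_germ_eq m hx
    obtain ⟨v, rfl⟩ := (he V hV).2 t
    exact ⟨fun i ↦ X.presheaf.germ V x hxV (v i), key hV hxV v⟩

/-- The basis of a stalk of `M` given by a basis of sections. -/
def IsBasisOn.stalkBasis {e : ι → Γ(M, W)} (he : M.IsBasisOn W e) (hx : x ∈ W) :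
    Module.Basis ι (X.presheaf.stalk x) (M.presheaf.stalk x) :=
  Module.Basis.ofEquivFun (LinearEquiv.ofBijective
    (Fintype.linearCombination _ fun i ↦ M.presheaf.germ W x hx (e i))
    (he.bijective_stalk hx)).symm

lemma IsBasisOn.stalkBasis_apply {e : ι → Γ(M, W)} (he : M.IsBasisOn W e) (hx : x ∈ W) (i : ι) :
    he.stalkBasis hx i = M.presheaf.germ W x hx (e i) := by
  classical
  rw [IsBasisOn.stalkBasis, Module.Basis.coe_ofEquivFun, LinearEquiv.symm_symm]
  refine (Fintype.linearCombination_apply_single (X.presheaf.stalk x) _ i 1).trans ?_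
  rw [one_smul]

/-- The linear map between stalks at `x` induced by a homomorphism on a neighbourhood of `x`. -/
lemma HasLocalBases.exists_stalkMap (hM : M.HasLocalBases) {U : X.Opens} (hx : x ∈ U)
    (f : LocalHom M N U) : ∃ φ : M.presheaf.stalk x →ₗ[X.presheaf.stalk x] N.presheaf.stalk x,
      ∀ (V : X.Opens) (hV : V ≤ U) (hxV : x ∈ V) (s : Γ(M, V)),
        φ (M.presheaf.germ V x hxV s) = N.presheaf.germ V x hxV (f.app V hV s) := by
  obtain ⟨W, m, e, hxW, he⟩ := hM x
  have hxWU : x ∈ W ⊓ U := ⟨hxW, hx⟩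
  have he' := he.res (inf_le_left : W ⊓ U ≤ W)
  -- The stalk map is prescribed on the germs of a local basis; an arbitrary section is compared
  -- after expanding it in this basis near `x`.
  refine ⟨(he'.stalkBasis hxWU).constr (X.presheaf.stalk x) fun i ↦
    N.presheaf.germ _ x hxWU (f.app _ inf_le_right (M.presheaf.map (homOfLE inf_le_left).op (e i))),
    fun V hV hxV s ↦ ?_⟩
  have hxV' : x ∈ V ⊓ (W ⊓ U) := ⟨hxV, hxWU⟩
  rw [← germ_map inf_le_left hxV', ← germ_map inf_le_left hxV' (f.app V hV s),
    ← f.naturality]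
  generalize M.presheaf.map (homOfLE inf_le_left).op s = s'
  obtain ⟨v, rfl⟩ := (he' _ inf_le_right).2 s'
  simp only [map_sum, _root_.map_smul, germ_smul, presheaf_map_map]
  refine Finset.sum_congr rfl fun i _ ↦ ?_
  congr 1
  rw [← presheaf_map_map M (inf_le_left : W ⊓ U ≤ W) inf_le_right, germ_map _ hxV',
    ← he'.stalkBasis_apply hxWU, Module.Basis.constr_basis, f.naturality _ _ inf_le_right
      inf_le_right, germ_map _ hxV']

/-- Exactness of `ℋom(M₃, N) ⟶ ℋom(M₂, N) ⟶ ℋom(M₁, N)` for locally free sheaves `M₂` and `M₃`,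
in terms of stalks. -/
lemma exact_sheafHomMap_of_stalk {M₁ M₂ M₃ : X.Modules} (f : M₁ ⟶ M₂) (g : M₂ ⟶ M₃)
    (h₂ : M₂.HasLocalBases) (h₃ : M₃.HasLocalBases)
    (H : ∀ x : X, ∀ φ : M₂.presheaf.stalk x →ₗ[X.presheaf.stalk x] N.presheaf.stalk x,
      φ ∘ₗ stalkMap x f = 0 →
        ∃ ψ : M₃.presheaf.stalk x →ₗ[X.presheaf.stalk x] N.presheaf.stalk x, φ = ψ ∘ₗ stalkMap x g)
    (w' : sheafHomMap g (𝟙 N) ≫ sheafHomMap f (𝟙 N) = 0) :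
    (ShortComplex.mk (sheafHomMap g (𝟙 N)) (sheafHomMap f (𝟙 N)) w').Exact := by
  rw [exact_iff_locally]
  intro U s hs x hx
  let s' : LocalHom M₂ N U := s
  have hs' (V : X.Opens) (hV : V ≤ U) (t : Γ(M₁, V)) : s'.app V hV (f.app V t) = 0 :=
    congr(LocalHom.app (M := M₁) (N := N) $hs V hV t)
  obtain ⟨φ, hφ⟩ := h₂.exists_stalkMap hx s'
  obtain ⟨ψ, rfl⟩ := H x φ (by
    ext t
    obtain ⟨V, hV, hxV, t, rfl⟩ := exists_germ_eq t hx
    rw [LinearMap.comp_apply, stalkMap_germ, hφ V hV, hs', map_zero]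
    rfl)
  obtain ⟨W₃, m₃, e₃, hxW₃, he₃⟩ := h₃ x
  obtain ⟨W₂, m₂, e₂, hxW₂, he₂⟩ := h₂ x
  -- The map `ψ` spreads out to a homomorphism `q` near `x`, by lifting its values on a basis.
  -- Equality of `q ∘ g` with the given homomorphism then only has to be reached on finitely many
  -- germs.
  obtain ⟨V, hV, hxV, t, ht⟩ := N.presheaf.exists_germ_eq_of_finite
    (fun i ↦ ψ (M₃.presheaf.germ W₃ x hxW₃ (e₃ i))) (W := W₃ ⊓ (W₂ ⊓ U)) ⟨hxW₃, hxW₂, hx⟩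
  have hV₃ : V ≤ W₃ := hV.trans inf_le_left
  have hV₂ : V ≤ W₂ := hV.trans (inf_le_right.trans inf_le_left)
  have hVU : V ≤ U := hV.trans (inf_le_right.trans inf_le_right)
  let q : LocalHom M₃ N V := he₃.constr hV₃ t
  obtain ⟨χ, hχ⟩ := h₃.exists_stalkMap hxV q
  have hχψ : χ = ψ := (he₃.stalkBasis hxW₃).ext fun i ↦ by
    rw [he₃.stalkBasis_apply, ← ht, ← germ_map hV₃ hxV, hχ V le_rfl]
    have := he₃.constr_app hV₃ t V le_rfl i
    rw [this, germ_map]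
  obtain ⟨V', hV', hxV', hE⟩ := N.presheaf.exists_map_eq_of_finite hxV
    (fun i ↦ q.app V le_rfl (g.app V (M₂.presheaf.map (homOfLE hV₂).op (e₂ i))))
    (fun i ↦ s'.app V hVU (M₂.presheaf.map (homOfLE hV₂).op (e₂ i)))
    (fun i ↦ by
      rw [← hφ V hVU hxV, ← hχ V le_rfl hxV, hχψ, LinearMap.comp_apply, stalkMap_germ])
  refine ⟨V', hV'.trans hVU, LocalHom.res hV' q, hxV', ?_⟩
  refine he₂.localHom_ext (M := M₂) (N := N) (V := V') (hV'.trans hV₂) fun i ↦ ?_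
  have := hE i
  rw [← q.naturality V V' le_rfl hV', ← s'.naturality V V' hVU hV', ← app_map,
    presheaf_map_map] at this
  exact this

end AlgebraicGeometry.Scheme.Modules

/-! ### Exactness of the dual complex in negative degrees -/

namespace AlgebraicGeometry.Scheme.Modules

variable {X : Scheme.{u}} {M N : X.Modules} (x : X)

lemma stalkMap_id : stalkMap x (𝟙 M) = LinearMap.id :=
  LinearMap.ext fun s ↦ ConcreteCategory.congr_hom ((stalkAb x).map_id M) s

lemma stalkMap_comp_apply {P : X.Modules} (f : M ⟶ N) (g : N ⟶ P) (s : M.presheaf.stalk x) :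
    stalkMap x (f ≫ g) s = stalkMap x g (stalkMap x f s) :=
  ConcreteCategory.congr_hom ((stalkAb x).map_comp f g) s

lemma stalkMap_zero : stalkMap x (0 : M ⟶ N) = 0 :=
  LinearMap.ext fun s ↦ ConcreteCategory.congr_hom ((stalkAb x).map_zero M N) s

lemma subsingleton_stalk_of_isZero (hM : IsZero M) : Subsingleton (M.presheaf.stalk x) :=
  subsingleton_of_forall_eq 0 fun s ↦ by
    rw [← LinearMap.id_apply (R := X.presheaf.stalk x) s, ← stalkMap_id,
      (IsZero.iff_id_eq_zero M).mp hM, stalkMap_zero]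
    rfl

variable {x} in
lemma HasLocalBases.projective_stalk (hM : M.HasLocalBases) :
    Module.Projective (X.presheaf.stalk x) (M.presheaf.stalk x) := by
  obtain ⟨W, m, e, hxW, he⟩ := hM x
  exact .of_basis (he.stalkBasis hxW)

variable {x} in
lemma IsLineBundle.nonempty_stalk_equiv (hN : N.IsLineBundle) :
    Nonempty (X.presheaf.stalk x ≃ₗ[X.presheaf.stalk x] N.presheaf.stalk x) := by
  obtain ⟨W, e, hxW, he⟩ := isLineBundle_iff.mp hN x
  have he' : N.IsBasisOn W (fun _ : Unit ↦ e) := isBasisOn_unique_iff.mpr he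
  exact ⟨(LinearEquiv.funUnique Unit _ _).symm ≪≫ₗ (he'.stalkBasis hxW).equivFun.symm⟩

variable {K : CochainComplex X.Modules ℤ}

lemma exactAt_iff_stalkMap {a b c : ℤ} (hab : a + 1 = b) (hbc : b + 1 = c) :
    K.ExactAt b ↔ ∀ x : X, Function.Exact (stalkMap x (K.d a b)) (stalkMap x (K.d b c)) := by
  rw [K.exactAt_iff' a b c (by simp; omega) (by simp; omega), exact_iff_stalkMap]
  rfl

/-- If `K` is a complex of locally free sheaves that is exact except in degree `0`, and the
annihilator of the stalks of its cohomology in degree `0` contains regular sequences of length `c`,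
then the dual complex, shifted by `c`, is exact in negative degrees. -/
theorem exactAt_dualComplex_of_lt (hK : ∀ m, (K.X m).HasLocalBases) {q : ℤ}
    (hq : ∀ m, q < m → IsZero (K.X m)) (hex : ∀ m, m ≠ 0 → K.ExactAt m) (hN : N.IsLineBundle)
    {c : ℕ} (hreg : ∀ x : X, ∃ rs : List (X.presheaf.stalk x), rs.length = c ∧
      RingTheory.Sequence.IsWeaklyRegular (X.presheaf.stalk x) rs ∧
      ∀ r ∈ rs, ∀ z, stalkMap x (K.d 0 1) z = 0 → ∃ u, stalkMap x (K.d (-1) 0) u = r • z)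
    {i : ℤ} (hi : i < 0) : (dualComplex K N c).ExactAt i := by
  rw [HomologicalComplex.exactAt_iff' _ (i - 1) i (i + 1) (by simp) (by simp)]
  refine exact_sheafHomMap_of_stalk (K.d (-(i + 1) - c) (-i - c)) (K.d (-i - c) (-(i - 1) - c))
    (hK _) (hK _) (fun x φ hφ ↦ ?_) _
  obtain ⟨rs, rfl, hrs, H⟩ := hreg x
  -- The indices are renamed to the shape `a`, `a + 1`, `a + 1 + 1` of the module statement, whose
  -- bound `-rs.length ≤ a` amounts to `i < 0`.
  obtain ⟨a, ha⟩ : ∃ a, -(i + 1) - (rs.length : ℤ) = a := ⟨_, rfl⟩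
  obtain ⟨b, hb⟩ : ∃ b, -i - (rs.length : ℤ) = b := ⟨_, rfl⟩
  obtain ⟨e, he⟩ : ∃ e, -(i - 1) - (rs.length : ℤ) = e := ⟨_, rfl⟩
  obtain rfl : b = a + 1 := by omega
  obtain rfl : e = a + 1 + 1 := by omega
  revert φ
  rw [ha, he, hb]
  intro φ hφ
  have hp (m : ℤ) : Module.Projective (X.presheaf.stalk x) ((K.X m).presheaf.stalk x) :=
    (hK m).projective_stalk
  have hex' (m : ℤ) (hm : m + 1 ≠ 0) := (exactAt_iff_stalkMap rfl rfl).mp (hex _ hm) x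
  obtain ⟨E⟩ := hN.nonempty_stalk_equiv (x := x)
  refine exists_comp_eq_of_isWeaklyRegular (P := fun m ↦ (K.X m).presheaf.stalk x)
    (d := fun m ↦ stalkMap x (K.d m (m + 1))) (fun m z ↦ ?_) (q := q)
    (fun m hm ↦ subsingleton_stalk_of_isZero x (hq m hm))
    (fun m hm z hz ↦ (hex' m (by omega) z).mp hz)
    (fun m hm z hz ↦ (hex' m (by omega) z).mp hz) rs (fun r hr m z hz ↦ ?_)
    ((E.isWeaklyRegular_congr rs).mp hrs) a (by omega) φ hφ
  · rw [← stalkMap_comp_apply, K.d_comp_d, stalkMap_zero]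
    rfl
  -- The value `m = -1` concerns the cohomology in degree `0`; elsewhere `z` is already a boundary.
  · obtain rfl | hm := eq_or_ne m (-1)
    · exact H r hr z hz
    · obtain ⟨u, rfl⟩ := (hex' m (by omega) z).mp hz
      exact ⟨r • u, _root_.map_smul _ _ _⟩

end AlgebraicGeometry.Scheme.Modules

/-! ### Local rings of a scheme and generizations of a point -/

namespace AlgebraicGeometry

variable {X : Scheme.{u}} {W : X.Opens} {x y : X}

/-- Elements of a local ring of an affine scheme are fractions. -/
lemma IsAffineOpen.exists_germ_mul_eq (hW : IsAffineOpen W) (hx : x ∈ W)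
    (r : X.presheaf.stalk x) : ∃ a b : Γ(X, W), IsUnit (X.presheaf.germ W x hx b) ∧
      X.presheaf.germ W x hx b * r = X.presheaf.germ W x hx a := by
  let _ := TopCat.Presheaf.algebra_section_stalk X.presheaf (⟨x, hx⟩ : W)
  have := hW.isLocalization_stalk ⟨x, hx⟩
  obtain ⟨⟨a, b⟩, h⟩ := IsLocalization.surj (hW.primeIdealOf ⟨x, hx⟩).asIdeal.primeCompl r
  exact ⟨a, b, IsLocalization.map_units (X.presheaf.stalk x) b, (mul_comm _ _).trans h⟩

lemma IsAffineOpen.germ_injective_of_isDomain (hW : IsAffineOpen W) [IsDomain Γ(X, W)]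
    (hx : x ∈ W) : Function.Injective (X.presheaf.germ W x hx) := by
  let _ := TopCat.Presheaf.algebra_section_stalk X.presheaf (⟨x, hx⟩ : W)
  have := hW.isLocalization_stalk ⟨x, hx⟩
  exact IsLocalization.injective (X.presheaf.stalk x)
    (hW.primeIdealOf ⟨x, hx⟩).asIdeal.primeCompl_le_nonZeroDivisors

lemma germ_stalkSpecializes_apply (h : y ⤳ x) (hx : x ∈ W) (a : Γ(X, W)) :
    X.presheaf.stalkSpecializes h (X.presheaf.germ W x hx a) =
      X.presheaf.germ W y (h.mem_open W.isOpen hx) a :=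
  ConcreteCategory.congr_hom (X.presheaf.germ_stalkSpecializes hx h) a

lemma IsAffineOpen.stalkSpecializes_injective (hW : IsAffineOpen W) [IsDomain Γ(X, W)]
    (hx : x ∈ W) (h : y ⤳ x) : Function.Injective (X.presheaf.stalkSpecializes h) := by
  rw [injective_iff_map_eq_zero]
  intro r hr
  obtain ⟨a, b, hb, e⟩ := hW.exists_germ_mul_eq hx r
  have := congr(X.presheaf.stalkSpecializes h $e)
  rw [map_mul, hr, mul_zero, germ_stalkSpecializes_apply] at this
  rw [hW.germ_injective_of_isDomain _ (this.symm.trans (map_zero _).symm), map_zero] at e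
  exact (hb.mul_right_eq_zero).mp e

/-- Both stalks are localizations of the sections over `W`. This common-denominator property and
injectivity are all that is used later about the local ring at `y` being a localization of the one
at `x`. -/
lemma IsAffineOpen.exists_stalkSpecializes_eq (hW : IsAffineOpen W) (hx : x ∈ W) (h : y ⤳ x)
    (r : X.presheaf.stalk y) : ∃ s r' : X.presheaf.stalk x,
      IsUnit (X.presheaf.stalkSpecializes h s) ∧
      X.presheaf.stalkSpecializes h r' = X.presheaf.stalkSpecializes h s * r := by
  obtain ⟨a, b, hb, e⟩ := hW.exists_germ_mul_eq (h.mem_open W.isOpen hx) r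
  refine ⟨X.presheaf.germ W x hx b, X.presheaf.germ W x hx a, ?_, ?_⟩
  · rwa [germ_stalkSpecializes_apply]
  · rw [germ_stalkSpecializes_apply, germ_stalkSpecializes_apply, e]

/-- The prime ideals of a local ring of a scheme correspond to the generizations of the point. -/
lemma IsAffineOpen.exists_specializes_of_isPrime (hW : IsAffineOpen W) (hx : x ∈ W)
    (q : Ideal (X.presheaf.stalk x)) [q.IsPrime] : ∃ (y : X) (h : y ⤳ x),
      Order.coheight y = q.height ∧ ∀ s, IsUnit (X.presheaf.stalkSpecializes h s) → s ∉ q := by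
  let _ := TopCat.Presheaf.algebra_section_stalk X.presheaf (⟨x, hx⟩ : W)
  have hloc := hW.isLocalization_stalk ⟨x, hx⟩
  let p := (hW.primeIdealOf ⟨x, hx⟩).asIdeal
  let q' : PrimeSpectrum Γ(X, W) := ⟨q.comap (algebraMap _ _), inferInstance⟩
  have hq' : q'.asIdeal ≤ p := by
    intro a ha
    by_contra hap
    exact ‹q.IsPrime›.ne_top (Ideal.eq_top_of_isUnit_mem _ ha
      (IsLocalization.map_units (X.presheaf.stalk x) (⟨a, hap⟩ : p.primeCompl)))
  have hs : hW.fromSpec q' ⤳ x := by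
    have h1 : q' ⤳ hW.primeIdealOf ⟨x, hx⟩ := (PrimeSpectrum.le_iff_specializes _ _).mp hq'
    have h2 := h1.map hW.fromSpec.continuous
    rwa [hW.fromSpec_primeIdealOf] at h2
  have hyW : hW.fromSpec q' ∈ W := hs.mem_open W.isOpen hx
  let _ := TopCat.Presheaf.algebra_section_stalk X.presheaf (⟨hW.fromSpec q', hyW⟩ : W)
  have hloc' : IsLocalization.AtPrime (X.presheaf.stalk (hW.fromSpec q')) q'.asIdeal :=
    hW.isLocalization_stalk' q' hyW
  refine ⟨_, hs, ?_, fun s hu hsq ↦ ?_⟩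
  -- Contraction along a localization preserves height, and the height of `q'` is the dimension of
  -- the stalk at the corresponding point, which is its coheight.
  · have h1 := IsLocalization.height_under p.primeCompl q
    have h2 := ringKrullDim_stalk_eq_coheight (hW.fromSpec q')
    rw [IsLocalization.AtPrime.ringKrullDim_eq_height q'.asIdeal] at h2
    exact (WithBot.coe_injective h2).symm.trans h1
  · obtain ⟨a, b, hb, e⟩ := hW.exists_germ_mul_eq hx s
    have ha : a ∈ q'.asIdeal := by
      change X.presheaf.germ W x hx a ∈ q
      rw [← e]
      exact Ideal.mul_mem_left _ _ hsq
    have hu' : IsUnit (X.presheaf.germ W _ hyW a) := by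
      have := (hb.map (X.presheaf.stalkSpecializes hs).hom).mul hu
      rw [← germ_stalkSpecializes_apply hs hx, ← e, map_mul]
      exact this
    exact (IsLocalization.AtPrime.isUnit_to_map_iff
      (X.presheaf.stalk (hW.fromSpec q')) q'.asIdeal a).mp hu' ha

/-- A version of `MvPolynomial.exists_isWeaklyRegular_of_le_height` for the local rings of a scheme
that is locally an affine space. -/
lemma IsAffineOpen.exists_isWeaklyRegular (hW : IsAffineOpen W) (hx : x ∈ W) {k : Type*} [Field k]
    {n : ℕ} (α : MvPolynomial (Fin n) k ≃+* Γ(X, W)) {c : ℕ} (I : Ideal (X.presheaf.stalk x))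
    (hI : c ≤ I.height) :
    ∃ rs : List (X.presheaf.stalk x), rs.length = c ∧ (∀ r ∈ rs, r ∈ I) ∧
      RingTheory.Sequence.IsWeaklyRegular (X.presheaf.stalk x) rs := by
  let _ := TopCat.Presheaf.algebra_section_stalk X.presheaf (⟨x, hx⟩ : W)
  have hloc := hW.isLocalization_stalk ⟨x, hx⟩
  let p := (hW.primeIdealOf ⟨x, hx⟩).asIdeal
  let J := I.comap (algebraMap Γ(X, W) (X.presheaf.stalk x))
  -- The sequence is found in the contraction of `I` to the polynomial ring, and weak regularity
  -- survives localization.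
  have hJ : c ≤ J.height := hI.trans_eq (IsLocalization.height_under p.primeCompl I).symm
  obtain ⟨rs, hrs, hrsI, hreg⟩ := MvPolynomial.exists_isWeaklyRegular_of_le_height
    (J.comap α) c (by rwa [RingEquiv.height_comap])
  have h1 : RingTheory.Sequence.IsWeaklyRegular Γ(X, W) (rs.map α) := by
    have := (AddEquiv.isWeaklyRegular_congr (e := α.toAddEquiv) (as := rs) (bs := rs.map α)
      (List.forall₂_map_right_iff.mpr (List.forall₂_same.mpr fun r _ x ↦ map_mul α r x))).mp hreg
    exact this
  have h2 := h1.of_isLocalization (X.presheaf.stalk x) p.primeCompl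
  refine ⟨_, ?_, ?_, h2⟩
  · simpa
  · simpa [J] using hrsI

end AlgebraicGeometry

/-! ### Specialization maps and annihilators of cohomology -/

namespace AlgebraicGeometry.Scheme.Modules

variable {X : Scheme.{u}} {M N : X.Modules} {W : X.Opens} {x y : X} (h : y ⤳ x)

/-- The specialization map between the stalks of an `𝒪_X`-module. -/
def specialize : M.presheaf.stalk x →ₛₗ[(X.presheaf.stalkSpecializes h).hom]
    M.presheaf.stalk y where
  toFun := M.presheaf.stalkSpecializes h
  map_add' := map_add _
  map_smul' r s := by
    obtain ⟨U, hU, r, rfl⟩ := TopCat.Presheaf.exists_germ_eq X.presheaf r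
    obtain ⟨V, hVU, hV, s, rfl⟩ := exists_germ_eq s hU
    rw [← X.presheaf.germ_res_apply (homOfLE hVU) x hV, ← germ_smul]
    refine (congr($(M.presheaf.germ_stalkSpecializes hV h) _)).trans ?_
    refine (germ_smul _ _ _ _).trans ?_
    exact congr($((germ_stalkSpecializes_apply h hV _).symm) •
      $((congr($(M.presheaf.germ_stalkSpecializes hV h) s)).symm))

lemma specialize_germ (hx : x ∈ W) (s : Γ(M, W)) :
    specialize h (M.presheaf.germ W x hx s) = M.presheaf.germ W y (h.mem_open W.isOpen hx) s :=
  congr($(M.presheaf.germ_stalkSpecializes hx h) s)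

lemma specialize_stalkMap (f : M ⟶ N) (s : M.presheaf.stalk x) :
    specialize h (stalkMap x f s) = stalkMap y f (specialize h s) :=
  congr($(TopCat.Presheaf.stalkSpecializes_stalkFunctor_map f.mapPresheaf h) s).symm

lemma HasLocalBases.specialize_injective (hM : M.HasLocalBases)
    (hinj : Function.Injective (X.presheaf.stalkSpecializes h)) :
    Function.Injective (specialize (M := M) h) := by
  obtain ⟨W, m, e, hxW, he⟩ := hM x
  have hyW := h.mem_open W.isOpen hxW
  rw [injective_iff_map_eq_zero]
  intro s hs
  obtain ⟨v, rfl⟩ := (he.bijective_stalk hxW).2 s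
  simp only [map_sum, map_smulₛₗ, specialize_germ] at hs
  have h0 := (he.bijective_stalk hyW).1 (hs.trans (by simp : _ = ∑ i, (0 : X.presheaf.stalk y) • _))
  refine Finset.sum_eq_zero fun i _ ↦ ?_
  rw [hinj ((congrFun h0 i).trans (map_zero _).symm), zero_smul]

lemma HasLocalBases.exists_specialize_eq (hM : M.HasLocalBases)
    (hloc : ∀ r : X.presheaf.stalk y, ∃ s r' : X.presheaf.stalk x,
      IsUnit (X.presheaf.stalkSpecializes h s) ∧
      X.presheaf.stalkSpecializes h r' = X.presheaf.stalkSpecializes h s * r)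
    (t : M.presheaf.stalk y) : ∃ (s : X.presheaf.stalk x) (t' : M.presheaf.stalk x),
      IsUnit (X.presheaf.stalkSpecializes h s) ∧
      specialize h t' = X.presheaf.stalkSpecializes h s • t := by
  obtain ⟨W, m, e, hxW, he⟩ := hM x
  have hyW := h.mem_open W.isOpen hxW
  obtain ⟨v, rfl⟩ := (he.bijective_stalk hyW).2 t
  choose s r' hs hr using fun i ↦ hloc (v i)
  classical
  refine ⟨∏ i, s i, ∑ i, ((∏ j ∈ Finset.univ.erase i, s j) * r' i) • M.presheaf.germ W x hxW (e i),
    ?_, ?_⟩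
  · rw [map_prod]
    exact IsUnit.prod_univ_iff.mpr hs
  · rw [map_sum, Finset.smul_sum]
    refine Finset.sum_congr rfl fun i _ ↦ ?_
    rw [map_smulₛₗ, specialize_germ, smul_smul]
    congr 1
    change X.presheaf.stalkSpecializes h _ = _
    rw [map_mul, hr, ← mul_assoc, ← map_mul, Finset.prod_erase_mul _ _ (Finset.mem_univ i)]

variable {M₁ M₂ M₃ : X.Modules} {f : M₁ ⟶ M₂} {g : M₂ ⟶ M₃}

/-- Exactness of a complex of locally free sheaves at a point is inherited by generizations. -/
lemma exact_stalkMap_of_specializes (h₂ : M₂.HasLocalBases) (h₃ : M₃.HasLocalBases)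
    (hinj : Function.Injective (X.presheaf.stalkSpecializes h))
    (hloc : ∀ r : X.presheaf.stalk y, ∃ s r' : X.presheaf.stalk x,
      IsUnit (X.presheaf.stalkSpecializes h s) ∧
      X.presheaf.stalkSpecializes h r' = X.presheaf.stalkSpecializes h s * r)
    (hx : Function.Exact (stalkMap x f) (stalkMap x g)) (hfg : f ≫ g = 0) :
    Function.Exact (stalkMap y f) (stalkMap y g) := by
  refine fun t ↦ ⟨fun ht ↦ ?_, ?_⟩
  · obtain ⟨s, t', hs, e⟩ := h₂.exists_specialize_eq h hloc t
    -- Clearing denominators replaces `t` by a unit multiple coming from `x`, and injectivity makes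
    -- the lift a cocycle already at `x`.
    have h0 : stalkMap x g t' = 0 := h₃.specialize_injective h hinj (by
      rw [specialize_stalkMap, e, _root_.map_smul, ht, smul_zero, map_zero])
    obtain ⟨u, rfl⟩ := (hx t').mp h0
    obtain ⟨r, hr⟩ := hs
    refine ⟨(↑r⁻¹ : X.presheaf.stalk y) • specialize h u, ?_⟩
    rw [_root_.map_smul, ← specialize_stalkMap, e, ← hr, smul_smul, Units.inv_mul, one_smul]
  · rintro ⟨u, rfl⟩
    rw [← stalkMap_comp_apply, hfg, stalkMap_zero]
    rfl

/-- If a complex of locally free sheaves is exact at a generization `y` of `x`, then its cohomology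
at `x` is annihilated by an element that is invertible at `y`. -/
lemma exists_smul_mem_range_stalkMap [IsNoetherianRing (X.presheaf.stalk x)]
    (h₁ : M₁.HasLocalBases) (h₂ : M₂.HasLocalBases)
    (hinj : Function.Injective (X.presheaf.stalkSpecializes h))
    (hloc : ∀ r : X.presheaf.stalk y, ∃ s r' : X.presheaf.stalk x,
      IsUnit (X.presheaf.stalkSpecializes h s) ∧
      X.presheaf.stalkSpecializes h r' = X.presheaf.stalkSpecializes h s * r)
    (hy : Function.Exact (stalkMap y f) (stalkMap y g)) :
    ∃ s, IsUnit (X.presheaf.stalkSpecializes h s) ∧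
      ∀ z, stalkMap x g z = 0 → ∃ u, stalkMap x f u = s • z := by
  have hfin : Module.Finite (X.presheaf.stalk x) (M₂.presheaf.stalk x) := by
    obtain ⟨W, m, e, hxW, he⟩ := h₂ x
    exact .of_basis (he.stalkBasis hxW)
  -- The cocycles at `x` are finitely generated, so the product of the multipliers of the generators
  -- serves all of them.
  obtain ⟨S, hS⟩ := (isNoetherian_def.mp inferInstance (LinearMap.ker (stalkMap x g)) :
    (LinearMap.ker (stalkMap x g)).FG)
  have key (z : S) : ∃ s, IsUnit (X.presheaf.stalkSpecializes h s) ∧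
      ∃ u, stalkMap x f u = s • z.1 := by
    have hz : stalkMap x g z = 0 := hS.le (Submodule.subset_span z.2)
    obtain ⟨u, hu⟩ := (hy (specialize h z.1)).mp (by rw [← specialize_stalkMap, hz, map_zero])
    obtain ⟨s, u', hs, e⟩ := h₁.exists_specialize_eq h hloc u
    refine ⟨s, hs, u', h₂.specialize_injective h hinj ?_⟩
    rw [specialize_stalkMap, e, _root_.map_smul, hu, map_smulₛₗ]
  choose s hs u hu using key
  classical
  refine ⟨∏ z, s z, ?_, fun z hz ↦ ?_⟩
  · rw [map_prod]
    exact IsUnit.prod_univ_iff.mpr hs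
  · have hle : LinearMap.ker (stalkMap x g) ≤
        (LinearMap.range (stalkMap x f)).comap ((∏ z, s z) • LinearMap.id) := by
      rw [← hS, Submodule.span_le]
      intro z hz
      refine ⟨(∏ j ∈ Finset.univ.erase ⟨z, hz⟩, s j) • u ⟨z, hz⟩, ?_⟩
      rw [_root_.map_smul, hu, smul_smul, Finset.prod_erase_mul _ _ (Finset.mem_univ _)]
      rfl
    exact hle hz

variable {K : CochainComplex X.Modules ℤ}

/-- The stalk functor is exact, hence commutes with homology. -/
lemma mem_support_homology_iff {a b c : ℤ} (hab : a + 1 = b) (hbc : b + 1 = c) :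
    x ∈ (K.homology b).support ↔ ¬ Function.Exact (stalkMap x (K.d a b)) (stalkMap x (K.d b c)) := by
  have h1 : Function.Exact (stalkMap x (K.d a b)) (stalkMap x (K.d b c)) ↔
      ((K.sc' a b c).map (stalkAb x)).Exact :=
    (ShortComplex.ab_exact_iff_function_exact ((K.sc' a b c).map (stalkAb x))).symm
  have e : ((K.sc' a b c).map (stalkAb x)).homology ≅ (stalkAb x).obj (K.homology b) :=
    (K.sc' a b c).mapHomologyIso (stalkAb x) ≪≫ (stalkAb x).mapIso
      (ShortComplex.homologyMapIso (K.isoSc' a b c (by simp; omega) (by simp; omega))).symm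
  rw [h1, ShortComplex.exact_iff_isZero_homology, e.isZero_iff]
  rw [AddCommGrpCat.isZero_iff_subsingleton, not_subsingleton_iff_nontrivial]
  rfl

lemma support_eq_of_iso (e : M ≅ N) : M.support = N.support := by
  ext x
  have e' := ((stalkAb x).mapIso e).addCommGroupIsoToAddEquiv
  exact e'.toEquiv.nontrivial_congr

end AlgebraicGeometry.Scheme.Modules

/-- Irreducible closed subsets of a scheme correspond to their generic points. The whole closure of
`y` has to lie in `Z`, as `Z` is not assumed closed. -/
lemma le_coheight_of_le_topologicalCodim {X : Scheme.{u}} {Z : Set X} {c : ℕ∞}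
    (hZ : c ≤ topologicalCodim Z) (y : X) (hy : closure {y} ⊆ Z) : c ≤ Order.coheight y := by
  have h := hZ.trans (iInf₂_le (irreducibleSetEquivPoints.symm y) hy)
  refine h.trans_eq ?_
  exact Order.coheight_orderIso (irreducibleSetEquivPoints (α := X)).symm y

/-! ### Regular sequences annihilating the cohomology on projective space -/

namespace AlgebraicGeometry

lemma Scheme.Modules.isZero_sheafHom {X : Scheme.{u}} {M : X.Modules} (hM : IsZero M)
    (N : X.Modules) : IsZero (sheafHom M N) := by
  rw [IsZero.iff_id_eq_zero, ← sheafHomMap_id, (IsZero.iff_id_eq_zero M).mp hM]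
  exact sheafHomMap_zero_left _

lemma Scheme.Modules.nonempty_sheafExt_iso {X : Scheme.{u}} {M M' : X.Modules} (e : M ≅ M')
    (N : X.Modules) (i : ℕ) : Nonempty (sheafExt i M N ≅ sheafExt i M' N) := by
  let I := InjectiveResolution.of N
  obtain ⟨φ⟩ := nonempty_homology_homComplex_iso I e i
  exact ⟨sheafExtIso i M N I ≪≫ φ ≪≫ (sheafExtIso i M' N I).symm⟩

namespace projectiveSpace

variable {k : Type u} [Field k] {n : ℕ}

/-- The isomorphism of `k[Y₁, …, Yₙ]` with the ring of functions of a standard chart. -/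
def chartRingEquiv (i : Fin (n + 1)) :
    MvPolynomial (Fin n) k ≃+* Γ(projectiveSpace k n, chart k i) :=
  RingEquiv.ofBijective (chartRingHom k i) (chartRingHom_bijective k i)

instance (i : Fin (n + 1)) : IsDomain Γ(projectiveSpace k n, chart k i) :=
  MulEquiv.isDomain _ (chartRingEquiv i).symm.toMulEquiv

instance (x : projectiveSpace k n) :
    IsNoetherianRing ((projectiveSpace k n).presheaf.stalk x) := by
  obtain ⟨i, hx⟩ := exists_mem_chart k x
  have hA : IsNoetherianRing Γ(projectiveSpace k n, chart k i) :=
    isNoetherianRing_of_ringEquiv _ (chartRingEquiv i)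
  let _ := TopCat.Presheaf.algebra_section_stalk (projectiveSpace k n).presheaf
    (⟨x, hx⟩ : chart k i)
  have hloc := (isAffineOpen_chart k i).isLocalization_stalk ⟨x, hx⟩
  exact IsLocalization.isNoetherianRing
    ((isAffineOpen_chart k i).primeIdealOf ⟨x, hx⟩).asIdeal.primeCompl _ hA

/-- The cohomology in degree `0` of a complex of locally free sheaves on projective space is locally
annihilated by regular sequences whose length is the codimension of its support. -/
lemma exists_isWeaklyRegular_annihilates {K : CochainComplex (projectiveSpace k n).Modules ℤ}
    (hK : ∀ m, (K.X m).HasLocalBases) {c : ℕ} (hc : c ≤ topologicalCodim (K.homology 0).support)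
    (x : projectiveSpace k n) :
    ∃ rs : List ((projectiveSpace k n).presheaf.stalk x), rs.length = c ∧
      RingTheory.Sequence.IsWeaklyRegular ((projectiveSpace k n).presheaf.stalk x) rs ∧
      ∀ r ∈ rs, ∀ z, Scheme.Modules.stalkMap x (K.d 0 1) z = 0 →
        ∃ u, Scheme.Modules.stalkMap x (K.d (-1) 0) u = r • z := by
  -- `I` is the annihilator of the stalk at `x` of the cohomology in degree `0`, in terms of
  -- cocycles and boundaries.
  let I : Ideal ((projectiveSpace k n).presheaf.stalk x) :=
    { carrier := {r | ∀ z, Scheme.Modules.stalkMap x (K.d 0 1) z = 0 →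
        ∃ u, Scheme.Modules.stalkMap x (K.d (-1) 0) u = r • z}
      zero_mem' z _ := ⟨0, by rw [map_zero, zero_smul]⟩
      add_mem' {r s} hr hs z hz := by
        obtain ⟨u, hu⟩ := hr z hz
        obtain ⟨v, hv⟩ := hs z hz
        exact ⟨u + v, by rw [map_add, hu, hv, add_smul]⟩
      smul_mem' r s hs z hz := by
        obtain ⟨u, hu⟩ := hs z hz
        exact ⟨r • u, by rw [map_smul, hu, smul_eq_mul, mul_smul]⟩ }
  obtain ⟨i, hx⟩ := exists_mem_chart k x
  have hI : c ≤ I.height := by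
    rw [Ideal.height_eq_inf_minimalPrimes]
    refine le_iInf₂ fun q hq ↦ ?_
    have := hq.isPrime
    obtain ⟨y, hyx, hy, hs⟩ := (isAffineOpen_chart k i).exists_specializes_of_isPrime hx q
    rw [← hy]
    refine le_coheight_of_le_topologicalCodim hc y fun z hz ↦ ?_
    rw [Scheme.Modules.mem_support_homology_iff (a := -1) (b := 0) (c := 1) rfl rfl]
    -- Exactness at a point `z` of the closure of `y` would pass to `y`, so some element of `I`
    -- would be invertible at `y`; but `I` lies in the prime `q` defining `y`.
    intro hex
    obtain ⟨j, hz'⟩ := exists_mem_chart k z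
    have hyz : y ⤳ z := specializes_iff_mem_closure.mpr hz
    have hexy := Scheme.Modules.exact_stalkMap_of_specializes hyz (hK 0) (hK 1)
      ((isAffineOpen_chart k j).stalkSpecializes_injective hz' hyz)
      ((isAffineOpen_chart k j).exists_stalkSpecializes_eq hz' hyz) hex (K.d_comp_d _ _ _)
    obtain ⟨s, hu, hsI⟩ := Scheme.Modules.exists_smul_mem_range_stalkMap hyx (hK (-1)) (hK 0)
      ((isAffineOpen_chart k i).stalkSpecializes_injective hx hyx)
      ((isAffineOpen_chart k i).exists_stalkSpecializes_eq hx hyx) hexy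
    exact hs s hu (hq.le hsI)
  obtain ⟨rs, h1, h2, h3⟩ :=
    (isAffineOpen_chart k i).exists_isWeaklyRegular hx (chartRingEquiv i) I hI
  exact ⟨rs, h1, h3, h2⟩

end projectiveSpace

end AlgebraicGeometry

end

/-! ### The duality statement -/

theorem lemma3 {k : Type u} [Field k] [IsAlgClosed k] [CharZero k] (n c p q : ℕ) (hc : 1 ≤ c)
    (F : (projectiveSpace k n).Modules) (hF : F.IsCoherent)
    (hcodim : topologicalCodim F.support = c)
    (C : CochainComplex (projectiveSpace k n).Modules ℤ)
    (hC : Scheme.Modules.IsFreeMonad C (-p) q F)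
    (hExt : ∀ i : ℕ, c < i →
      IsZero (Scheme.Modules.sheafExt i F (projectiveSpace.canonicalSheaf k n))) :
    Scheme.Modules.IsFreeMonad
      (Scheme.Modules.dualComplex C (projectiveSpace.canonicalSheaf k n) c) (-q - c) (p - c)
      (Scheme.Modules.sheafExt c F (projectiveSpace.canonicalSheaf k n)) := by
  have hω := projectiveSpace.isLineBundle_canonicalSheaf k (n := n)
  have hb (m : ℤ) := (hC.isSumOfLineBundles m).hasLocalBases
  let I := InjectiveResolution.of (projectiveSpace.canonicalSheaf k n)
  have hI (m : ℤ) (j : ℕ) : IsZero ((Scheme.Modules.homComplex I (C.X m)).homology (j + 1)) :=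
    have := (hb m).preservesEpimorphisms
    Scheme.Modules.isZero_homology_homComplex I j
  obtain ⟨e⟩ := hC.nonempty_iso
  -- Dimension shifting needs a positive ℰxt index `i + c`, which is written as `a + 1`.
  have key (i : ℤ) (a : ℕ) (ha : i + c = a + 1) : Nonempty
      ((Scheme.Modules.dualComplex C (projectiveSpace.canonicalSheaf k n) c).homology i ≅
        Scheme.Modules.sheafExt (a + 1) F (projectiveSpace.canonicalSheaf k n)) := by
    obtain ⟨φ⟩ := Scheme.Modules.nonempty_homology_dualComplex_iso hI hC.isZero_of_gt
      hC.exactAt c i a ha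
    obtain ⟨ψ⟩ := Scheme.Modules.nonempty_sheafExt_iso e (projectiveSpace.canonicalSheaf k n) (a + 1)
    exact ⟨φ ≪≫ ψ⟩
  refine ⟨fun i ↦ (hC.isSumOfLineBundles _).sheafHom hω,
    fun i hi ↦ Scheme.Modules.isZero_sheafHom (hC.isZero_of_gt _ (by omega)) _,
    fun i hi ↦ Scheme.Modules.isZero_sheafHom (hC.isZero_of_lt _ (by omega)) _, fun i hi ↦ ?_, ?_⟩
  -- Negative degrees follow from the codimension, positive ones from the vanishing of ℰxt above
  -- `c`.
  · rcases lt_or_gt_of_ne hi with hi | hi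
    · exact Scheme.Modules.exactAt_dualComplex_of_lt hb hC.isZero_of_gt hC.exactAt hω
        (projectiveSpace.exists_isWeaklyRegular_annihilates hb
          (by rw [Scheme.Modules.support_eq_of_iso e, hcodim])) hi
    · obtain ⟨a, ha⟩ : ∃ a : ℕ, i + c = a + 1 := ⟨(i + c - 1).toNat, by omega⟩
      obtain ⟨φ⟩ := key i a ha
      rw [HomologicalComplex.exactAt_iff_isZero_homology]
      exact (hExt (a + 1) (by omega)).of_iso φ
  -- Since `c ≥ 1`, degree `0` is within reach of `key`.
  · obtain ⟨a, rfl⟩ : ∃ a, c = a + 1 := ⟨c - 1, by omega⟩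
    exact key 0 a (by simp)
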